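/- **Setting.** A *multicast problem* consists of a finite directed acyclic graph (nodes, links), a finite set $S$ of sessions, an originating node $O(s)$ and a set $D(s)$ of requesting nodes for each $s\in S$. A *secure* multicast problem has in addition a family of adversaries $r$, each with a set $A_r$ of sessions and a set $B_r$ of links that it observes. A *network code* consists of independent, uniformly distributed source symbols $T_s$ on finite nonempty alphabets, independent finite-valued internal randomness $V_v$ at each node $v$ (independent of the sources), messages $W_e$ in finite alphabets such that $W_e$ is a function of the source symbols at the tail of $e$, the messages entering the tail and the internal randomness there, and decoders at the requesting nodes, which use what is available at the node. $|w_e|$, $|w_s|$ denote alphabet sizes, $P_e$ is the probability that some receiver decodes some requested session wrongly, and logarithms are to base 2. A rate-capacity tuple $(\lambda_s,\omega_e)$ is *admissible* if some network code has $H(W_e)\le\log|w_e|\le\omega_e$ for all $e$, $H(T_s)=\log|w_s|\ge\lambda_s$ for all $s$, $P_e=0$, and $I(T_{A_r};W_{B_r})=0$ for all $r$. It is *achievable* if there are network codes $\Phi^{(n)}$ and constants $r(n)>0$ such that the limits below exist and $\lim \frac{H(W_e^{(n)})}{r(n)}\le\lim \frac{\log|w_e^{(n)}|}{r(n)}\le\omega_e$,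 $\lim \frac{H(T_s^{(n)})}{r(n)}=\lim \frac{\log|w_s^{(n)}|}{r(n)}\ge\lambda_s$, $\lim P_e(\Phi^{(n)})=0$ and $\lim \frac{1}{r(n)}I(T_{A_r}^{(n)};W_{B_r}^{(n)})=0$. **Construction.** Let $\mathcal P$ be a multicast problem without secrecy constraints, and let $c_s$ ($s\in S$) be real numbers; put $d=2\sum_{s}c_s$. The secure problem $\mathcal P^\star$ keeps the nodes and links of $\mathcal P$ and has one new source node holding a single session $X$ of rate $d$, a new node $P_0^s$ with a link of capacity $c_s$ to $O(s)$ for each session $s$, and, for each $s\in S$ and $u\in D(s)$, three new nodes (an encryption node, a decryption node and a sink) and the links: $W_1$ (source to encryption node, capacity $c_s$), $W_2$ (source to sink, capacity $d-c_s$), $K$ ($P_0^s$ to encryption node), $W_3$ (encryption to decryption node), $W_4$ ($u$ to decryption node), $W_5$ (decryption node to sink), the last four of capacity $c_s$. Nothing is generated at $O(s)$ any more; all new sinks request $X$; for each copy there is one adversary, who observes only $W_3$ of that copy and must learn nothing about $X$. Links of $\mathcal P$ keep their capacities $\omega_e$. **Theorem.** 1. For every multicast problem $\mathcal P$ without secrecy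 constraints and every tuple $(\lambda,\omega)$ for it, $(\lambda,\omega)$ is admissible for $\mathcal P$ if and only if the tuple of the single-source, single-session secure problem $\mathcal P^\star$ described above, with $c_s=\log_2\lceil 2^{\lambda_s}\rceil$, is admissible for $\mathcal P^\star$. (So $c_s=\lambda_s$ whenever $2^{\lambda_s}$ is a positive integer.) 2. For every $N$, let $\mathcal G^\dagger$ be the following multicast problem with a single source node and two sessions $S_0,S_1$, in which every receiver requests $S_0$ and some receivers also request $S_1$. Given $h:2^{\{1,\dots,N\}}\to\mathbb R$ with $h(\emptyset)=0$, write $h(i)=h(\{i\})$, $h(\mathcal N)=h(\{1,\dots,N\})$; the rates of $S_0,S_1$ are $\sum_i h(i)$ and $h(\mathcal N)$. * Links $U_i$ of capacity $h(i)$ go from the source to nodes $u_i$. A link of capacity $h(\mathcal N)$ goes from the source to a node from which links $V_i$ of capacity $h(i)$ go to nodes $v_i$. The nodes $u_i$, $v_i$ serve to duplicate $U_i,V_i$; "receives $U_i$ (or $V_i$)" means that there is a link of capacity $h(i)$ from $u_i$ (or $v_i$). One receiver of $S_0$ receives all $U_i$; one receiver of $S_0,S_1$ receives all $U_i$ and all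 $V_i$. * For each $\emptyset\ne\alpha\subseteq\{1,\dots,N\}$: a node receiving $V_j$, $j\in\alpha$, with a link of capacity $h(\alpha)$ to a receiver of $S_0,S_1$, which also receives all $U_j$ and has a link of capacity $h(\mathcal N)-h(\alpha)$ from the source. * For each $\emptyset\ne\alpha\subset\{1,\dots,N\}$ and $i\notin\alpha$: a node receiving $U_i$ and $V_i$ emits $W_1$, of capacity $h(i)$, to a relay, with links of capacity $h(i)$ to nodes $P_0$ and $P_1$. $P_0$ also receives a link $W_2$ of capacity $h(i)$ from $u_i$, and has a link of capacity $2h(i)$ to a receiver of $S_0,S_1$, which also receives $U_j$, $j\ne i$, and has a link of capacity $h(\mathcal N)-h(i)$ from the source. A node receiving $V_j$, $j\in\alpha\cup\{i\}$, has a link of capacity $h(\alpha\cup\{i\})-h(\alpha)$ to $P_1$; $P_1$ also receives $V_j$, $j\in\alpha$, and has a link $W_3$ of capacity $h(i)$ to a receiver of $S_0$, which also receives $U_j$, $j\neq i$. Then the tuple of the secure problem $(\mathcal G^\dagger)^\star$ obtained from these rates and capacities, with $(c_0,c_1)=\left(\sum_i h(i),h(\mathcal N)\right)$ (a tuple linear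 in $h$), is achievable for $(\mathcal G^\dagger)^\star$ if and only if $h$ is almost entropic, i.e. a pointwise limit of functions $\alpha\mapsto H(X_i,i\in\alpha)$ with $X_1,\dots,X_N$ jointly distributed discrete random variables. -/

import Mathlib

open Filter Topology

/-! ## Entropy on finite probability spaces (in bits) -/

/-- Probability that the random variable `X` takes the value `a`, where `p` is the mass function
of a finite sample space. -/
noncomputable def probEq {Ω A : Type} [Fintype Ω] (p : Ω → ℝ) (X : Ω → A) (a : A) : ℝ :=
  open Classical in ∑ ω with X ω = a, p ω

/-- Shannon entropy `H(X)` in bits, `- ∑ₐ P(X = a) log₂ P(X = a)`, the sum running over the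
finitely many values `a` of `X`. -/
noncomputable def entropy {Ω A : Type} [Fintype Ω] (p : Ω → ℝ) (X : Ω → A) : ℝ :=
  open Classical in
  (∑ a ∈ Finset.univ.image X, Real.negMulLog (probEq p X a)) / Real.log 2

/-- Mutual information `I(X ; Y) = H(X) + H(Y) - H(X, Y)`. -/
noncomputable def mutualInfo {Ω A B : Type} [Fintype Ω] (p : Ω → ℝ) (X : Ω → A) (Y : Ω → B) : ℝ :=
  entropy p X + entropy p Y - entropy p (fun ω => (X ω, Y ω))

/-- `h` is entropic: there are jointly distributed discrete random variables `X₁, …, X_N` such that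
`H(Xᵢ, i ∈ α) = h α` for every `α`. -/
def Entropic {N : ℕ} (h : Finset (Fin N) → ℝ) : Prop :=
  ∃ (Ω : Type) (_ : Fintype Ω) (p : Ω → ℝ) (A : Fin N → Type) (X : (i : Fin N) → Ω → A i),
    (∀ ω, 0 ≤ p ω) ∧ ∑ ω, p ω = 1 ∧
      ∀ α : Finset (Fin N), entropy p (fun ω (i : α) => X i ω) = h α

/-- `h` is almost entropic: it is the limit of a sequence of entropic functions. -/
def AlmostEntropic {N : ℕ} (h : Finset (Fin N) → ℝ) : Prop :=
  ∃ g : ℕ → Finset (Fin N) → ℝ, (∀ n, Entropic (g n)) ∧ Tendsto g atTop (𝓝 h)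

/-! ## Multicast problems -/

/-- A multicast problem: a finite directed acyclic (multi)graph, a finite set of sessions, the node
at which each session originates, and the set of nodes which request it. -/
structure MulticastProblem where
  Node : Type
  Edge : Type
  Session : Type
  [fintypeNode : Fintype Node]
  [fintypeEdge : Fintype Edge]
  [fintypeSession : Fintype Session]
  tail : Edge → Node
  head : Edge → Node
  acyclic : ∀ v, ¬ Relation.TransGen (fun a b => ∃ e, tail e = a ∧ head e = b) v v
  origin : Session → Node
  dest : Session → Set Node

attribute [instance] MulticastProblem.fintypeNode MulticastProblem.fintypeEdge
  MulticastProblem.fintypeSession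

/-- A secure multicast problem: a multicast problem together with a wiretapping pattern. Adversary
`r` observes the links in `tap r` and is interested in the sessions in `target r`. -/
structure SecureMulticastProblem extends MulticastProblem where
  Adversary : Type
  target : Adversary → Set Session
  tap : Adversary → Set Edge

/-- A multicast problem without secrecy constraints. -/
def MulticastProblem.withoutSecrecy (P : MulticastProblem) : SecureMulticastProblem where
  toMulticastProblem := P
  Adversary := Empty
  target := Empty.elim
  tap := Empty.elim

/-! ## Network codes -/

/-- Sample space of a network code: the source symbols together with the internal randomness of
the nodes. -/
abbrev Outcome (P : MulticastProblem) (Src : P.Session → Type) (Rnd : P.Node → Type) : Type :=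
  ((s : P.Session) → Src s) × ((v : P.Node) → Rnd v)

noncomputable instance (P : MulticastProblem) (Src : P.Session → Type) (Rnd : P.Node → Type)
    [∀ s, Fintype (Src s)] [∀ v, Fintype (Rnd v)] : Fintype (Outcome P Src Rnd) :=
  open Classical in inferInstance

/-- The outcomes `ω` and `ω'` look the same at node `v`: the sources originating at `v`, the
messages on the links entering `v`, and the internal randomness of `v` agree. -/
def SameView (P : MulticastProblem) {Src : P.Session → Type} {Msg : P.Edge → Type}
    {Rnd : P.Node → Type} (msg : (e : P.Edge) → Outcome P Src Rnd → Msg e) (v : P.Node)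
    (ω ω' : Outcome P Src Rnd) : Prop :=
  (∀ s, P.origin s = v → ω.1 s = ω'.1 s) ∧ (∀ e, P.head e = v → msg e ω = msg e ω') ∧
    ω.2 v = ω'.2 v

/-- A (possibly probabilistic) network code with its decoders. The message on a link is a function
of what is seen at the tail of the link; `est s v` is the estimate of the symbol of session `s`
formed at node `v`, a function of what is seen at `v`. -/
structure NetworkCode (P : MulticastProblem) where
  Src : P.Session → Type
  Msg : P.Edge → Type
  Rnd : P.Node → Type
  [fintypeSrc : ∀ s, Fintype (Src s)]
  [nonemptySrc : ∀ s, Nonempty (Src s)]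
  [fintypeMsg : ∀ e, Fintype (Msg e)]
  [fintypeRnd : ∀ v, Fintype (Rnd v)]
  rndProb : (v : P.Node) → Rnd v → ℝ
  rndProb_nonneg : ∀ v x, 0 ≤ rndProb v x
  rndProb_sum : ∀ v, ∑ x, rndProb v x = 1
  msg : (e : P.Edge) → Outcome P Src Rnd → Msg e
  msg_causal : ∀ e ω ω', SameView P msg (P.tail e) ω ω' → msg e ω = msg e ω'
  est : (s : P.Session) → P.Node → Outcome P Src Rnd → Src s
  est_causal : ∀ s v ω ω', SameView P msg v ω ω' → est s v ω = est s v ω'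

attribute [instance] NetworkCode.fintypeSrc NetworkCode.nonemptySrc NetworkCode.fintypeMsg
  NetworkCode.fintypeRnd

namespace NetworkCode

variable {P : MulticastProblem} (C : NetworkCode P)

/-- The law of the code: source symbols are uniform, and all source symbols and internal
randomness variables are mutually independent. -/
noncomputable def prob (ω : Outcome P C.Src C.Rnd) : ℝ :=
  (∏ s, (Fintype.card (C.Src s) : ℝ)⁻¹) * ∏ v, C.rndProb v (ω.2 v)

/-- Entropy `H(T_s)` of a source symbol. -/
noncomputable def srcEntropy (s : P.Session) : ℝ := entropy C.prob (fun ω => ω.1 s)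

/-- Entropy `H(W_e)` of a link message. -/
noncomputable def msgEntropy (e : P.Edge) : ℝ := entropy C.prob (C.msg e)

/-- `log₂` of the size of the alphabet of a source. -/
noncomputable def srcBits (s : P.Session) : ℝ := Real.logb 2 (Fintype.card (C.Src s))

/-- `log₂` of the size of the alphabet of a link message. -/
noncomputable def msgBits (e : P.Edge) : ℝ := Real.logb 2 (Fintype.card (C.Msg e))

/-- Probability that some receiver fails to reconstruct one of its requested sessions. -/
noncomputable def errorProb : ℝ :=
  open Classical in ∑ ω with ∃ s, ∃ v ∈ P.dest s, C.est s v ω ≠ ω.1 s, C.prob ω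

/-- The leakage `I(T_A ; W_B)`. -/
noncomputable def leakage (A : Set P.Session) (B : Set P.Edge) : ℝ :=
  mutualInfo C.prob (fun ω (s : A) => ω.1 s) (fun ω (e : B) => C.msg e ω)

end NetworkCode

namespace SecureMulticastProblem

/-- The rate-capacity tuple `(rate, cap)` is admissible: some zero-error, perfectly secure network
code satisfies `H(W_e) ≤ log |w_e| ≤ cap e` and `H(T_s) = log |w_s| ≥ rate s`. -/
def Admissible (Q : SecureMulticastProblem) (rate : Q.Session → ℝ) (cap : Q.Edge → ℝ) : Prop :=
  ∃ C : NetworkCode Q.toMulticastProblem,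
    (∀ e, C.msgEntropy e ≤ C.msgBits e ∧ C.msgBits e ≤ cap e) ∧
    (∀ s, C.srcEntropy s = C.srcBits s ∧ rate s ≤ C.srcBits s) ∧
    C.errorProb = 0 ∧
    ∀ r, C.leakage (Q.target r) (Q.tap r) = 0

/-- The rate-capacity tuple `(rate, cap)` is achievable: the requirements are met in the limit by a
sequence of network codes, after normalization by constants `r n > 0`. -/
def Achievable (Q : SecureMulticastProblem) (rate : Q.Session → ℝ) (cap : Q.Edge → ℝ) : Prop :=
  ∃ (C : ℕ → NetworkCode Q.toMulticastProblem) (r : ℕ → ℝ), (∀ n, 0 < r n) ∧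
    (∀ e, ∃ a b : ℝ, Tendsto (fun n => (C n).msgEntropy e / r n) atTop (𝓝 a) ∧
      Tendsto (fun n => (C n).msgBits e / r n) atTop (𝓝 b) ∧ a ≤ b ∧ b ≤ cap e) ∧
    (∀ s, ∃ b : ℝ, Tendsto (fun n => (C n).srcEntropy s / r n) atTop (𝓝 b) ∧
      Tendsto (fun n => (C n).srcBits s / r n) atTop (𝓝 b) ∧ rate s ≤ b) ∧
    Tendsto (fun n => (C n).errorProb) atTop (𝓝 0) ∧
    ∀ q, Tendsto (fun n => (C n).leakage (Q.target q) (Q.tap q) / r n) atTop (𝓝 0)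

end SecureMulticastProblem

/-! ## The secure problem attached to a multicast problem

One copy of the following network `G*` is used for every session `s` and every node `u` that
requests `s`:

* the source sends `W₁` (capacity `c`) to an encryption node and `W₂` (capacity `d - c`) to a sink;
* the node `P₀` sends `K` (capacity `c`) to the encryption node;
* the encryption node sends `W₃` (capacity `c`) to a decryption node; `W₃` is wiretapped;
* the node `P₁` sends `W₄` (capacity `c`) to the decryption node;
* the decryption node sends `W₅` (capacity `c`) to the sink, which requests the source message.

All copies share the source. The copies for one session `s` share `P₀`, which takes the place of the
source of session `s`: it feeds the node `origin s` of the given network through a link of capacity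
`c`. In the copy for `(s, u)` the node `P₁` is the node `u` of the given network. -/

/-- Nodes of the glued network, for a given node set `V`, session set `S` and set `I` of copies. -/
inductive GluedNode (V S I : Type) : Type
  | given (v : V)
  | source
  | keyGen (s : S)
  | encrypt (i : I)
  | decrypt (i : I)
  | sink (i : I)
  deriving Fintype

/-- Links of the glued network, for a given link set `E`, session set `S` and set `I` of copies. -/
inductive GluedEdge (E S I : Type) : Type
  | given (e : E)
  | keyOut (s : S)
  | key (i : I)
  | w1 (i : I)
  | w2 (i : I)
  | w3 (i : I)
  | w4 (i : I)
  | w5 (i : I)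
  deriving Fintype

namespace MulticastProblem

variable (P : MulticastProblem)

/-- The index set of the copies of `G*`: pairs of a session and a node that requests it. -/
def Copy : Type := {x : P.Session × P.Node // x.2 ∈ P.dest x.1}

noncomputable instance : Fintype P.Copy := by
  classical
  unfold Copy
  infer_instance

/-- Tails of the links of the glued network. -/
def gluedTail : GluedEdge P.Edge P.Session P.Copy → GluedNode P.Node P.Session P.Copy
  | .given e => .given (P.tail e)
  | .keyOut s => .keyGen s
  | .key i => .keyGen i.1.1
  | .w1 _ => .source
  | .w2 _ => .source
  | .w3 i => .encrypt i
  | .w4 i => .given i.1.2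
  | .w5 i => .decrypt i

/-- Heads of the links of the glued network. -/
def gluedHead : GluedEdge P.Edge P.Session P.Copy → GluedNode P.Node P.Session P.Copy
  | .given e => .given (P.head e)
  | .keyOut s => .given (P.origin s)
  | .key i => .encrypt i
  | .w1 i => .encrypt i
  | .w2 i => .sink i
  | .w3 i => .decrypt i
  | .w4 i => .decrypt i
  | .w5 i => .sink i

theorem glued_acyclic (v : GluedNode P.Node P.Session P.Copy) :
    ¬ Relation.TransGen (fun a b => ∃ e, P.gluedTail e = a ∧ P.gluedHead e = b) v v := by
  let lev : GluedNode P.Node P.Session P.Copy → ℕ := fun x => match x with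
    | .source => 0
    | .keyGen _ => 0
    | .given _ => 1
    | .encrypt _ => 2
    | .decrypt _ => 3
    | .sink _ => 4
  have key : ∀ a b, Relation.TransGen
      (fun a b => ∃ e, P.gluedTail e = a ∧ P.gluedHead e = b) a b →
      lev a < lev b ∨ ∃ x y, a = .given x ∧ b = .given y ∧
        Relation.TransGen (fun a b => ∃ e, P.tail e = a ∧ P.head e = b) x y := by
    have step : ∀ a b, (∃ e, P.gluedTail e = a ∧ P.gluedHead e = b) →
      lev a < lev b ∨ ∃ x y, a = .given x ∧ b = .given y ∧
        Relation.TransGen (fun a b => ∃ e, P.tail e = a ∧ P.head e = b) x y := by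
      rintro a b ⟨e, rfl, rfl⟩
      cases e with
      | given e => exact Or.inr ⟨_, _, rfl, rfl, .single ⟨e, rfl, rfl⟩⟩
      | _ => left; simp [gluedTail, gluedHead, lev]
    intro a b hab
    induction hab with
    | single h => exact step _ _ h
    | tail _ h ih =>
      rcases ih with ih | ⟨x, y, rfl, rfl, hxy⟩ <;>
        rcases step _ _ h with h' | ⟨x', y', hx, rfl, hxy'⟩
      · exact Or.inl (ih.trans h')
      · subst hx; exact Or.inl ih
      · exact Or.inl h'
      · cases hx; exact Or.inr ⟨_, _, rfl, rfl, hxy.trans hxy'⟩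
  intro hv
  rcases key v v hv with h | ⟨x, y, rfl, h, hxy⟩
  · exact lt_irrefl _ h
  · cases h; exact P.acyclic _ hxy

/-- The single-source, single-session secure multicast problem obtained from `P` by attaching
copies of `G*`. In every copy there is an adversary who sees only the message `W₃` of that copy and
must learn nothing about the source message. -/
noncomputable def secured : SecureMulticastProblem where
  Node := GluedNode P.Node P.Session P.Copy
  Edge := GluedEdge P.Edge P.Session P.Copy
  Session := Unit
  tail := P.gluedTail
  head := P.gluedHead
  acyclic := P.glued_acyclic
  origin _ := .source
  dest _ := Set.range .sink
  Adversary := P.Copy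
  target _ := Set.univ
  tap i := {.w3 i}

/-- The rate `d` of the source message, for key rates `c`; all sessions and copies use the same `d`.
If all `c s` are positive, then `0 < c s < d`. -/
noncomputable def securedRate (c : P.Session → ℝ) : P.secured.Session → ℝ :=
  fun _ => 2 * ∑ s, c s

/-- Link capacities of the glued network: `c s` is the key rate `c` in the copies of `G*` for
session `s`, and links of the given network keep their capacities. -/
noncomputable def securedCap (c : P.Session → ℝ) (cap : P.Edge → ℝ) : P.secured.Edge → ℝ
  | .given e => cap e
  | .keyOut s => c s
  | .key i => c i.1.1
  | .w1 i => c i.1.1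
  | .w2 i => 2 * (∑ s, c s) - c i.1.1
  | .w3 i => c i.1.1
  | .w4 i => c i.1.1
  | .w5 i => c i.1.1

end MulticastProblem

/-! ## The single-source, two-session incremental multicast network `G†`

Sessions are `0` (rate `∑ᵢ h(i)`) and `1` (rate `h(all)`). Every receiver requests session `0`, some
also request session `1`. -/

/-- Index set of the type 1 subnetworks: nonempty sets `α`. -/
abbrev Type1 (N : ℕ) : Type := {α : Finset (Fin N) // α.Nonempty}

/-- Index set of the type 2 subnetworks: pairs of a nonempty set `α` and an element `i ∉ α`. -/
abbrev Type2 (N : ℕ) : Type := {x : Finset (Fin N) × Fin N // x.1.Nonempty ∧ x.2 ∉ x.1}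

/-- Nodes of `G†`. -/
inductive DaggerNode (N : ℕ) : Type
  /-- the source node, at which both sessions originate -/
  | source
  /-- the node that emits `V₁, …, V_N` -/
  | split
  /-- the nodes that duplicate `Uᵢ` and `Vᵢ` -/
  | u (i : Fin N)
  | v (i : Fin N)
  /-- receiver of session `0` fed by `U₁, …, U_N` -/
  | recv0
  /-- receiver of sessions `0` and `1` fed by `U₁, …, U_N, V₁, …, V_N` -/
  | recv01
  /-- type 1 subnetwork: intermediate node and receiver of sessions `0` and `1` -/
  | mid (t : Type1 N)
  | recv1 (t : Type1 N)
  /-- type 2 subnetwork: the node that mixes `Uᵢ` and `Vᵢ` into `W₁` and the one duplicating `W₁` -/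
  | mix (t : Type2 N)
  | relay (t : Type2 N)
  /-- upper part of a type 2 subnetwork: the node `P₀` and a receiver of sessions `0` and `1` -/
  | p0 (t : Type2 N)
  | upper (t : Type2 N)
  /-- lower part of a type 2 subnetwork: a node seeing `V_α, Vᵢ`, the node `P₁`, and a receiver of
  session `0` -/
  | cond (t : Type2 N)
  | p1 (t : Type2 N)
  | lower (t : Type2 N)
  deriving Fintype

set_option synthInstance.maxSize 2000 in
set_option synthInstance.maxHeartbeats 400000 in
/-- Links of `G†`. -/
inductive DaggerEdge (N : ℕ) : Type
  | toSplit
  | U (i : Fin N)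
  | V (i : Fin N)
  | recv0U (i : Fin N)
  | recv01U (i : Fin N)
  | recv01V (i : Fin N)
  /-- type 1 subnetworks -/
  | midV (t : Type1 N) (j : {j : Fin N // j ∈ t.1})
  | midOut (t : Type1 N)
  | recv1Src (t : Type1 N)
  | recv1U (t : Type1 N) (j : Fin N)
  /-- type 2 subnetworks, upper part -/
  | mixU (t : Type2 N)
  | mixV (t : Type2 N)
  | W1 (t : Type2 N)
  | W1p0 (t : Type2 N)
  | W1p1 (t : Type2 N)
  | W2 (t : Type2 N)
  | p0Out (t : Type2 N)
  | upperSrc (t : Type2 N)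
  | upperU (t : Type2 N) (j : {j : Fin N // j ≠ t.1.2})
  /-- type 2 subnetworks, lower part -/
  | condV (t : Type2 N) (j : {j : Fin N // j ∈ insert t.1.2 t.1.1})
  | condOut (t : Type2 N)
  | p1V (t : Type2 N) (j : {j : Fin N // j ∈ t.1.1})
  | W3 (t : Type2 N)
  | lowerU (t : Type2 N) (j : {j : Fin N // j ≠ t.1.2})
  deriving Fintype

/-- Tails of the links of `G†`. -/
def daggerTail {N : ℕ} : DaggerEdge N → DaggerNode N
  | .toSplit => .source
  | .U _ => .source
  | .V _ => .split
  | .recv0U i => .u i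
  | .recv01U i => .u i
  | .recv01V i => .v i
  | .midV _ j => .v j.1
  | .midOut t => .mid t
  | .recv1Src _ => .source
  | .recv1U _ j => .u j
  | .mixU t => .u t.1.2
  | .mixV t => .v t.1.2
  | .W1 t => .mix t
  | .W1p0 t => .relay t
  | .W1p1 t => .relay t
  | .W2 t => .u t.1.2
  | .p0Out t => .p0 t
  | .upperSrc _ => .source
  | .upperU _ j => .u j.1
  | .condV _ j => .v j.1
  | .condOut t => .cond t
  | .p1V _ j => .v j.1
  | .W3 t => .p1 t
  | .lowerU _ j => .u j.1

/-- Heads of the links of `G†`. -/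
def daggerHead {N : ℕ} : DaggerEdge N → DaggerNode N
  | .toSplit => .split
  | .U i => .u i
  | .V i => .v i
  | .recv0U _ => .recv0
  | .recv01U _ => .recv01
  | .recv01V _ => .recv01
  | .midV t _ => .mid t
  | .midOut t => .recv1 t
  | .recv1Src t => .recv1 t
  | .recv1U t _ => .recv1 t
  | .mixU t => .mix t
  | .mixV t => .mix t
  | .W1 t => .relay t
  | .W1p0 t => .p0 t
  | .W1p1 t => .p1 t
  | .W2 t => .p0 t
  | .p0Out t => .upper t
  | .upperSrc t => .upper t
  | .upperU t _ => .upper t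
  | .condV t _ => .cond t
  | .condOut t => .p1 t
  | .p1V t _ => .p1 t
  | .W3 t => .lower t
  | .lowerU t _ => .lower t

theorem dagger_acyclic {N : ℕ} (v : DaggerNode N) :
    ¬ Relation.TransGen (fun a b => ∃ e, daggerTail e = a ∧ daggerHead e = b) v v := by
  let lev : DaggerNode N → ℕ := fun x => match x with
    | .source => 0
    | .split => 1
    | .u _ => 2
    | .v _ => 2
    | .mid _ => 3
    | .mix _ => 3
    | .cond _ => 3
    | .relay _ => 4
    | .p0 _ => 5
    | .p1 _ => 5
    | .recv0 => 6
    | .recv01 => 6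
    | .recv1 _ => 6
    | .upper _ => 6
    | .lower _ => 6
  have key : ∀ a b, Relation.TransGen
      (fun a b => ∃ e, daggerTail e = a ∧ daggerHead e = b) a b → lev a < lev b := by
    have step : ∀ a b, (∃ e, daggerTail (N := N) e = a ∧ daggerHead e = b) → lev a < lev b := by
      rintro a b ⟨e, rfl, rfl⟩
      cases e <;> simp [daggerTail, daggerHead, lev]
    intro a b hab
    induction hab with
    | single h => exact step _ _ h
    | tail _ h ih => exact ih.trans (step _ _ h)
  exact fun hv => lt_irrefl _ (key v v hv)

/-- The nodes of `G†` that request a given session. Requests are incremental: every node that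
requests session `1` also requests session `0`. -/
def daggerDest {N : ℕ} (s : Fin 2) : Set (DaggerNode N) :=
  {.recv01} ∪ Set.range .recv1 ∪ Set.range .upper ∪
    if s = 0 then {.recv0} ∪ Set.range .lower else ∅

/-- The network `G†` with its connection requirement; it depends only on `N`. -/
def dagger (N : ℕ) : MulticastProblem where
  Node := DaggerNode N
  Edge := DaggerEdge N
  Session := Fin 2
  tail := daggerTail
  head := daggerHead
  acyclic := dagger_acyclic
  origin _ := .source
  dest := daggerDest

/-- The source rates in the tuple built from `h`. -/
def daggerRate {N : ℕ} (h : Finset (Fin N) → ℝ) : (dagger N).Session → ℝ :=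
  fun s : Fin 2 => if s = 0 then ∑ i, h {i} else h Finset.univ

/-- The link capacities in the tuple built from `h`; links that only forward messages get exactly
the capacity needed to forward what is received. -/
def daggerCap {N : ℕ} (h : Finset (Fin N) → ℝ) : (dagger N).Edge → ℝ
  | .toSplit => h Finset.univ
  | .U i => h {i}
  | .V i => h {i}
  | .recv0U i => h {i}
  | .recv01U i => h {i}
  | .recv01V i => h {i}
  | .midV _ j => h {j.1}
  | .midOut t => h t.1
  | .recv1Src t => h Finset.univ - h t.1
  | .recv1U _ j => h {j}
  | .mixU t => h {t.1.2}
  | .mixV t => h {t.1.2}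
  | .W1 t => h {t.1.2}
  | .W1p0 t => h {t.1.2}
  | .W1p1 t => h {t.1.2}
  | .W2 t => h {t.1.2}
  | .p0Out t => 2 * h {t.1.2}
  | .upperSrc t => h Finset.univ - h {t.1.2}
  | .upperU _ j => h {j.1}
  | .condV _ j => h {j.1}
  | .condOut t => h (insert t.1.2 t.1.1) - h t.1.1
  | .p1V _ j => h {j.1}
  | .W3 t => h {t.1.2}
  | .lowerU _ j => h {j.1}

/-! Part 1 rests on one-time pads. In the secured problem the source symbol of a session `s` turns
into a key, which is fed both to the given network and to the encryption nodes. The wiretapped `W₃`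
must not reveal `X`, and `W₂` is `c_s` bits too short to carry it, so a sink can recover `X` only if
`W₄`, and hence the node `u` of the given network, knows the key. A code for the given network
becomes a secure one by padding with a Latin square (`ZeroErrorSolvable.exists_securedCode`).
Conversely, submodularity and Fano's inequality give H(X) - H(W₂) - leakage - Fano term ≤ I(key; W₄)
(`key_agreement_inequality`). Here H(X) - H(W₂) ≥ `c_s`, while the key link has capacity `c_s`; in
the exact case this forces H(key | W₄) = 0. Freezing all other randomness at an outcome of positive
probability leaves a deterministic zero-error code (`ZeroErrorSolvable.of_secured_admissible`).
Alphabet sizes are integers, which is why `c_s` is the logarithm of a ceiling.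

For necessity in part 2 the same inequality shows that H(key | W₄) vanishes after normalization. The
randomness inside the given network is removed by averaging: revealing it does not increase this
conditional entropy on average, and one fixed value serves all copies at once
(`exists_fixedVar_dest`). By compactness the normalized joint entropies accumulate at a polymatroid
`g` that obeys the network constraints exactly (`exists_limit_polymatroid`). On G† the type 1
subnetworks give g(V_α) ≥ h(α) and the type 2 subnetworks give g(V_{α∪i}) - g(V_α) ≤ h(α∪i) - h(α),
so g(V_α) = h(α). Before the limit the `V_i` are genuine random variables, so `h` is a limit of
positive multiples of entropic functions; such multiples are almost entropic
(`Entropic.smul_mem_closure`).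

For sufficiency, an entropic function is a limit of normalized quasi-uniform ones, obtained by
randomly permuting a list with prescribed frequencies and applying Stirling's formula
(`Entropic.mem_closure`). Quasi-uniform variables have conditional alphabets of exact integer size,
so G† has a zero-error code that meets the prescribed capacities (`zeroErrorSolvable_dagger`). Part
1 secures it, and linearity of the tuple in `h` allows passage to the limit. -/

/-! ## Entropy inequalities -/

/-- `p` is a probability mass function on a finite type. -/
structure IsMass {Ω : Type} [Fintype Ω] (p : Ω → ℝ) : Prop where
  nonneg : ∀ ω, 0 ≤ p ω
  sum_one : ∑ ω, p ω = 1

/-- The variable `Y` is a function of the variable `X`. -/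
def Determines {Ω A B : Type} (X : Ω → A) (Y : Ω → B) : Prop :=
  ∀ ω ω', X ω = X ω' → Y ω = Y ω'

section Entropy

variable {Ω A B C D : Type} [Fintype Ω] {p : Ω → ℝ}

theorem probEq_nonneg (hp : IsMass p) (X : Ω → A) (a : A) : 0 ≤ probEq p X a :=
  Finset.sum_nonneg fun ω _ => hp.nonneg ω

theorem le_probEq (hp : IsMass p) (X : Ω → A) (ω : Ω) : p ω ≤ probEq p X (X ω) := by
  classical
  exact Finset.single_le_sum (f := p) (fun ω _ => hp.nonneg ω) (by simp)

theorem probEq_pos (hp : IsMass p) (X : Ω → A) {ω : Ω} (h : 0 < p ω) : 0 < probEq p X (X ω) :=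
  h.trans_le (le_probEq hp X ω)

theorem probEq_le_one (hp : IsMass p) (X : Ω → A) (a : A) : probEq p X a ≤ 1 := by
  classical
  rw [← hp.sum_one]
  exact Finset.sum_le_sum_of_subset_of_nonneg (Finset.filter_subset _ _)
    fun ω _ _ => hp.nonneg ω

theorem probEq_congr {X : Ω → A} {Y : Ω → B} {a : A} {b : B} (h : ∀ ω, X ω = a ↔ Y ω = b) :
    probEq p X a = probEq p Y b := by
  classical
  simp only [probEq, h]

/-- Summing out the law of a variable. -/
theorem sum_image_mul_probEq [DecidableEq A] (X : Ω → A) (f : A → ℝ) :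
    ∑ a ∈ Finset.univ.image X, f a * probEq p X a = ∑ ω, f (X ω) * p ω := by
  classical
  rw [← Finset.sum_fiberwise_of_maps_to (s := (Finset.univ : Finset Ω)) (t := Finset.univ.image X) (g := X)
    (fun ω _ => Finset.mem_image_of_mem _ (Finset.mem_univ ω))]
  refine Finset.sum_congr rfl fun a _ => ?_
  rw [probEq, Finset.mul_sum]
  refine Finset.sum_congr (by ext; simp) fun ω hω => ?_
  rw [(Finset.mem_filter.1 hω).2]

theorem sum_mul_probEq [Fintype A] (X : Ω → A) (f : A → ℝ) :
    ∑ a, f a * probEq p X a = ∑ ω, f (X ω) * p ω := by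
  classical
  rw [← sum_image_mul_probEq X f]
  symm
  refine Finset.sum_subset (Finset.subset_univ _) fun a _ ha => ?_
  have : probEq p X a = 0 := Finset.sum_eq_zero fun ω hω =>
    absurd (Finset.mem_image.2 ⟨ω, Finset.mem_univ _, (Finset.mem_filter.1 hω).2⟩) ha
  rw [this, mul_zero]

/-- Averaging over outcomes instead of values puts variables with different alphabets on a common
index set, so entropies can be compared term by term. -/
theorem entropy_eq_sum (p : Ω → ℝ) (X : Ω → A) :
    entropy p X = (∑ ω, p ω * -Real.log (probEq p X (X ω))) / Real.log 2 := by
  classical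
  rw [entropy]
  congr 1
  have := sum_image_mul_probEq (p := p) X (fun a => -Real.log (probEq p X a))
  calc _ = ∑ a ∈ Finset.univ.image X, -Real.log (probEq p X a) * probEq p X a := by
        refine Finset.sum_congr (by congr) fun a _ => ?_
        rw [Real.negMulLog]; ring
    _ = _ := this
    _ = _ := Finset.sum_congr rfl fun ω _ => mul_comm _ _

theorem log_two_pos : 0 < Real.log 2 := Real.log_pos one_lt_two

/-- Gibbs' inequality. -/
theorem entropy_le_cross [DecidableEq A] (hp : IsMass p) (X : Ω → A) (q : A → ℝ)
    (hq0 : ∀ a, 0 ≤ q a) (hq : ∀ ω, 0 < p ω → 0 < q (X ω))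
    (hsum : ∑ a ∈ Finset.univ.image X, q a ≤ 1) :
    entropy p X ≤ (∑ ω, p ω * -Real.log (q (X ω))) / Real.log 2 := by
  rw [entropy_eq_sum]
  refine div_le_div_of_nonneg_right ?_ log_two_pos.le
  have h1 : ∑ ω, p ω * -Real.log (probEq p X (X ω)) - ∑ ω, p ω * -Real.log (q (X ω)) ≤
      ∑ ω, (q (X ω) / probEq p X (X ω)) * p ω - ∑ ω, p ω := by
    rw [← Finset.sum_sub_distrib, ← Finset.sum_sub_distrib]
    refine Finset.sum_le_sum fun ω _ => ?_
    rcases (hp.nonneg ω).eq_or_lt with h | h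
    · simp [← h]
    have hP := probEq_pos hp X h
    have hQ := hq ω h
    have := Real.log_le_sub_one_of_pos (div_pos hQ hP)
    rw [Real.log_div hQ.ne' hP.ne'] at this
    nlinarith
  have h2 : ∑ ω, (q (X ω) / probEq p X (X ω)) * p ω ≤ 1 := by
    rw [← sum_image_mul_probEq X (fun a => q a / probEq p X a)]
    refine le_trans (Finset.sum_le_sum fun a _ => ?_) hsum
    rcases (probEq_nonneg hp X a).eq_or_lt with h | h
    · simp [← h, hq0]
    · rw [div_mul_cancel₀ _ h.ne']
  rw [hp.sum_one] at h1
  linarith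

theorem entropy_nonneg (hp : IsMass p) (X : Ω → A) : 0 ≤ entropy p X := by
  rw [entropy_eq_sum]
  refine div_nonneg (Finset.sum_nonneg fun ω _ => mul_nonneg (hp.nonneg ω) ?_) log_two_pos.le
  exact neg_nonneg.2 (Real.log_nonpos (probEq_nonneg hp _ _) (probEq_le_one hp _ _))

/-- The variable `Y` carries no more information than `X`. -/
theorem entropy_le_of_determines (hp : IsMass p) {X : Ω → A} {Y : Ω → B} (h : Determines X Y) :
    entropy p Y ≤ entropy p X := by
  classical
  rw [entropy_eq_sum, entropy_eq_sum]
  refine div_le_div_of_nonneg_right (Finset.sum_le_sum fun ω _ => ?_) log_two_pos.le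
  rcases (hp.nonneg ω).eq_or_lt with h0 | h0
  · simp [← h0]
  refine mul_le_mul_of_nonneg_left (neg_le_neg (Real.log_le_log (probEq_pos hp X h0) ?_)) h0.le
  refine Finset.sum_le_sum_of_subset_of_nonneg (fun ω' hω' => ?_) fun ω _ _ => hp.nonneg ω
  simp only [Finset.mem_filter, Finset.mem_univ, true_and] at hω' ⊢
  exact h _ _ hω'

theorem entropy_congr {X : Ω → A} {Y : Ω → B} (h : Determines X Y) (h' : Determines Y X) :
    entropy p X = entropy p Y := by
  rw [entropy_eq_sum, entropy_eq_sum]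
  congr 1
  refine Finset.sum_congr rfl fun ω _ => ?_
  rw [probEq_congr (b := Y ω) fun ω' => ⟨h _ _, h' _ _⟩]

theorem entropy_const (hp : IsMass p) {X : Ω → A} (h : ∀ ω ω', X ω = X ω') : entropy p X = 0 := by
  classical
  rw [entropy_eq_sum, Finset.sum_eq_zero, zero_div]
  intro ω _
  have : probEq p X (X ω) = 1 := by
    rw [probEq, Finset.filter_true_of_mem fun ω' _ => h ω' ω, hp.sum_one]
  simp [this]

/-- Submodularity of entropy. -/
theorem entropy_submodular (hp : IsMass p) {X : Ω → A} {Y : Ω → B} {U : Ω → C} {I : Ω → D}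
    (hU : Determines (fun ω => (X ω, Y ω)) U) (hX : Determines X I) (hY : Determines Y I) :
    entropy p U + entropy p I ≤ entropy p X + entropy p Y := by
  classical
  have hne : Nonempty Ω := by
    by_contra h
    rw [not_nonempty_iff] at h
    simpa using hp.sum_one
  obtain ⟨ω₀⟩ := hne
  have : Nonempty D := ⟨I ω₀⟩
  -- Outside the range of `X` the value of `f` plays no role; `I ω₀` is only a default.
  obtain ⟨f, hf⟩ : ∃ f : A → D, ∀ ω, f (X ω) = I ω :=
    ⟨fun a => if h : ∃ ω, X ω = a then I h.choose else I ω₀, fun ω => by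
      have h : ∃ ω', X ω' = X ω := ⟨ω, rfl⟩
      simp only [h, dif_pos]
      exact hX _ _ h.choose_spec⟩
  obtain ⟨g, hg⟩ : ∃ f : B → D, ∀ ω, f (Y ω) = I ω :=
    ⟨fun a => if h : ∃ ω, Y ω = a then I h.choose else I ω₀, fun ω => by
      have h : ∃ ω', Y ω' = Y ω := ⟨ω, rfl⟩
      simp only [h, dif_pos]
      exact hY _ _ h.choose_spec⟩
  -- The comparison law for Gibbs' inequality makes `X` and `Y` conditionally independent given `I`.
  -- Its cross entropy is H(X) + H(Y) - H(I), and its mass on pairs with `g b = f a` is at most 1.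
  let q : A × B → ℝ := fun z => probEq p X z.1 * probEq p Y z.2 / probEq p I (f z.1)
  have hgY : ∀ d, ∑ b ∈ (Finset.univ.image Y).filter (fun b => g b = d), probEq p Y b
      = probEq p I d := by
    intro d
    have := sum_image_mul_probEq (p := p) Y (fun b => if g b = d then 1 else 0)
    simp only [hg, ite_mul, one_mul, zero_mul] at this
    rw [Finset.sum_filter, this, probEq, Finset.sum_filter]
  have key := entropy_le_cross hp (fun ω => (X ω, Y ω)) q
    (fun z => div_nonneg (mul_nonneg (probEq_nonneg hp _ _) (probEq_nonneg hp _ _))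
      (probEq_nonneg hp _ _))
    (fun ω h => by
      simp only [q, hf]
      exact div_pos (mul_pos (probEq_pos hp _ h) (probEq_pos hp _ h)) (probEq_pos hp _ h)) (by
      calc ∑ z ∈ Finset.univ.image (fun ω => (X ω, Y ω)), q z
          ≤ ∑ z ∈ (Finset.univ.image X).sigma
              (fun a => (Finset.univ.image Y).filter (fun b => g b = f a)), q (z.1, z.2) := by
            rw [← Finset.sum_image (s := (Finset.univ.image X).sigma
              (fun a => (Finset.univ.image Y).filter (fun b => g b = f a)))
              (g := fun z => (z.1, z.2)) (f := q)]
            · refine Finset.sum_le_sum_of_subset_of_nonneg (fun z hz => ?_) fun z _ _ =>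
                div_nonneg (mul_nonneg (probEq_nonneg hp _ _) (probEq_nonneg hp _ _))
                  (probEq_nonneg hp _ _)
              obtain ⟨ω, _, rfl⟩ := Finset.mem_image.1 hz
              exact Finset.mem_image.2 ⟨⟨X ω, Y ω⟩, by simp [hf, hg], rfl⟩
            · rintro ⟨a, b⟩ _ ⟨a', b'⟩ _ h
              simpa using h
        _ = ∑ a ∈ Finset.univ.image X, probEq p X a * (probEq p I (f a) / probEq p I (f a)) := by
            rw [Finset.sum_sigma]
            refine Finset.sum_congr rfl fun a _ => ?_
            rw [← hgY (f a), Finset.sum_div, Finset.mul_sum]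
            refine Finset.sum_congr rfl fun b _ => ?_
            simp only [q, hgY]
            ring
        _ ≤ ∑ a ∈ Finset.univ.image X, 1 * probEq p X a := by
            refine Finset.sum_le_sum fun a _ => ?_
            rw [mul_comm]
            exact mul_le_mul_of_nonneg_right (div_self_le_one _) (probEq_nonneg hp _ _)
        _ = 1 := by
            rw [sum_image_mul_probEq X (fun _ => 1)]
            simpa using hp.sum_one)
  have h2 : (∑ ω, p ω * -Real.log (q (X ω, Y ω))) / Real.log 2 =
      entropy p X + entropy p Y - entropy p I := by
    rw [entropy_eq_sum, entropy_eq_sum, entropy_eq_sum, ← add_div, ← sub_div,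
      ← Finset.sum_add_distrib, ← Finset.sum_sub_distrib]
    congr 1
    refine Finset.sum_congr rfl fun ω _ => ?_
    rcases (hp.nonneg ω).eq_or_lt with h0 | h0
    · simp [← h0]
    simp only [q, hf]
    rw [Real.log_div (mul_pos (probEq_pos hp _ h0) (probEq_pos hp _ h0)).ne'
      (probEq_pos hp _ h0).ne', Real.log_mul (probEq_pos hp _ h0).ne' (probEq_pos hp _ h0).ne']
    ring
  have h3 := entropy_le_of_determines hp hU
  linarith

theorem entropy_pair_le (hp : IsMass p) (X : Ω → A) (Y : Ω → B) :
    entropy p (fun ω => (X ω, Y ω)) ≤ entropy p X + entropy p Y := by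
  have := entropy_submodular hp (X := X) (Y := Y) (U := fun ω => (X ω, Y ω))
    (I := fun _ => ()) (fun _ _ h => h) (fun _ _ _ => rfl) (fun _ _ _ => rfl)
  rw [entropy_const hp (X := fun _ : Ω => ()) (fun _ _ => rfl)] at this
  linarith

theorem entropy_pair_of_indep (hp : IsMass p) {X : Ω → A} {Y : Ω → B}
    (h : ∀ a b, probEq p (fun ω => (X ω, Y ω)) (a, b) = probEq p X a * probEq p Y b) :
    entropy p (fun ω => (X ω, Y ω)) = entropy p X + entropy p Y := by
  rw [entropy_eq_sum, entropy_eq_sum, entropy_eq_sum, ← add_div, ← Finset.sum_add_distrib]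
  congr 1
  refine Finset.sum_congr rfl fun ω _ => ?_
  rcases (hp.nonneg ω).eq_or_lt with h0 | h0
  · simp [← h0]
  rw [h, Real.log_mul (probEq_pos hp _ h0).ne' (probEq_pos hp _ h0).ne']
  ring

/-- Entropy is at most the logarithm of the size of the support. -/
theorem entropy_le_log_support (hp : IsMass p) (X : Ω → A) (s : Finset A)
    (hs : ∀ ω, 0 < p ω → X ω ∈ s) : entropy p X ≤ Real.logb 2 s.card := by
  classical
  have hne : ∃ ω, 0 < p ω := by
    by_contra h
    push Not at h
    have := hp.sum_one
    rw [Finset.sum_eq_zero fun ω _ => le_antisymm (h ω) (hp.nonneg ω)] at this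
    exact zero_ne_one this
  obtain ⟨ω₀, h₀⟩ := hne
  have hc : (0 : ℝ) < s.card := by exact_mod_cast Finset.card_pos.2 ⟨_, hs ω₀ h₀⟩
  have := entropy_le_cross hp X (fun a => if a ∈ s then (s.card : ℝ)⁻¹ else 0)
    (fun a => by split_ifs <;> positivity) (fun ω h => by simp only [hs ω h, if_true]; positivity)
    (by
      rw [← Finset.sum_filter, Finset.sum_const, nsmul_eq_mul]
      calc _ ≤ (s.card : ℝ) * (s.card : ℝ)⁻¹ := by
            refine mul_le_mul_of_nonneg_right ?_ (by positivity)
            exact_mod_cast Finset.card_le_card fun a ha => (Finset.mem_filter.1 ha).2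
        _ = 1 := mul_inv_cancel₀ hc.ne')
  refine this.trans (le_of_eq ?_)
  rw [Real.logb]
  congr 1
  calc _ = ∑ ω, p ω * Real.log s.card := by
        refine Finset.sum_congr rfl fun ω _ => ?_
        rcases (hp.nonneg ω).eq_or_lt with h0 | h0
        · simp [← h0]
        simp [hs ω h0]
    _ = _ := by rw [← Finset.sum_mul, hp.sum_one, one_mul]

theorem entropy_le_log_card [Fintype A] (hp : IsMass p) (X : Ω → A) :
    entropy p X ≤ Real.logb 2 (Fintype.card A) :=
  entropy_le_log_support hp X Finset.univ fun _ _ => Finset.mem_univ _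

theorem entropy_of_uniform (hp : IsMass p) {X : Ω → A} {c : ℝ}
    (h : ∀ ω, probEq p X (X ω) = c⁻¹) : entropy p X = Real.logb 2 c := by
  rw [entropy_eq_sum, Real.logb]
  simp only [h, Real.log_inv, neg_neg]
  rw [← Finset.sum_mul, hp.sum_one, one_mul]

/-- If `H(X | Y) = 0`, then `X` is determined by `Y` on the support. -/
theorem eq_of_entropy_pair_le (hp : IsMass p) {X : Ω → A} {Y : Ω → B}
    (h : entropy p (fun ω => (X ω, Y ω)) ≤ entropy p Y) {ω ω' : Ω} (h0 : 0 < p ω) (h0' : 0 < p ω')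
    (hY : Y ω = Y ω') : X ω = X ω' := by
  classical
  by_contra hne
  rw [entropy_eq_sum, entropy_eq_sum, div_le_div_iff_of_pos_right log_two_pos] at h
  -- Each joint probability is at most the corresponding probability of `Y`, strictly so at `ω`,
  -- since `ω'` contributes only to the latter.
  refine absurd h (not_le.2 (Finset.sum_lt_sum (fun ω _ => ?_) ⟨ω, Finset.mem_univ _, ?_⟩))
  · rcases (hp.nonneg ω).eq_or_lt with h0 | h0
    · simp [← h0]
    refine mul_le_mul_of_nonneg_left (neg_le_neg (Real.log_le_log (probEq_pos hp _ h0) ?_)) h0.le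
    refine Finset.sum_le_sum_of_subset_of_nonneg (fun ω' hω' => ?_) fun ω _ _ => hp.nonneg ω
    simp only [Finset.mem_filter, Finset.mem_univ, true_and, Prod.mk.injEq] at hω' ⊢
    exact hω'.2
  · refine mul_lt_mul_of_pos_left (neg_lt_neg
      (Real.log_lt_log (probEq_pos hp (fun ω => (X ω, Y ω)) h0) ?_)) h0
    refine Finset.sum_lt_sum_of_subset (i := ω') (fun ω' hω' => ?_) ?_ ?_ h0'
      fun ω _ _ => hp.nonneg ω
    · simp only [Finset.mem_filter, Finset.mem_univ, true_and, Prod.mk.injEq] at hω' ⊢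
      exact hω'.2
    · simp [hY]
    · simp only [Finset.mem_filter, Finset.mem_univ, true_and, Prod.mk.injEq, not_and]
      exact fun h => absurd h.symm hne

/-- The bound of Fano's inequality, relative to the number of bits to be estimated. -/
noncomputable def fanoBound (e : ℝ) : ℝ := Real.binEntropy e / Real.log 2 + e

theorem continuous_fanoBound : Continuous fanoBound := by
  unfold fanoBound
  fun_prop

theorem fanoBound_zero : fanoBound 0 = 0 := by simp [fanoBound]

/-- Fano's inequality. -/
theorem entropy_pair_le_fano [Fintype A] (hp : IsMass p) (X Y : Ω → A) {e : ℝ}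
    (he : open Classical in e = ∑ ω with Y ω ≠ X ω, p ω) :
    entropy p (fun ω => (X ω, Y ω)) ≤
      entropy p Y + fanoBound e * Real.logb 2 (Fintype.card A) := by
  classical
  have hne : Nonempty Ω := by
    by_contra h
    rw [not_nonempty_iff] at h
    simpa using hp.sum_one
  obtain ⟨ω₀⟩ := hne
  have he0 : 0 ≤ e := by rw [he]; exact Finset.sum_nonneg fun ω _ => hp.nonneg ω
  have heq : ∑ ω with Y ω = X ω, p ω = 1 - e := by
    rw [he, ← hp.sum_one, ← Finset.sum_filter_add_sum_filter_not Finset.univ (fun ω => Y ω = X ω)]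
    simp
  have he1 : 0 ≤ 1 - e := by rw [← heq]; exact Finset.sum_nonneg fun ω _ => hp.nonneg ω
  rcases subsingleton_or_nontrivial A with hA | hA
  · have hc : Fintype.card A = 1 := Fintype.card_eq_one_iff_nonempty_unique.2
      ⟨⟨⟨X ω₀⟩, fun a => Subsingleton.elim _ _⟩⟩
    rw [hc, entropy_const hp (X := fun ω => (X ω, Y ω)) fun _ _ => Subsingleton.elim _ _]
    simpa using entropy_nonneg hp Y
  set n : ℝ := (Fintype.card A : ℝ)
  have hn : 2 ≤ n := by
    have := Fintype.one_lt_card (α := A)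
    simp only [n]; exact_mod_cast this
  -- With two or more symbols the binary entropy term can be multiplied by `log₂ n`, which makes the
  -- final bound proportional to the number of bits.
  have hlogb : 1 ≤ Real.logb 2 n := by
    rw [Real.le_logb_iff_rpow_le one_lt_two (by linarith)]
    simpa using hn
  -- A test channel from the estimate to the symbol. Dividing by `n` instead of `n - 1` gives total
  -- mass at most 1, which is enough for Gibbs' inequality.
  let r : A → A → ℝ := fun x y => if y = x then 1 - e else e / n
  have hr0 : ∀ x y, 0 ≤ r x y := fun x y => by
    simp only [r]; split_ifs
    · exact he1
    · exact div_nonneg he0 (by linarith)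
  have hrs : ∀ y, ∑ x, r x y ≤ 1 := by
    intro y
    calc ∑ x, r x y ≤ ∑ x, ((if y = x then 1 - e else 0) + e / n) := by
          refine Finset.sum_le_sum fun x _ => ?_
          have : 0 ≤ e / n := div_nonneg he0 (by linarith)
          simp only [r]
          split_ifs <;> linarith
      _ = 1 := by
          rw [Finset.sum_add_distrib, Finset.sum_ite_eq, Finset.sum_const, nsmul_eq_mul]
          simp only [Finset.mem_univ, if_true, Finset.card_univ]
          change 1 - e + n * (e / n) = 1
          field_simp
          ring
  have hrp : ∀ ω, 0 < p ω → 0 < r (X ω) (Y ω) := by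
    intro ω h
    simp only [r]
    split_ifs with hxy
    · rw [← heq]
      exact h.trans_le (Finset.single_le_sum (f := p) (fun ω _ => hp.nonneg ω) (by simpa using hxy))
    · refine div_pos ?_ (by linarith)
      rw [he]
      exact h.trans_le (Finset.single_le_sum (f := p) (fun ω _ => hp.nonneg ω) (by simpa using hxy))
  have key := entropy_le_cross hp (fun ω => (X ω, Y ω)) (fun z => probEq p Y z.2 * r z.1 z.2)
    (fun z => mul_nonneg (probEq_nonneg hp _ _) (hr0 _ _))
    (fun ω h => mul_pos (probEq_pos hp _ h) (hrp ω h)) (by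
      calc _ ≤ ∑ z : A × A, probEq p Y z.2 * r z.1 z.2 :=
            Finset.sum_le_sum_of_subset_of_nonneg (Finset.subset_univ _)
              fun z _ _ => mul_nonneg (probEq_nonneg hp _ _) (hr0 _ _)
        _ = ∑ y, (∑ x, r x y) * probEq p Y y := by
            rw [Fintype.sum_prod_type_right]
            refine Finset.sum_congr rfl fun y _ => ?_
            rw [Finset.sum_mul]
            exact Finset.sum_congr rfl fun x _ => mul_comm _ _
        _ ≤ ∑ y, 1 * probEq p Y y := Finset.sum_le_sum fun y _ =>
            mul_le_mul_of_nonneg_right (hrs y) (probEq_nonneg hp _ _)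
        _ = 1 := by
            rw [sum_mul_probEq Y (fun _ => 1)]
            simpa using hp.sum_one)
  have h1 : ∑ ω, p ω * -Real.log (r (X ω) (Y ω)) = Real.binEntropy e + e * Real.log n := by
    rw [← Finset.sum_filter_add_sum_filter_not Finset.univ (fun ω => Y ω = X ω)]
    have ha : ∑ ω with Y ω = X ω, p ω * -Real.log (r (X ω) (Y ω)) =
        (1 - e) * -Real.log (1 - e) := by
      rw [← heq, Finset.sum_mul]
      refine Finset.sum_congr rfl fun ω hω => ?_
      simp only [r, (Finset.mem_filter.1 hω).2, if_true, heq]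
    have hb : ∑ ω with ¬ Y ω = X ω, p ω * -Real.log (r (X ω) (Y ω)) =
        e * -Real.log (e / n) := by
      conv_rhs => rw [he]
      rw [Finset.sum_mul]
      refine Finset.sum_congr rfl fun ω hω => ?_
      simp only [r, (Finset.mem_filter.1 hω).2, if_false, he]
    rw [ha, hb, Real.binEntropy, Real.log_inv, Real.log_inv]
    rcases he0.eq_or_lt with h | h
    · simp [← h]
    · rw [Real.log_div h.ne' (by linarith)]
      ring
  have h2 : (∑ ω, p ω * -Real.log (probEq p Y (Y ω) * r (X ω) (Y ω))) / Real.log 2 =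
      entropy p Y + (Real.binEntropy e + e * Real.log n) / Real.log 2 := by
    rw [entropy_eq_sum, ← h1, ← add_div, ← Finset.sum_add_distrib]
    congr 1
    refine Finset.sum_congr rfl fun ω _ => ?_
    rcases (hp.nonneg ω).eq_or_lt with h0 | h0
    · simp [← h0]
    rw [Real.log_mul (probEq_pos hp _ h0).ne' (hrp ω h0).ne']
    ring
  refine key.trans (h2.le.trans ?_)
  rw [fanoBound, add_mul, add_div, mul_div_assoc, ← Real.logb]
  have hb : 0 ≤ Real.binEntropy e / Real.log 2 :=
    div_nonneg (Real.binEntropy_nonneg he0 (by linarith)) log_two_pos.le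
  nlinarith

end Entropy

/-! ## The law of a network code -/

theorem sum_outcome {P : MulticastProblem} {Src : P.Session → Type} {Rnd : P.Node → Type}
    [∀ s, Fintype (Src s)] [∀ v, Fintype (Rnd v)] [DecidableEq P.Session] [DecidableEq P.Node]
    (f : Outcome P Src Rnd → ℝ) :
    ∑ ω, f ω = ∑ a : (∀ s, Src s), ∑ b : (∀ v, Rnd v), f (a, b) := by
  rw [← Fintype.sum_prod_type']
  refine Finset.sum_congr ?_ fun _ _ => rfl
  ext
  simp

/-- The outcome whose randomness agrees with `ω` at the nodes in `T` and which agrees with `ρ`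
elsewhere. -/
noncomputable def override {P : MulticastProblem} {Src : P.Session → Type} {Rnd : P.Node → Type}
    (T : Set P.Node) (ρ ω : Outcome P Src Rnd) : Outcome P Src Rnd :=
  open Classical in (ρ.1, fun v => if v ∈ T then ω.2 v else ρ.2 v)

section Override

variable {P : MulticastProblem} {Src : P.Session → Type} {Rnd : P.Node → Type}
  {T : Set P.Node} {ρ ω : Outcome P Src Rnd} {v : P.Node}

theorem override_snd_mem (h : v ∈ T) : (override T ρ ω).2 v = ω.2 v := by
  simp [override, h]

theorem override_snd_notMem (h : v ∉ T) : (override T ρ ω).2 v = ρ.2 v := by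
  simp [override, h]

theorem override_override (T : Set P.Node) (ρ ω : Outcome P Src Rnd) :
    override T (override T ρ ω) (override T ω ρ) = ρ := by
  classical
  refine Prod.ext rfl (funext fun v => ?_)
  by_cases h : v ∈ T
  · rw [override_snd_mem h, override_snd_mem h]
  · rw [override_snd_notMem h, override_snd_notMem h]

end Override

namespace NetworkCode

variable {P : MulticastProblem} (C : NetworkCode P)

/-- The law is a product over coordinates. Inserting constants and indicators yields the total mass
and the marginals of single coordinates. -/
theorem sum_prob_mul_prod (f : ∀ s, C.Src s → ℝ) (g : ∀ v, C.Rnd v → ℝ) :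
    ∑ ω, C.prob ω * ((∏ s, f s (ω.1 s)) * ∏ v, g v (ω.2 v)) =
      (∏ s, ∑ a, (Fintype.card (C.Src s) : ℝ)⁻¹ * f s a) * ∏ v, ∑ x, C.rndProb v x * g v x := by
  classical
  rw [sum_outcome, Finset.prod_univ_sum, Finset.prod_univ_sum, Fintype.piFinset_univ,
    Fintype.piFinset_univ, Finset.sum_mul_sum]
  refine Finset.sum_congr rfl fun a _ => Finset.sum_congr rfl fun b _ => ?_
  rw [prob, Finset.prod_mul_distrib, Finset.prod_mul_distrib]
  ring

theorem isMass_prob : IsMass C.prob where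
  nonneg ω := mul_nonneg (Finset.prod_nonneg fun _ _ => by positivity)
    (Finset.prod_nonneg fun v _ => C.rndProb_nonneg v _)
  sum_one := by
    have := C.sum_prob_mul_prod (fun _ _ => 1) (fun _ _ => 1)
    simpa [C.rndProb_sum] using this

theorem probEq_src (s : P.Session) (a : C.Src s) :
    probEq C.prob (fun ω => ω.1 s) a = (Fintype.card (C.Src s) : ℝ)⁻¹ := by
  classical
  have := C.sum_prob_mul_prod
    (Function.update (fun _ _ => 1) s fun x => if x = a then 1 else 0) (fun _ _ => 1)
  simp only [Finset.prod_const_one, mul_one, C.rndProb_sum] at this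
  rw [probEq, Finset.sum_filter]
  calc _ = ∑ ω, C.prob ω * ∏ s', Function.update (fun s (_ : C.Src s) => (1 : ℝ)) s
        (fun x => if x = a then 1 else 0) s' (ω.1 s') := by
        refine Finset.sum_congr rfl fun ω _ => ?_
        rw [Finset.prod_eq_single s (fun s' _ h => by rw [Function.update_of_ne h]) (by simp)]
        simp only [Function.update_self, mul_ite, mul_one, mul_zero]
    _ = _ := this
    _ = _ := by
        rw [Finset.prod_eq_single s (fun s' _ h => by simp [Function.update_of_ne h]) (by simp)]
        simp

theorem probEq_rnd (v : P.Node) (x : C.Rnd v) :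
    probEq C.prob (fun ω => ω.2 v) x = C.rndProb v x := by
  classical
  have := C.sum_prob_mul_prod (fun _ _ => 1)
    (Function.update (fun _ _ => 1) v fun y => if y = x then 1 else 0)
  rw [probEq, Finset.sum_filter]
  calc _ = ∑ ω, C.prob ω * ((∏ s : P.Session, 1) *
        ∏ v', Function.update (fun v (_ : C.Rnd v) => (1 : ℝ)) v
        (fun y => if y = x then 1 else 0) v' (ω.2 v')) := by
        refine Finset.sum_congr rfl fun ω _ => ?_
        rw [Finset.prod_eq_single v (fun s' _ h => by rw [Function.update_of_ne h]) (by simp)]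
        simp only [Function.update_self, mul_ite, mul_one, mul_zero, Finset.prod_const_one]
    _ = _ := this
    _ = _ := by
        rw [Finset.prod_eq_single v
          (fun s' _ h => by simp [Function.update_of_ne h, C.rndProb_sum]) (by simp)]
        simp

theorem srcEntropy_eq_srcBits (s : P.Session) : C.srcEntropy s = C.srcBits s :=
  entropy_of_uniform C.isMass_prob fun _ => C.probEq_src s _

theorem msgEntropy_le_msgBits (e : P.Edge) : C.msgEntropy e ≤ C.msgBits e :=
  entropy_le_log_card C.isMass_prob _

/-- Swapping the `T`-coordinates of two outcomes only exchanges factors between the two product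
weights; the source factors are constant. -/
theorem prob_override_mul (T : Set P.Node) (ρ ω : Outcome P C.Src C.Rnd) :
    C.prob (override T ρ ω) * C.prob (override T ω ρ) = C.prob ρ * C.prob ω := by
  have : (∏ v, C.rndProb v ((override T ρ ω).2 v)) * ∏ v, C.rndProb v ((override T ω ρ).2 v) =
      (∏ v, C.rndProb v (ρ.2 v)) * ∏ v, C.rndProb v (ω.2 v) := by
    rw [← Finset.prod_mul_distrib, ← Finset.prod_mul_distrib]
    refine Finset.prod_congr rfl fun v _ => ?_
    by_cases h : v ∈ T
    · rw [override_snd_mem h, override_snd_mem h, mul_comm]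
    · rw [override_snd_notMem h, override_snd_notMem h]
  simp only [prob]
  linear_combination (∏ s, (Fintype.card (C.Src s) : ℝ)⁻¹) ^ 2 * this

/-- Resampling the randomness of the nodes in `T` does not change the law. -/
theorem sum_override (T : Set P.Node) (f : Outcome P C.Src C.Rnd → ℝ) :
    ∑ z : Outcome P C.Src C.Rnd × Outcome P C.Src C.Rnd,
      C.prob z.1 * C.prob z.2 * f (override T z.1 z.2) = ∑ ω, C.prob ω * f ω := by
  -- The swap of the `T`-coordinates is an involution that preserves the weight of a pair.
  let σ : Equiv.Perm (Outcome P C.Src C.Rnd × Outcome P C.Src C.Rnd) :=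
    { toFun := fun z => (override T z.1 z.2, override T z.2 z.1)
      invFun := fun z => (override T z.1 z.2, override T z.2 z.1)
      left_inv := fun z => Prod.ext (override_override T _ _) (override_override T _ _)
      right_inv := fun z => Prod.ext (override_override T _ _) (override_override T _ _) }
  calc _ = ∑ z, C.prob (σ z).1 * C.prob (σ z).2 * f (σ z).1 := by
        refine Finset.sum_congr rfl fun z _ => ?_
        change _ = C.prob (override T z.1 z.2) * C.prob (override T z.2 z.1) * f (override T z.1 z.2)
        rw [C.prob_override_mul]
    _ = ∑ z : Outcome P C.Src C.Rnd × Outcome P C.Src C.Rnd, C.prob z.1 * C.prob z.2 * f z.1 :=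
        Equiv.sum_comp σ fun z => C.prob z.1 * C.prob z.2 * f z.1
    _ = _ := by
        rw [Fintype.sum_prod_type]
        refine Finset.sum_congr rfl fun ω _ => ?_
        simp only
        rw [← Finset.sum_mul, ← Finset.mul_sum, C.isMass_prob.sum_one, mul_one]

/-- The standard independence test below: `X` ignores the randomness in `T`, and `Y` depends on
nothing else. Sources always count as lying outside `T`. -/
theorem entropy_pair_of_override {A B : Type} (T : Set P.Node)
    {X : Outcome P C.Src C.Rnd → A} {Y : Outcome P C.Src C.Rnd → B}
    (hX : ∀ ρ ω, X (override T ρ ω) = X ρ) (hY : ∀ ρ ω, Y (override T ρ ω) = Y ω) :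
    entropy C.prob (fun ω => (X ω, Y ω)) = entropy C.prob X + entropy C.prob Y := by
  classical
  refine entropy_pair_of_indep C.isMass_prob fun a b => ?_
  have := C.sum_override T (fun ω => if X ω = a ∧ Y ω = b then 1 else 0)
  rw [probEq, probEq, probEq, Finset.sum_filter, Finset.sum_filter, Finset.sum_filter,
    Finset.sum_mul_sum, ← Fintype.sum_prod_type']
  simp only [mul_ite, mul_one, mul_zero, hX, hY] at this
  simp only [Prod.mk.injEq]
  rw [← this]
  refine Finset.sum_congr rfl fun z _ => ?_
  by_cases h1 : X z.1 = a <;> by_cases h2 : Y z.2 = b <;> simp [h1, h2]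

end NetworkCode

/-! ## The key agreement forced by the secured problem -/

/-- The entropy inequality behind one copy of `G*`: a message `X` that is decoded from `W₂`, `W₃`,
`W₄` forces `W₄` to agree with the key, up to the leakage through `W₃` and the decoding error. -/
theorem key_agreement_inequality {Ω S A K W₂ W₃ W₄ F B O D : Type} [Fintype Ω] [Fintype S]
    {p : Ω → ℝ} (hp : IsMass p) {X Y : Ω → S} {a : Ω → A} {k : Ω → K} {w₂ : Ω → W₂} {w₃ : Ω → W₃}
    {w₄ : Ω → W₄} {f : Ω → F} {b : Ω → B} {o : Ω → O} {d : Ω → D}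
    (hX : Determines a X) (hw₂ : Determines a w₂) (hw₃ : Determines (fun ω => (a ω, k ω)) w₃)
    (hY : Determines (fun ω => (w₂ ω, w₃ ω, w₄ ω, f ω)) Y)
    (hf : entropy p (fun ω => ((a ω, k ω, w₄ ω), f ω)) =
      entropy p (fun ω => (a ω, k ω, w₄ ω)) + entropy p f)
    (ha : entropy p (fun ω => (a ω, k ω, w₄ ω)) = entropy p a + entropy p (fun ω => (k ω, w₄ ω)))
    (hk : Determines b k) (ho : Determines b o) (hw₄ : Determines (fun ω => (o ω, d ω)) w₄)
    (hdb : entropy p (fun ω => (d ω, b ω)) = entropy p d + entropy p b)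
    {e : ℝ} (he : open Classical in e = ∑ ω with Y ω ≠ X ω, p ω) :
    entropy p X - entropy p w₂ - mutualInfo p X w₃ -
        fanoBound e * Real.logb 2 (Fintype.card S) ≤
      entropy p o + entropy p w₄ - entropy p (fun ω => (o ω, w₄ ω)) := by
  have h1 := entropy_pair_le_fano hp X Y he
  -- With `h1`: the conditional entropy of `X` given `W₂`, `W₃`, `W₄`, `f` is at most the Fano term.
  have h2 := entropy_submodular hp (X := fun ω => (X ω, Y ω))
    (Y := fun ω => (w₂ ω, w₃ ω, w₄ ω, f ω)) (U := fun ω => (X ω, w₂ ω, w₃ ω, w₄ ω, f ω)) (I := Y)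
    (fun ω ω' h => by simp_all) (fun ω ω' h => by simp_all) hY
  have h3 := entropy_le_of_determines hp (X := fun ω => (X ω, w₂ ω, w₃ ω))
    (Y := fun ω => (X ω, w₃ ω)) (fun ω ω' h => by simp_all)
  have h4 : entropy p (fun ω => (w₂ ω, w₃ ω, w₄ ω, f ω)) ≤
      entropy p w₂ + entropy p w₃ + entropy p w₄ + entropy p f := by
    have i1 := entropy_pair_le hp w₂ (fun ω => (w₃ ω, w₄ ω, f ω))
    have i2 := entropy_pair_le hp w₃ (fun ω => (w₄ ω, f ω))
    have i3 := entropy_pair_le hp w₄ f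
    linarith
  -- Passing from (X, W₂, W₃) to (a, k) does not increase the conditional entropy of (W₄, f). With
  -- the independences `ha` and `hf` this yields the claimed lower bound for I(k; W₄).
  have h5 := entropy_submodular hp (X := fun ω => (a ω, k ω))
    (Y := fun ω => (X ω, w₂ ω, w₃ ω, w₄ ω, f ω)) (U := fun ω => ((a ω, k ω, w₄ ω), f ω))
    (I := fun ω => (X ω, w₂ ω, w₃ ω)) (fun ω ω' h => by simp_all)
    (fun ω ω' h => by
      have h' := h
      simp only [Prod.mk.injEq] at h
      simp only [hX _ _ h.1, hw₂ _ _ h.1, hw₃ _ _ h']) (fun ω ω' h => by simp_all)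
  have h6 := entropy_pair_le hp a k
  -- Data processing: I(k; W₄) ≤ I(b; W₄).
  have h7 := entropy_submodular hp (X := b) (Y := fun ω => (k ω, w₄ ω))
    (U := fun ω => (b ω, w₄ ω)) (I := k) (fun ω ω' h => by simp_all) hk
    (fun ω ω' h => by simp_all)
  -- I(b; W₄) ≤ I(o; W₄): `W₄` sees `b` only through `o`, and `d` is independent of `b`.
  have h8 := entropy_submodular hp (X := fun ω => (b ω, w₄ ω)) (Y := fun ω => (o ω, d ω))
    (U := fun ω => (d ω, b ω)) (I := fun ω => (o ω, w₄ ω)) (fun ω ω' h => by simp_all)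
    (fun ω ω' h => by
      simp only [Prod.mk.injEq] at h
      simp only [ho _ _ h.1, h.2])
    (fun ω ω' h => by
      have h' := hw₄ _ _ h
      simp only [Prod.mk.injEq] at h
      simp only [h.1, h'])
  have h9 := entropy_pair_le hp o d
  rw [mutualInfo]
  linarith

namespace MulticastProblem

variable {P : MulticastProblem} (C : NetworkCode P.secured.toMulticastProblem)
  {ω ω' : Outcome P.secured.toMulticastProblem C.Src C.Rnd}

/-- This and the next lemmas read off the topology: each lists what a node of the glued network
sees, hence what its outgoing messages may depend on. -/
theorem sameView_given {v : P.Node} (hk : ∀ s, P.origin s = v →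
      C.msg (.keyOut s) ω = C.msg (.keyOut s) ω')
    (he : ∀ e, P.head e = v → C.msg (.given e) ω = C.msg (.given e) ω')
    (hr : ω.2 (.given v) = ω'.2 (.given v)) :
    SameView P.secured.toMulticastProblem C.msg (.given v) ω ω' := by
  refine ⟨fun s h => ?_, fun e h => ?_, hr⟩
  · exact absurd h (by rintro ⟨⟩)
  · change P.gluedHead e = .given v at h
    cases e with
    | given e => exact he e (by simpa [gluedHead] using h)
    | keyOut s => exact hk s (by simpa [gluedHead] using h)
    | _ => simp [gluedHead] at h

theorem keyOut_congr {s : P.Session} (h : ω.2 (.keyGen s) = ω'.2 (.keyGen s)) :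
    C.msg (.keyOut s) ω = C.msg (.keyOut s) ω' := by
  refine C.msg_causal _ _ _ ⟨fun _ h' => absurd h' (by rintro ⟨⟩), fun e h' => ?_, h⟩
  change P.gluedHead e = .keyGen s at h'
  cases e <;> simp [gluedHead] at h'

theorem key_congr {i : P.Copy} (h : ω.2 (.keyGen i.1.1) = ω'.2 (.keyGen i.1.1)) :
    C.msg (.key i) ω = C.msg (.key i) ω' := by
  refine C.msg_causal _ _ _ ⟨fun _ h' => absurd h' (by rintro ⟨⟩), fun e h' => ?_, h⟩
  change P.gluedHead e = .keyGen i.1.1 at h'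
  cases e <;> simp [gluedHead] at h'

theorem sameView_source (hx : ω.1 () = ω'.1 ()) (h : ω.2 .source = ω'.2 .source) :
    SameView P.secured.toMulticastProblem C.msg .source ω ω' := by
  refine ⟨fun _ _ => hx, fun e h' => ?_, h⟩
  change P.gluedHead e = .source at h'
  cases e <;> simp [gluedHead] at h'

theorem w3_congr {i : P.Copy} (h1 : C.msg (.w1 i) ω = C.msg (.w1 i) ω')
    (hk : C.msg (.key i) ω = C.msg (.key i) ω') (h : ω.2 (.encrypt i) = ω'.2 (.encrypt i)) :
    C.msg (.w3 i) ω = C.msg (.w3 i) ω' := by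
  refine C.msg_causal _ _ _ ⟨fun _ h' => absurd h' (by rintro ⟨⟩), fun e h' => ?_, h⟩
  change P.gluedHead e = .encrypt i at h'
  cases e with
  | key j => cases h'; exact hk
  | w1 j => cases h'; exact h1
  | _ => simp [gluedHead] at h'

theorem w5_congr {i : P.Copy} (h3 : C.msg (.w3 i) ω = C.msg (.w3 i) ω')
    (h4 : C.msg (.w4 i) ω = C.msg (.w4 i) ω') (h : ω.2 (.decrypt i) = ω'.2 (.decrypt i)) :
    C.msg (.w5 i) ω = C.msg (.w5 i) ω' := by
  refine C.msg_causal _ _ _ ⟨fun _ h' => absurd h' (by rintro ⟨⟩), fun e h' => ?_, h⟩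
  change P.gluedHead e = .decrypt i at h'
  cases e with
  | w3 j => cases h'; exact h3
  | w4 j => cases h'; exact h4
  | _ => simp [gluedHead] at h'

theorem est_sink_congr {i : P.Copy} (h2 : C.msg (.w2 i) ω = C.msg (.w2 i) ω')
    (h5 : C.msg (.w5 i) ω = C.msg (.w5 i) ω') (h : ω.2 (.sink i) = ω'.2 (.sink i)) :
    C.est () (.sink i) ω = C.est () (.sink i) ω' := by
  refine C.est_causal _ _ _ _ ⟨fun _ h' => absurd h' (by rintro ⟨⟩), fun e h' => ?_, h⟩
  change P.gluedHead e = .sink i at h'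
  cases e with
  | w2 j => cases h'; exact h2
  | w5 j => cases h'; exact h5
  | _ => simp [gluedHead] at h'

/-- The links of a multicast problem are well-founded. -/
theorem wellFounded_edge (P : MulticastProblem) :
    WellFounded fun e e' : P.Edge => P.head e = P.tail e' := by
  have h : WellFounded (Relation.TransGen fun a b => ∃ e, P.tail e = a ∧ P.head e = b) := by
    have : Std.Irrefl (Relation.TransGen fun a b => ∃ e, P.tail e = a ∧ P.head e = b) :=
      ⟨P.acyclic⟩
    exact Finite.wellFounded_of_trans_of_irrefl _
  refine Subrelation.wf (r := InvImage _ P.tail) ?_ (InvImage.wf P.tail h)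
  intro e e' hee
  exact .single ⟨e, rfl, hee⟩

/-- Induction along the acyclic network. In particular nothing inside the given network depends on
the source message, which makes `W₄` independent of the source side. -/
theorem given_congr (hk : ∀ s, C.msg (.keyOut s) ω = C.msg (.keyOut s) ω')
    (hr : ∀ v, ω.2 (.given v) = ω'.2 (.given v)) (e : P.Edge) :
    C.msg (.given e) ω = C.msg (.given e) ω' := by
  induction e using P.wellFounded_edge.induction with
  | _ e ih =>
    exact C.msg_causal _ _ _ (sameView_given C (fun s _ => hk s) (fun e' h => ih e' h) (hr _))

theorem w4_congr (hk : ∀ s, C.msg (.keyOut s) ω = C.msg (.keyOut s) ω')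
    (hr : ∀ v, ω.2 (.given v) = ω'.2 (.given v)) (i : P.Copy) :
    C.msg (.w4 i) ω = C.msg (.w4 i) ω' :=
  C.msg_causal _ _ _ (sameView_given C (fun s _ => hk s) (fun e _ => given_congr C hk hr e) (hr _))

/-- The probability that the sink of the copy `i` is in error. -/
noncomputable def copyError (i : P.Copy) : ℝ :=
  open Classical in ∑ ω with C.est () (.sink i) ω ≠ ω.1 (), C.prob ω

theorem copyError_nonneg (i : P.Copy) : 0 ≤ copyError C i :=
  Finset.sum_nonneg fun ω _ => C.isMass_prob.nonneg ω

theorem copyError_le (i : P.Copy) : copyError C i ≤ C.errorProb := by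
  classical
  refine Finset.sum_le_sum_of_subset_of_nonneg (fun ω hω => ?_)
    fun ω _ _ => C.isMass_prob.nonneg ω
  simp only [Finset.mem_filter, Finset.mem_univ, true_and] at hω ⊢
  exact ⟨(), .sink i, ⟨i, rfl⟩, hω⟩

theorem leakage_eq (i : P.Copy) :
    C.leakage (P.secured.target i) (P.secured.tap i) =
      mutualInfo C.prob (fun ω => ω.1 ()) (C.msg (.w3 i)) := by
  have hX : ∀ ω ω' : Outcome P.secured.toMulticastProblem C.Src C.Rnd,
      (fun s : P.secured.target i => ω.1 s) = (fun s : P.secured.target i => ω'.1 s) ↔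
        ω.1 () = ω'.1 () := fun ω ω' =>
    ⟨fun h => congrFun h ⟨(), trivial⟩, fun h => funext fun _ => h⟩
  have hW : ∀ ω ω' : Outcome P.secured.toMulticastProblem C.Src C.Rnd,
      (fun e : P.secured.tap i => C.msg e ω) = (fun e : P.secured.tap i => C.msg e ω') ↔
        C.msg (.w3 i) ω = C.msg (.w3 i) ω' := fun ω ω' =>
    ⟨fun h => congrFun h ⟨.w3 i, rfl⟩, fun h => funext fun ⟨e, he⟩ => by cases he; exact h⟩
  rw [NetworkCode.leakage, mutualInfo, mutualInfo]
  congr 1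
  · congr 1
    · exact entropy_congr (fun ω ω' => (hX ω ω').1) (fun ω ω' => (hX ω ω').2)
    · exact entropy_congr (fun ω ω' => (hW ω ω').1) (fun ω ω' => (hW ω ω').2)
  · refine entropy_congr (fun ω ω' h => ?_) (fun ω ω' h => ?_) <;>
      simp only [Prod.mk.injEq] at h ⊢
    · exact ⟨(hX ω ω').1 h.1, (hW ω ω').1 h.2⟩
    · exact ⟨(hX ω ω').2 h.1, (hW ω ω').2 h.2⟩

/-- In every copy of `G*`, the message `W₄` has to reveal the key of its session. -/
theorem le_mutualInfo_keyOut (i : P.Copy) :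
    C.srcEntropy () - C.msgEntropy (.w2 i) - C.leakage (P.secured.target i) (P.secured.tap i) -
        fanoBound (copyError C i) * C.srcBits () ≤
      mutualInfo C.prob (C.msg (.keyOut i.1.1)) (C.msg (.w4 i)) := by
  rw [leakage_eq]
  let : Fintype (C.Src ()) := C.fintypeSrc ()
  refine key_agreement_inequality C.isMass_prob (X := fun ω => ω.1 ())
    (Y := C.est () (.sink i)) (w₂ := C.msg (.w2 i)) (w₃ := C.msg (.w3 i))
    -- The sample space is split by location: `a` is the source side including the encryption node,
    -- `f` the decryption side, `b` the key generator of the session, and `d` everything except `b`.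
    -- The independences required are then instances of resampling.
    (a := fun ω => (ω.1 (), ω.2 .source, ω.2 (.encrypt i)))
    (k := C.msg (.key i)) (f := fun ω => (ω.2 (.decrypt i), ω.2 (.sink i)))
    (b := fun ω => ω.2 (.keyGen i.1.1))
    (d := fun ω => (ω.1, fun v : {v : P.secured.Node // v ≠ .keyGen i.1.1} => ω.2 v))
    ?_ ?_ ?_ ?_ ?_ ?_ ?_ ?_ ?_ ?_ rfl
  · intro ω ω' h
    simp only [Prod.mk.injEq] at h
    exact h.1
  · intro ω ω' h
    simp only [Prod.mk.injEq] at h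
    exact C.msg_causal _ _ _ (sameView_source C h.1 h.2.1)
  · intro ω ω' h
    simp only [Prod.mk.injEq] at h
    exact w3_congr C (C.msg_causal _ _ _ (sameView_source C h.1.1 h.1.2.1)) h.2 h.1.2.2
  · intro ω ω' h
    simp only [Prod.mk.injEq] at h
    exact est_sink_congr C h.1 (w5_congr C h.2.1 h.2.2.1 h.2.2.2.1) h.2.2.2.2
  · have hT : ∀ v : GluedNode P.Node P.Session P.Copy, v ≠ .decrypt i → v ≠ .sink i →
        v ∉ ({.decrypt i, .sink i} : Set (GluedNode P.Node P.Session P.Copy)) := by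
      rintro v h1 h2 (h | h)
      exacts [h1 h, h2 h]
    refine C.entropy_pair_of_override {.decrypt i, .sink i} (fun ρ ω => ?_) (fun ρ ω => ?_)
    · simp only [Prod.mk.injEq]
      refine ⟨⟨rfl, override_snd_notMem (hT _ nofun nofun), override_snd_notMem (hT _ nofun nofun)⟩,
        key_congr C (override_snd_notMem (hT _ nofun nofun)), w4_congr C (fun s => ?_) (fun v => ?_) i⟩
      · exact keyOut_congr C (override_snd_notMem (hT _ nofun nofun))
      · exact override_snd_notMem (hT _ nofun nofun)
    · simp only [Prod.mk.injEq]
      exact ⟨override_snd_mem (Or.inl rfl), override_snd_mem (Or.inr rfl)⟩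
  · refine C.entropy_pair_of_override (Set.range .keyGen ∪ Set.range .given)
      (fun ρ ω => ?_) (fun ρ ω => ?_)
    · simp only [Prod.mk.injEq]
      refine ⟨rfl, override_snd_notMem ?_, override_snd_notMem ?_⟩ <;>
        rintro (⟨_, ⟨⟩⟩ | ⟨_, ⟨⟩⟩)
    · simp only [Prod.mk.injEq]
      refine ⟨key_congr C (override_snd_mem (Or.inl ⟨_, rfl⟩)), w4_congr C (fun s => ?_) (fun v => ?_) i⟩
      · exact keyOut_congr C (override_snd_mem (Or.inl ⟨_, rfl⟩))
      · exact override_snd_mem (Or.inr ⟨_, rfl⟩)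
  · exact fun ω ω' h => key_congr C h
  · exact fun ω ω' h => keyOut_congr C h
  · intro ω ω' h
    simp only [Prod.mk.injEq] at h
    have hv : ∀ v : P.secured.Node, v ≠ .keyGen i.1.1 → ω.2 v = ω'.2 v :=
      fun v hv => congrFun h.2.2 ⟨v, hv⟩
    refine w4_congr C (fun s => ?_) (fun v => hv _ (by rintro ⟨⟩)) i
    by_cases hs : s = i.1.1
    · rw [hs]; exact h.1
    · exact keyOut_congr C (hv _ fun h' => hs (GluedNode.keyGen.inj h'))
  · refine C.entropy_pair_of_override {.keyGen i.1.1} (fun ρ ω => ?_) (fun ρ ω => ?_)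
    · simp only [Prod.mk.injEq]
      refine ⟨rfl, funext fun v => override_snd_notMem v.2⟩
    · exact override_snd_mem rfl

end MulticastProblem

/-! ## Deterministic zero-error codes -/

/-- The source symbols `t` and `t'` look the same at the node `v`, for deterministic messages. -/
def SameSrcView (P : MulticastProblem) {Src : P.Session → Type} {Msg : P.Edge → Type}
    (msg : (e : P.Edge) → (∀ s, Src s) → Msg e) (v : P.Node) (t t' : ∀ s, Src s) : Prop :=
  (∀ s, P.origin s = v → t s = t' s) ∧ ∀ e, P.head e = v → msg e t = msg e t'

/-- The source symbols in `Src s` can be communicated without error by deterministic messages that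
respect the link capacities. -/
def ZeroErrorSolvable (P : MulticastProblem) (Src : P.Session → Type) (cap : P.Edge → ℝ) : Prop :=
  ∃ (Msg : P.Edge → Type) (_ : ∀ e, Fintype (Msg e)) (msg : (e : P.Edge) → (∀ s, Src s) → Msg e),
    (∀ e, Real.logb 2 (Fintype.card (Msg e)) ≤ cap e) ∧
    (∀ e t t', SameSrcView P msg (P.tail e) t t' → msg e t = msg e t') ∧
    ∀ s, ∀ v ∈ P.dest s, ∀ t t', SameSrcView P msg v t t' → t s = t' s

namespace NetworkCode

variable {P : MulticastProblem} (C : NetworkCode P)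

theorem prob_pos_iff (ω : Outcome P C.Src C.Rnd) :
    0 < C.prob ω ↔ ∀ v, 0 < C.rndProb v (ω.2 v) := by
  have h : 0 < ∏ s, (Fintype.card (C.Src s) : ℝ)⁻¹ :=
    Finset.prod_pos fun s _ => inv_pos.2 (by exact_mod_cast Fintype.card_pos)
  rw [prob, mul_pos_iff_of_pos_left h]
  refine ⟨fun h v => ?_, fun h => Finset.prod_pos fun v _ => h v⟩
  exact (C.rndProb_nonneg v _).lt_of_ne fun h0 => h.ne' (Finset.prod_eq_zero (Finset.mem_univ v) h0.symm)

theorem exists_prob_pos : ∃ ω, 0 < C.prob ω := by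
  by_contra h
  push Not at h
  have := C.isMass_prob.sum_one
  rw [Finset.sum_eq_zero fun ω _ => le_antisymm (h ω) (C.isMass_prob.nonneg ω)] at this
  exact zero_ne_one this

theorem errorProb_eq_zero (h : ∀ s, ∀ v ∈ P.dest s, ∀ ω, C.est s v ω = ω.1 s) :
    C.errorProb = 0 := by
  classical
  refine Finset.sum_eq_zero fun ω hω => ?_
  obtain ⟨s, v, hv, hne⟩ := (Finset.mem_filter.1 hω).2
  exact absurd (h s v hv ω) hne

theorem est_eq_of_errorProb_eq_zero (h : C.errorProb = 0) {ω : Outcome P C.Src C.Rnd}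
    (hω : 0 < C.prob ω) {s : P.Session} {v : P.Node} (hv : v ∈ P.dest s) :
    C.est s v ω = ω.1 s := by
  classical
  by_contra hne
  refine hω.ne' ((Finset.sum_eq_zero_iff_of_nonneg fun ω _ => C.isMass_prob.nonneg ω).1 h ω ?_)
  simp only [Finset.mem_filter, Finset.mem_univ, true_and]
  exact ⟨s, v, hv, hne⟩

end NetworkCode

/-- At zero error the internal randomness may be frozen at any outcome of positive probability. An
alphabet with at least `2 ^ rate` symbols has at least the ceiling of that number, so the smaller
alphabet embeds. -/
theorem ZeroErrorSolvable.of_admissible {P : MulticastProblem} {rate : P.Session → ℝ}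
    {cap : P.Edge → ℝ} (h : P.withoutSecrecy.Admissible rate cap) :
    ZeroErrorSolvable P (fun s => Fin ⌈(2 : ℝ) ^ rate s⌉₊) cap := by
  obtain ⟨C, hcap, hrate, herr, -⟩ := h
  change NetworkCode P at C
  obtain ⟨ω₀, h₀⟩ := C.exists_prob_pos
  have hφ : ∀ s, Nonempty (Fin ⌈(2 : ℝ) ^ rate s⌉₊ ↪ C.Src s) := by
    intro s
    refine Function.Embedding.nonempty_of_card_le ?_
    rw [Fintype.card_fin, Nat.ceil_le]
    have h1 : rate s ≤ Real.logb 2 (Fintype.card (C.Src s)) := (hrate s).2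
    rwa [Real.le_logb_iff_rpow_le one_lt_two
      (by exact_mod_cast (Fintype.card_pos (α := C.Src s)))] at h1
  let φ := fun s => (hφ s).some
  let o : (∀ s, Fin ⌈(2 : ℝ) ^ rate s⌉₊) → Outcome P C.Src C.Rnd :=
    fun t => (fun s => φ s (t s), ω₀.2)
  have ho : ∀ t, 0 < C.prob (o t) := fun t =>
    (C.prob_pos_iff _).2 ((C.prob_pos_iff _).1 h₀)
  have hview : ∀ v t t', SameSrcView P (fun e t => C.msg e (o t)) v t t' →
      SameView P C.msg v (o t) (o t') := fun v t t' h =>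
    ⟨fun s hs => congrArg (φ s) (h.1 s hs), h.2, rfl⟩
  refine ⟨C.Msg, inferInstance, fun e t => C.msg e (o t), fun e => (hcap e).2,
    fun e t t' h => C.msg_causal _ _ _ (hview _ _ _ h), fun s v hv t t' h => ?_⟩
  have h1 := C.est_causal s v _ _ (hview _ _ _ h)
  rw [C.est_eq_of_errorProb_eq_zero herr (ho t) hv,
    C.est_eq_of_errorProb_eq_zero herr (ho t') hv] at h1
  exact (φ s).injective h1

theorem ZeroErrorSolvable.admissible {P : MulticastProblem} {Src : P.Session → Type}
    [∀ s, Fintype (Src s)] [∀ s, Nonempty (Src s)] {rate : P.Session → ℝ} {cap : P.Edge → ℝ}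
    (h : ZeroErrorSolvable P Src cap) (hrate : ∀ s, rate s ≤ Real.logb 2 (Fintype.card (Src s))) :
    P.withoutSecrecy.Admissible rate cap := by
  classical
  obtain ⟨Msg, _, msg, hcap, hcausal, hdec⟩ := h
  let C : NetworkCode P :=
    { Src := Src
      Msg := Msg
      Rnd := fun _ => Unit
      rndProb := fun _ _ => 1
      rndProb_nonneg := fun _ _ => zero_le_one
      rndProb_sum := fun _ => by simp
      msg := fun e ω => msg e ω.1
      msg_causal := fun e ω ω' h => hcausal e _ _ ⟨h.1, h.2.1⟩
      -- Reading the symbol off `ω` is causal only at requesting nodes, by `hdec`; elsewhere any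
      -- constant will do.
      est := fun s v ω => if v ∈ P.dest s then ω.1 s else Classical.arbitrary _
      est_causal := fun s v ω ω' h => by
        split_ifs with hv
        · exact hdec s v hv _ _ ⟨h.1, h.2.1⟩
        · rfl }
  refine ⟨C, fun e => ⟨C.msgEntropy_le_msgBits e, hcap e⟩,
    fun s => ⟨C.srcEntropy_eq_srcBits s, hrate s⟩, 
    C.errorProb_eq_zero fun s v hv ω => if_pos hv, fun r => r.elim⟩

/-! ## Secured problems: codes from zero-error codes -/

/-- A finite nonempty type carries a Latin square. -/
theorem exists_latinSquare (A : Type) [Finite A] [Nonempty A] :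
    ∃ f : A → A → A, (∀ a, Function.Injective (f a)) ∧ ∀ b, Function.Injective fun a => f a b := by
  obtain ⟨n, ⟨e⟩⟩ := Finite.exists_equiv_fin A
  have : NeZero n := ⟨by rintro rfl; exact (e (Classical.arbitrary A)).elim0⟩
  refine ⟨fun a b => e.symm (e a + e b), fun a b c h => ?_, fun b a c h => ?_⟩
  · simpa using h
  · simpa using h

section SecuredCode

variable {P : MulticastProblem} (Src : P.Session → Type) (Msg : P.Edge → Type)

/-- Message alphabets of the code for the secured problem. -/
def SecuredMsg : GluedEdge P.Edge P.Session P.Copy → Type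
  | .given e => Msg e
  | .keyOut s => Src s
  | .key i => Src i.1.1
  | .w1 i => Src i.1.1
  | .w2 i => Src i.1.1 × ∀ s : {s // s ≠ i.1.1}, Src s × Src s
  | .w3 i => Src i.1.1
  | .w4 i => Src i.1.1
  | .w5 i => Src i.1.1

/-- Internal randomness of the code for the secured problem: only keys are random. -/
def SecuredRnd : GluedNode P.Node P.Session P.Copy → Type
  | .keyGen s => Src s
  | _ => Unit

variable [∀ s, Fintype (Src s)] [∀ e, Fintype (Msg e)]

noncomputable instance instFintypeSecuredMsg : ∀ e, Fintype (SecuredMsg (P := P) Src Msg e)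
  | .given e => inferInstanceAs (Fintype (Msg e))
  | .keyOut s => inferInstanceAs (Fintype (Src s))
  | .key i => inferInstanceAs (Fintype (Src i.1.1))
  | .w1 i => inferInstanceAs (Fintype (Src i.1.1))
  | .w2 i => by
    classical
    exact inferInstanceAs (Fintype (Src i.1.1 × ∀ s : {s // s ≠ i.1.1}, Src s × Src s))
  | .w3 i => inferInstanceAs (Fintype (Src i.1.1))
  | .w4 i => inferInstanceAs (Fintype (Src i.1.1))
  | .w5 i => inferInstanceAs (Fintype (Src i.1.1))

instance instFintypeSecuredRnd : ∀ v, Fintype (SecuredRnd (P := P) Src v)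
  | .keyGen s => inferInstanceAs (Fintype (Src s))
  | .given _ => inferInstanceAs (Fintype Unit)
  | .source => inferInstanceAs (Fintype Unit)
  | .encrypt _ => inferInstanceAs (Fintype Unit)
  | .decrypt _ => inferInstanceAs (Fintype Unit)
  | .sink _ => inferInstanceAs (Fintype Unit)

instance instNonemptySecuredRnd [∀ s, Nonempty (Src s)] :
    ∀ v, Nonempty (SecuredRnd (P := P) Src v)
  | .keyGen s => inferInstanceAs (Nonempty (Src s))
  | .given _ => inferInstanceAs (Nonempty Unit)
  | .source => inferInstanceAs (Nonempty Unit)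
  | .encrypt _ => inferInstanceAs (Nonempty Unit)
  | .decrypt _ => inferInstanceAs (Nonempty Unit)
  | .sink _ => inferInstanceAs (Nonempty Unit)

end SecuredCode

/-- One-time pad: if `W₃` amounts to a uniform key once the source message is known, then it is
independent of the source message. -/
theorem leakage_eq_zero {P : MulticastProblem} (C : NetworkCode P.secured.toMulticastProblem)
    (i : P.Copy)
    (h : ∀ ω ω', ω.1 () = ω'.1 () → C.msg (.w3 i) ω = C.msg (.w3 i) ω' →
      ω.2 (.keyGen i.1.1) = ω'.2 (.keyGen i.1.1))
    (h' : ∀ ω ω', ω.1 () = ω'.1 () → ω.2 (.keyGen i.1.1) = ω'.2 (.keyGen i.1.1) →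
      C.msg (.w3 i) ω = C.msg (.w3 i) ω')
    {n : ℝ} (hu : ∀ x, probEq C.prob (fun ω => ω.2 (.keyGen i.1.1)) x = n⁻¹)
    (hn : C.msgBits (.w3 i) ≤ Real.logb 2 n) :
    C.leakage (P.secured.target i) (P.secured.tap i) = 0 := by
  refine (MulticastProblem.leakage_eq C i).trans ?_
  rw [mutualInfo]
  have h1 := C.entropy_pair_of_override {.keyGen i.1.1} (X := fun ω => ω.1 ())
    (Y := fun ω => ω.2 (.keyGen i.1.1)) (fun _ _ => rfl)
    fun _ _ => override_snd_mem (Set.mem_singleton _)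
  have h2 := entropy_of_uniform C.isMass_prob fun ω => hu (ω.2 (.keyGen i.1.1))
  have h3 : entropy C.prob (fun ω => (ω.1 (), C.msg (.w3 i) ω)) =
      entropy C.prob (fun ω => (ω.1 (), ω.2 (.keyGen i.1.1))) :=
    entropy_congr
      (fun ω ω' h0 => Prod.ext (Prod.ext_iff.1 h0).1 (h _ _ (Prod.ext_iff.1 h0).1 (Prod.ext_iff.1 h0).2))
      (fun ω ω' h0 => Prod.ext (Prod.ext_iff.1 h0).1 (h' _ _ (Prod.ext_iff.1 h0).1 (Prod.ext_iff.1 h0).2))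
  -- H(X, W₃) = H(X) + log n while H(W₃) ≤ log n, so subadditivity is an equality and nothing leaks.
  have h4 : entropy C.prob (C.msg (.w3 i)) ≤ Real.logb 2 n :=
    (C.msgEntropy_le_msgBits (.w3 i)).trans hn
  have h5 := entropy_pair_le C.isMass_prob (fun ω => ω.1 ()) (C.msg (.w3 i))
  linarith

/-- A zero-error code for `P` yields a zero-error, perfectly secure code for the secured problem, in
which the links of `P` carry the same messages and the sources of `P` become keys. -/
theorem ZeroErrorSolvable.exists_securedCode {P : MulticastProblem} {Src : P.Session → Type}
    [∀ s, Fintype (Src s)] [∀ s, Nonempty (Src s)] {cap : P.Edge → ℝ} {c : P.Session → ℝ}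
    (h : ZeroErrorSolvable P Src cap) (hc : ∀ s, c s = Real.logb 2 (Fintype.card (Src s))) :
    ∃ C : NetworkCode P.secured.toMulticastProblem,
      (∀ e, C.msgBits e ≤ P.securedCap c cap e) ∧ (∀ s, C.srcBits s = P.securedRate c s) ∧
      C.errorProb = 0 ∧ ∀ r, C.leakage (P.secured.target r) (P.secured.tap r) = 0 := by
  classical
  obtain ⟨Msg, _, msg, hcap, hcausal, hdec⟩ := h
  choose f hf hf' using fun s => exists_latinSquare (Src s)
  let C : NetworkCode P.secured.toMulticastProblem :=
    -- Two symbols per session account for the rate `2 * ∑ c`. In the copy for `s`, `W₁` takes the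
    -- first symbol of `s` and `W₂` all the others.
    { Src := fun _ => ∀ s, Src s × Src s
      Msg := SecuredMsg Src Msg
      Rnd := SecuredRnd Src
      nonemptySrc := fun _ => inferInstance
      fintypeMsg := fun e => instFintypeSecuredMsg Src Msg e
      fintypeRnd := fun v => instFintypeSecuredRnd Src v
      rndProb := fun (v : GluedNode P.Node P.Session P.Copy) _ => (Fintype.card (SecuredRnd Src v) : ℝ)⁻¹
      rndProb_nonneg := fun v x => inv_nonneg.2 (Nat.cast_nonneg _)
      rndProb_sum := fun (v : GluedNode P.Node P.Session P.Copy) => by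
        rw [Finset.sum_const, Finset.card_univ, nsmul_eq_mul, mul_inv_cancel₀]
        exact Nat.cast_ne_zero.2 (Fintype.card_pos (α := SecuredRnd Src v)).ne'
      msg := fun e ω => match e with
        | .given e => msg e fun s => ω.2 (.keyGen s)
        | .keyOut s => ω.2 (.keyGen s)
        | .key i => ω.2 (.keyGen i.1.1)
        | .w1 i => (ω.1 () i.1.1).1
        | .w2 i => ((ω.1 () i.1.1).2, fun s => ω.1 () s)
        | .w3 i => f i.1.1 (ω.1 () i.1.1).1 (ω.2 (.keyGen i.1.1))
        | .w4 i => ω.2 (.keyGen i.1.1)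
        | .w5 i => (ω.1 () i.1.1).1
      msg_causal := fun e ω ω' h => by
        cases e with
        | given e =>
          refine hcausal e _ _ ⟨fun s hs => ?_, fun e' he' => ?_⟩
          · exact h.2.1 (.keyOut s) (congrArg GluedNode.given hs)
          · exact h.2.1 (.given e') (congrArg GluedNode.given he')
        | keyOut s => exact h.2.2
        | key i => exact h.2.2
        | w1 i => exact congrArg (fun x => (x i.1.1).1) (h.1 () rfl)
        | w2 i =>
          exact congrArg (fun x => ((x i.1.1).2, fun s : {s // s ≠ i.1.1} => x s)) (h.1 () rfl)
        | w3 i =>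
          have h1 : (ω.1 () i.1.1).1 = (ω'.1 () i.1.1).1 := h.2.1 (.w1 i) rfl
          have h2 : ω.2 (.keyGen i.1.1) = ω'.2 (.keyGen i.1.1) := h.2.1 (.key i) rfl
          exact (congrArg (fun a => f i.1.1 a _) h1).trans (congrArg (f i.1.1 _) h2)
        | w4 i =>
          refine hdec i.1.1 i.1.2 i.2 (fun s => ω.2 (.keyGen s)) (fun s => ω'.2 (.keyGen s))
            ⟨fun s hs => ?_, fun e' he' => ?_⟩
          · exact h.2.1 (.keyOut s) (congrArg GluedNode.given hs)
          · exact h.2.1 (.given e') (congrArg GluedNode.given he')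
        | w5 i =>
          have h1 : f i.1.1 (ω.1 () i.1.1).1 (ω.2 (.keyGen i.1.1)) =
            f i.1.1 (ω'.1 () i.1.1).1 (ω'.2 (.keyGen i.1.1)) := h.2.1 (.w3 i) rfl
          have h2 : ω.2 (.keyGen i.1.1) = ω'.2 (.keyGen i.1.1) := h.2.1 (.w4 i) rfl
          rw [h2] at h1
          exact hf' _ _ h1
      est := fun _ v ω => if v ∈ Set.range GluedNode.sink then ω.1 () else Classical.arbitrary _
      est_causal := fun s v ω ω' h => by
        split_ifs with hv
        · obtain ⟨i, rfl⟩ := hv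
          have h2 : ((ω.1 () i.1.1).2, fun s : {s // s ≠ i.1.1} => ω.1 () s) =
            ((ω'.1 () i.1.1).2, fun s : {s // s ≠ i.1.1} => ω'.1 () s) := h.2.1 (.w2 i) rfl
          have h5 : (ω.1 () i.1.1).1 = (ω'.1 () i.1.1).1 := h.2.1 (.w5 i) rfl
          funext s
          by_cases hs : s = i.1.1
          · subst hs
            exact Prod.ext h5 (Prod.ext_iff.1 h2).1
          · exact congrFun (Prod.ext_iff.1 h2).2 ⟨s, hs⟩
        · rfl }
  have hpos : ∀ s, (0 : ℝ) < Fintype.card (Src s) := fun s => by exact_mod_cast Fintype.card_pos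
  have hrate : ∀ s, C.srcBits s = P.securedRate c s := by
    intro s
    change Real.logb 2 (Fintype.card (∀ s, Src s × Src s)) = 2 * ∑ s, c s
    rw [Fintype.card_pi]
    push_cast
    rw [Real.logb_prod _ _ (fun s _ => by simp), Finset.mul_sum]
    refine Finset.sum_congr rfl fun s _ => ?_
    rw [Fintype.card_prod, Nat.cast_mul, Real.logb_mul (hpos s).ne' (hpos s).ne', hc]
    ring
  refine ⟨C, fun e => ?_, hrate, ?_, fun i => ?_⟩
  · cases e with
    | given e => exact hcap e
    | keyOut s => exact (hc s).ge
    | w2 i =>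
      change Real.logb 2 (Fintype.card (Src i.1.1 × ∀ s : {s // s ≠ i.1.1}, Src s × Src s)) ≤
        2 * (∑ s, c s) - c i.1.1
      -- The source alphabet is the product of those of `W₁` and `W₂`, so `W₂` needs exactly `d - c`
      -- bits.
      have h1 : Fintype.card (∀ s, Src s × Src s) = Fintype.card (Src i.1.1) *
          Fintype.card (Src i.1.1 × ∀ s : {s // s ≠ i.1.1}, Src s × Src s) := by
        rw [Fintype.card_congr (Equiv.piSplitAt i.1.1 fun s => Src s × Src s)]
        simp only [Fintype.card_prod]
        ring
      have h2 : Real.logb 2 (Fintype.card (∀ s, Src s × Src s)) = 2 * ∑ s, c s := hrate ()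
      rw [h1, Nat.cast_mul, Real.logb_mul (hpos _).ne'
        (Nat.cast_ne_zero.2 Fintype.card_ne_zero), ← hc] at h2
      linarith
    | key i => exact (hc _).ge
    | w1 i => exact (hc _).ge
    | w3 i => exact (hc _).ge
    | w4 i => exact (hc _).ge
    | w5 i => exact (hc _).ge
  · exact C.errorProb_eq_zero fun s v hv ω => if_pos hv
  · refine leakage_eq_zero C i (fun ω ω' hx hb => ?_) (fun ω ω' hx hb => ?_)
      (C.probEq_rnd (.keyGen i.1.1)) le_rfl
    · change f i.1.1 (ω.1 () i.1.1).1 (ω.2 (.keyGen i.1.1)) =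
          f i.1.1 (ω'.1 () i.1.1).1 (ω'.2 (.keyGen i.1.1)) at hb
      rw [hx] at hb
      exact hf _ _ hb
    · change f i.1.1 (ω.1 () i.1.1).1 (ω.2 (.keyGen i.1.1)) =
          f i.1.1 (ω'.1 () i.1.1).1 (ω'.2 (.keyGen i.1.1))
      rw [hx, hb]

/-! ## Zero-error codes from codes for the secured problem -/

/-- Without error and leakage, key agreement gives I(key; W₄) ≥ `c s` ≥ H(key). Hence `W₄`
determines the key message on the support, and this message takes at least `M s` values there.
Selecting `M s` of them as source symbols and freezing the rest yields the code. -/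
theorem ZeroErrorSolvable.of_secured_admissible {P : MulticastProblem} {cap : P.Edge → ℝ}
    {c : P.Session → ℝ} {M : P.Session → ℕ} (hM : ∀ s, 0 < M s) (hc : ∀ s, c s = Real.logb 2 (M s))
    (h : P.secured.Admissible (P.securedRate c) (P.securedCap c cap)) :
    ZeroErrorSolvable P (fun s => Fin (M s)) cap := by
  classical
  obtain ⟨C, hcap, hrate, herr, hleak⟩ := h
  have hkey : ∀ i : P.Copy, c i.1.1 ≤
      mutualInfo C.prob (C.msg (.keyOut i.1.1)) (C.msg (.w4 i)) := by
    intro i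
    have h0 : MulticastProblem.copyError C i = 0 := le_antisymm
      ((MulticastProblem.copyError_le C i).trans herr.le) (MulticastProblem.copyError_nonneg C i)
    have h1 := MulticastProblem.le_mutualInfo_keyOut C i
    rw [h0, fanoBound_zero, hleak i, (hrate ()).1] at h1
    have h2 := (hrate ()).2
    have h3 : C.msgEntropy (.w2 i) ≤ 2 * (∑ s, c s) - c i.1.1 := (hcap (.w2 i)).1.trans (hcap (.w2 i)).2
    change 2 * (∑ s, c s) ≤ _ at h2
    linarith
  have hkout : ∀ s, entropy C.prob (C.msg (.keyOut s)) ≤ c s := fun s =>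
    (hcap (.keyOut s)).1.trans (hcap (.keyOut s)).2
  have hdet : ∀ i : P.Copy, entropy C.prob (fun ω => (C.msg (.keyOut i.1.1) ω, C.msg (.w4 i) ω)) ≤
      entropy C.prob (C.msg (.w4 i)) := by
    intro i
    have h1 := hkey i
    have h2 := hkout i.1.1
    rw [mutualInfo] at h1
    linarith
  obtain ⟨ω₀, h₀⟩ := C.exists_prob_pos
  have hφ : ∀ s, ∃ φ : Fin (M s) → Outcome P.secured.toMulticastProblem C.Src C.Rnd,
      (∀ t, 0 < C.prob (φ t)) ∧
      ((P.dest s).Nonempty → Function.Injective fun t => C.msg (.keyOut s) (φ t)) := by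
    intro s
    -- A session that nobody requests has no copy, so its key is unconstrained; a constant choice
    -- suffices.
    by_cases hs : (P.dest s).Nonempty
    · obtain ⟨u, hu⟩ := hs
      let i : P.Copy := ⟨(s, u), hu⟩
      let S : Finset (C.Msg (.keyOut s)) :=
        (Finset.univ.filter fun ω => 0 < C.prob ω).image (C.msg (.keyOut s))
      have h1 : Real.logb 2 (M s) ≤ Real.logb 2 S.card := by
        rw [← hc]
        have ha := hkey i
        have hb := entropy_le_of_determines C.isMass_prob
          (X := fun ω => (C.msg (.keyOut s) ω, C.msg (.w4 i) ω)) (Y := C.msg (.w4 i))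
          (fun ω ω' h => (Prod.ext_iff.1 h).2)
        have hd := entropy_le_log_support C.isMass_prob (C.msg (.keyOut s)) S fun ω hω =>
          Finset.mem_image_of_mem _ (by simpa using hω)
        rw [mutualInfo] at ha
        change c s ≤ entropy C.prob (C.msg (.keyOut s)) + _ - _ at ha
        change c s ≤ _
        linarith
      have hS : 0 < S.card := Finset.card_pos.2 ⟨_, Finset.mem_image_of_mem _ (by simpa using h₀)⟩
      have h2 : M s ≤ S.card := by
        rw [Real.logb_le_logb one_lt_two (by exact_mod_cast hM s) (by exact_mod_cast hS)] at h1
        exact_mod_cast h1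
      obtain ⟨g⟩ : Nonempty (Fin (M s) ↪ S) :=
        Function.Embedding.nonempty_of_card_le (by simpa using h2)
      choose φ hφ using fun t => Finset.mem_image.1 (g t).2
      refine ⟨φ, fun t => by simpa using (hφ t).1, fun _ t t' h => g.injective (Subtype.ext ?_)⟩
      rw [← (hφ t).2, ← (hφ t').2]
      exact h
    · exact ⟨fun _ => ω₀, fun _ => h₀, fun h => absurd h hs⟩
  choose φ hφ hinj using hφ
  -- Key randomness is taken from a different outcome for each session. The law is a product, so the
  -- combined outcome still has positive probability.
  let o : (∀ s, Fin (M s)) → Outcome P.secured.toMulticastProblem C.Src C.Rnd := fun t =>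
    (ω₀.1, fun v => match v with
      | .keyGen s => (φ s (t s)).2 (.keyGen s)
      | .given v => ω₀.2 (.given v)
      | .source => ω₀.2 .source
      | .encrypt i => ω₀.2 (.encrypt i)
      | .decrypt i => ω₀.2 (.decrypt i)
      | .sink i => ω₀.2 (.sink i))
  have ho : ∀ t, 0 < C.prob (o t) := by
    intro t
    rw [C.prob_pos_iff] at h₀ ⊢
    intro v
    cases v with
    | keyGen s => exact (C.prob_pos_iff _).1 (hφ s (t s)) (.keyGen s)
    | _ => exact h₀ _
  have hko : ∀ s t, C.msg (.keyOut s) (o t) = C.msg (.keyOut s) (φ s (t s)) := fun s t =>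
    MulticastProblem.keyOut_congr C rfl
  have hview : ∀ v t t', SameSrcView P (fun e t => C.msg (.given e) (o t)) v t t' →
      SameView P.secured.toMulticastProblem C.msg (.given v) (o t) (o t') := by
    intro v t t' h
    refine MulticastProblem.sameView_given C (fun s hs => ?_) h.2 rfl
    rw [hko, hko, h.1 s hs]
  refine ⟨fun e => C.Msg (.given e), fun e => C.fintypeMsg (.given e),
    fun e t => C.msg (.given e) (o t), fun e => (hcap (.given e)).2,
    fun e t t' h => C.msg_causal (.given e) _ _ (hview _ _ _ h), fun s v hv t t' h => ?_⟩
  let i : P.Copy := ⟨(s, v), hv⟩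
  have h4 : C.msg (.w4 i) (o t) = C.msg (.w4 i) (o t') :=
    C.msg_causal (.w4 i) _ _ (hview _ _ _ h)
  have h5 : C.msg (.keyOut s) (o t) = C.msg (.keyOut s) (o t') :=
    eq_of_entropy_pair_le C.isMass_prob (hdet i) (ho t) (ho t') h4
  rw [hko, hko] at h5
  exact hinj s ⟨v, hv⟩ h5

theorem admissible_iff_secured_admissible (P : MulticastProblem) (rate : P.Session → ℝ)
    (cap : P.Edge → ℝ) (c : P.Session → ℝ)
    (hc : ∀ s, c s = Real.logb 2 (⌈(2 : ℝ) ^ rate s⌉₊ : ℝ)) :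
    P.withoutSecrecy.Admissible rate cap ↔
      P.secured.Admissible (P.securedRate c) (P.securedCap c cap) := by
  have hM : ∀ s, 0 < ⌈(2 : ℝ) ^ rate s⌉₊ := fun s =>
    Nat.ceil_pos.2 (Real.rpow_pos_of_pos two_pos _)
  have : ∀ s, NeZero ⌈(2 : ℝ) ^ rate s⌉₊ := fun s => ⟨(hM s).ne'⟩
  constructor
  · intro h
    obtain ⟨C, hcap, hrate, herr, hleak⟩ :=
      (ZeroErrorSolvable.of_admissible h).exists_securedCode (c := c) (fun s => by simp [hc])
    exact ⟨C, fun e => ⟨C.msgEntropy_le_msgBits e, hcap e⟩,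
      fun s => ⟨C.srcEntropy_eq_srcBits s, (hrate s).ge⟩, herr, hleak⟩
  · intro h
    refine (ZeroErrorSolvable.of_secured_admissible hM hc h).admissible fun s => ?_
    rw [Fintype.card_fin, Real.le_logb_iff_rpow_le one_lt_two (by exact_mod_cast hM s)]
    exact Nat.le_ceil _

/-! ## Joint entropies and polymatroids -/

/-- The joint entropy of the variables with index in `A`. -/
noncomputable def jointEntropy {Ω J : Type} [Fintype Ω] {V : J → Type} (p : Ω → ℝ)
    (Y : (j : J) → Ω → V j) (A : Finset J) : ℝ :=
  entropy p fun ω (j : A) => Y j ω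

/-- A normalized, monotone and submodular set function. -/
structure IsPolymatroid {J : Type} [DecidableEq J] (g : Finset J → ℝ) : Prop where
  empty : g ∅ = 0
  mono : ∀ A B, A ⊆ B → g A ≤ g B
  submod : ∀ A B, g (A ∪ B) + g (A ∩ B) ≤ g A + g B

section JointEntropy

theorem restrict_eq_iff {Ω J : Type} {V : J → Type} {Y : (j : J) → Ω → V j} {A : Finset J} {ω ω' : Ω} :
    (fun j : A => Y j ω) = (fun j : A => Y j ω') ↔ ∀ j ∈ A, Y j ω = Y j ω' :=
  ⟨fun h j hj => congrFun h ⟨j, hj⟩, fun h => funext fun j => h j j.2⟩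

variable {Ω J : Type} [Fintype Ω] {V : J → Type} {p : Ω → ℝ} {Y : (j : J) → Ω → V j}

theorem isPolymatroid_jointEntropy [DecidableEq J] (hp : IsMass p) :
    IsPolymatroid (jointEntropy p Y) where
  empty := entropy_const hp fun ω ω' => restrict_eq_iff.2 (by simp)
  mono A B h := entropy_le_of_determines hp fun ω ω' hω =>
    restrict_eq_iff.2 fun j hj => restrict_eq_iff.1 hω j (h hj)
  submod A B := by
    refine entropy_submodular hp (fun ω ω' h => ?_) (fun ω ω' h => ?_) (fun ω ω' h => ?_) <;>
      refine restrict_eq_iff.2 fun j hj => ?_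
    · obtain ⟨h1, h2⟩ := Prod.ext_iff.1 h
      rcases Finset.mem_union.1 hj with hj | hj
      · exact restrict_eq_iff.1 h1 j hj
      · exact restrict_eq_iff.1 h2 j hj
    · exact restrict_eq_iff.1 h j (Finset.mem_inter.1 hj).1
    · exact restrict_eq_iff.1 h j (Finset.mem_inter.1 hj).2

theorem jointEntropy_singleton (j : J) : jointEntropy p Y {j} = entropy p (Y j) :=
  entropy_congr (fun _ _ h => restrict_eq_iff.1 h j (by simp))
    fun _ _ h => restrict_eq_iff.2 fun j' hj' => by rw [Finset.mem_singleton.1 hj']; exact h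

theorem jointEntropy_insert [DecidableEq J] (A : Finset J) (j : J) :
    jointEntropy p Y (insert j A) = entropy p (fun ω => ((fun j : A => Y j ω), Y j ω)) := by
  refine entropy_congr (fun ω ω' h => ?_) (fun ω ω' h => restrict_eq_iff.2 fun j' hj' => ?_)
  · have h := restrict_eq_iff.1 h
    exact Prod.ext (restrict_eq_iff.2 fun j' hj' => h j' (by simp [hj'])) (h j (by simp))
  · obtain ⟨h1, h2⟩ := Prod.ext_iff.1 h
    rcases Finset.mem_insert.1 hj' with rfl | hj'
    · exact h2
    · exact restrict_eq_iff.1 h1 j' hj'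

theorem jointEntropy_le_sum [DecidableEq J] (hp : IsMass p) (A : Finset J) :
    jointEntropy p Y A ≤ ∑ j ∈ A, entropy p (Y j) := by
  induction A using Finset.induction_on with
  | empty => rw [(isPolymatroid_jointEntropy hp).empty]; simp
  | insert j A hj ih =>
    rw [Finset.sum_insert hj, jointEntropy_insert]
    have := entropy_pair_le hp (fun ω (j : A) => Y j ω) (Y j)
    rw [jointEntropy] at ih
    linarith

end JointEntropy

/-! ## Removing the internal randomness -/

section Average

variable {Ω Ω' A B : Type} [Fintype Ω] [Fintype Ω'] {p : Ω → ℝ} {q : Ω' → ℝ}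

/-- Change of variables: `h` says that `φ` carries the law `q` to `p`. -/
theorem entropy_comp_of_law {φ : Ω' → Ω}
    (h : ∀ f : Ω → ℝ, ∑ z, q z * f (φ z) = ∑ ω, p ω * f ω) (X : Ω → A) :
    entropy q (fun z => X (φ z)) = entropy p X := by
  classical
  have h1 : ∀ a, probEq q (fun z => X (φ z)) a = probEq p X a := by
    intro a
    have := h fun ω => if X ω = a then 1 else 0
    simpa only [probEq, Finset.sum_filter, mul_ite, mul_one, mul_zero] using this
  rw [entropy_eq_sum, entropy_eq_sum, ← h]
  simp only [h1]

theorem isMass_prod (hp : IsMass p) (hq : IsMass q) : IsMass fun z : Ω × Ω' => p z.1 * q z.2 where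
  nonneg z := mul_nonneg (hp.nonneg _) (hq.nonneg _)
  sum_one := by rw [Fintype.sum_prod_type, ← Fintype.sum_mul_sum, hp.sum_one, hq.sum_one, one_mul]

/-- The chain rule with the whole first coordinate revealed: given `z.1 = ω`, the second coordinate
still has law `q`. -/
theorem entropy_pair_fst (hp : IsMass p) (hq : IsMass q) (X : Ω × Ω' → A) :
    entropy (fun z : Ω × Ω' => p z.1 * q z.2) (fun z => (X z, z.1)) =
      entropy p id + ∑ ω, p ω * entropy q (fun ω' => X (ω, ω')) := by
  classical
  have h1 : ∀ ω a, probEq (fun z : Ω × Ω' => p z.1 * q z.2) (fun z => (X z, z.1)) (a, ω) =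
      p ω * probEq q (fun ω' => X (ω, ω')) a := by
    intro ω a
    rw [probEq, probEq, Finset.sum_filter, Finset.sum_filter, Fintype.sum_prod_type,
      Finset.sum_eq_single ω, Finset.mul_sum]
    · exact Finset.sum_congr rfl fun ω' _ => by simp
    · intro ω'' _ hne
      simp [hne]
    · simp
  have h2 : ∀ ω, probEq p id ω = p ω := by
    intro ω
    rw [probEq, Finset.sum_filter]
    simp
  have h3 : ∀ ω, p ω * entropy q (fun ω' => X (ω, ω')) =
      (∑ ω', p ω * q ω' * -Real.log (probEq q (fun ω' => X (ω, ω')) (X (ω, ω')))) /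
        Real.log 2 := by
    intro ω
    rw [entropy_eq_sum, ← mul_div_assoc, Finset.mul_sum]
    simp only [mul_assoc]
  rw [entropy_eq_sum, entropy_eq_sum, Finset.sum_congr rfl fun ω _ => h3 ω, ← Finset.sum_div,
    ← add_div, ← Finset.sum_add_distrib, Fintype.sum_prod_type]
  congr 1
  refine Finset.sum_congr rfl fun ω _ => ?_
  simp only [h1, h2, id]
  have h4 : p ω * -Real.log (p ω) = ∑ ω', p ω * q ω' * -Real.log (p ω) := by
    rw [← Finset.sum_mul, ← Finset.mul_sum, hq.sum_one, mul_one]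
  rw [h4, ← Finset.sum_add_distrib]
  refine Finset.sum_congr rfl fun ω' _ => ?_
  rcases (hp.nonneg ω).eq_or_lt with h | h
  · simp [← h]
  rcases (hq.nonneg ω').eq_or_lt with h' | h'
  · simp [← h']
  rw [Real.log_mul h.ne' (probEq_pos hq (fun ω' => X (ω, ω')) h').ne']
  ring

/-- Conditional entropy does not increase on average if some of the randomness is revealed. -/
theorem average_condEntropy_le (hp : IsMass p) {φ : Ω × Ω → Ω}
    (h : ∀ f : Ω → ℝ, ∑ z : Ω × Ω, (p z.1 * p z.2) * f (φ z) = ∑ ω, p ω * f ω)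
    (X : Ω → A) (Y : Ω → B) :
    ∑ ρ, p ρ * (entropy p (fun ω => (X (φ (ρ, ω)), Y (φ (ρ, ω)))) -
        entropy p (fun ω => Y (φ (ρ, ω)))) ≤
      entropy p (fun ω => (X ω, Y ω)) - entropy p Y := by
  have hpp := isMass_prod hp hp
  have h1 := entropy_comp_of_law h (fun ω => (X ω, Y ω))
  have h2 := entropy_comp_of_law h Y
  have h3 := entropy_pair_fst hp hp (fun z => (X (φ z), Y (φ z)))
  have h4 := entropy_pair_fst hp hp (fun z => Y (φ z))
  -- Conditioning additionally on the first coordinate does not increase entropy; by `h3` and `h4`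
  -- the left side of the claim is that conditional entropy.
  have h5 := entropy_submodular hpp (X := fun z : Ω × Ω => (X (φ z), Y (φ z)))
    (Y := fun z : Ω × Ω => (Y (φ z), z.1)) (U := fun z => ((X (φ z), Y (φ z)), z.1))
    (I := fun z => Y (φ z)) (fun _ _ h => by simp_all) (fun _ _ h => by simp_all)
    (fun _ _ h => by simp_all)
  simp only [mul_sub, Finset.sum_sub_distrib]
  linarith

/-- Some outcome is at most the mean. -/
theorem exists_le_of_average_le (hp : IsMass p) {f : Ω → ℝ} {c : ℝ}
    (h : ∑ ω, p ω * f ω ≤ c) : ∃ ω, f ω ≤ c := by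
  by_contra hne
  push Not at hne
  have h1 : ∑ ω, p ω * (f ω - c) = ∑ ω, p ω * f ω - c := by
    simp only [mul_sub, Finset.sum_sub_distrib]
    rw [← Finset.sum_mul, hp.sum_one, one_mul]
  have h2 : ∀ ω ∈ Finset.univ, 0 ≤ p ω * (f ω - c) := fun ω _ =>
    mul_nonneg (hp.nonneg ω) (by linarith [hne ω])
  have h3 : ∑ ω, p ω * (f ω - c) = 0 := le_antisymm (by linarith) (Finset.sum_nonneg h2)
  have h4 : ∀ ω, p ω = 0 := fun ω =>
    (mul_eq_zero.1 ((Finset.sum_eq_zero_iff_of_nonneg h2).1 h3 ω (Finset.mem_univ _))).resolve_right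
      (by linarith [hne ω])
  have := hp.sum_one
  simp [h4] at this

end Average

namespace MulticastProblem

variable {P : MulticastProblem}

/-- The sessions and links that are visible at the node `v`. -/
noncomputable def inputs (P : MulticastProblem) (v : P.Node) : Finset (P.Session ⊕ P.Edge) :=
  open Classical in Finset.univ.filter fun j => Sum.elim P.origin P.head j = v

theorem inl_mem_inputs {v : P.Node} {s : P.Session} :
    Sum.inl s ∈ P.inputs v ↔ P.origin s = v := by simp [inputs]

theorem inr_mem_inputs {v : P.Node} {e : P.Edge} :
    Sum.inr e ∈ P.inputs v ↔ P.head e = v := by simp [inputs]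

variable (C : NetworkCode P.secured.toMulticastProblem)

/-- The keys take the place of the sources of the given network. -/
def keyOrGiven (P : MulticastProblem) : P.Session ⊕ P.Edge → P.secured.Edge :=
  Sum.elim .keyOut .given

/-- The variables of the given network in a code for the secured problem when all randomness, except
for the generation of the keys, is fixed to be `ρ`. -/
noncomputable def fixedVar (ρ : Outcome P.secured.toMulticastProblem C.Src C.Rnd)
    (j : P.Session ⊕ P.Edge) (ω : Outcome P.secured.toMulticastProblem C.Src C.Rnd) :
    C.Msg (P.keyOrGiven j) :=
  C.msg (P.keyOrGiven j) (override (Set.range .keyGen) ρ ω)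

theorem fixedVar_inl (ρ : Outcome P.secured.toMulticastProblem C.Src C.Rnd) (s : P.Session) :
    fixedVar C ρ (.inl s) = C.msg (.keyOut s) :=
  funext fun _ => keyOut_congr C (override_snd_mem ⟨s, rfl⟩)

/-- Once the local randomness is fixed to `ρ`, the inputs are all that a node knows. This is what
turns causality into entropy equalities between the fixed variables. -/
theorem sameView_override {ρ ω ω' : Outcome P.secured.toMulticastProblem C.Src C.Rnd} {v : P.Node}
    (h : ∀ j ∈ P.inputs v, fixedVar C ρ j ω = fixedVar C ρ j ω') :
    SameView P.secured.toMulticastProblem C.msg (.given v)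
      (override (Set.range .keyGen) ρ ω) (override (Set.range .keyGen) ρ ω') := by
  refine sameView_given C (fun s hs => h (.inl s) (inl_mem_inputs.2 hs))
    (fun e he => h (.inr e) (inr_mem_inputs.2 he)) ?_
  have hv : (GluedNode.given v : P.secured.Node) ∉ Set.range GluedNode.keyGen := by
    rintro ⟨_, ⟨⟩⟩
  exact (override_snd_notMem hv).trans (override_snd_notMem hv).symm

/-- Distinct sessions have distinct key generators, so their key messages are independent, whatever
`ρ` is. -/
theorem jointEntropy_fixedVar_image_inl [DecidableEq (P.Session ⊕ P.Edge)]
    (ρ : Outcome P.secured.toMulticastProblem C.Src C.Rnd) (A : Finset P.Session) :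
    jointEntropy C.prob (fixedVar C ρ) (A.image Sum.inl) =
      ∑ s ∈ A, C.msgEntropy (.keyOut s) := by
  classical
  induction A using Finset.induction_on with
  | empty => simpa using (isPolymatroid_jointEntropy C.isMass_prob).empty
  | insert s A hs ih =>
    rw [Finset.image_insert, jointEntropy_insert, Finset.sum_insert hs, ← ih, add_comm,
      C.entropy_pair_of_override {.keyGen s}, fixedVar_inl]
    · rfl
    · intro ω' ω
      refine restrict_eq_iff.2 fun j hj => ?_
      obtain ⟨s', hs', rfl⟩ := Finset.mem_image.1 hj
      rw [fixedVar_inl]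
      refine keyOut_congr C (override_snd_notMem fun h => hs ?_)
      rw [← GluedNode.keyGen.inj (Set.mem_singleton_iff.1 h)]
      exact hs'
    · intro ω' ω
      rw [fixedVar_inl]
      exact keyOut_congr C (override_snd_mem (Set.mem_singleton _))

theorem jointEntropy_fixedVar_edge [DecidableEq (P.Session ⊕ P.Edge)]
    (ρ : Outcome P.secured.toMulticastProblem C.Src C.Rnd) (e : P.Edge) :
    jointEntropy C.prob (fixedVar C ρ) (insert (.inr e) (P.inputs (P.tail e))) =
      jointEntropy C.prob (fixedVar C ρ) (P.inputs (P.tail e)) := by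
  refine le_antisymm ?_ ((isPolymatroid_jointEntropy C.isMass_prob).mono _ _
    (Finset.subset_insert _ _))
  refine entropy_le_of_determines C.isMass_prob fun ω ω' h => restrict_eq_iff.2 fun j hj => ?_
  have h := restrict_eq_iff.1 h
  rcases Finset.mem_insert.1 hj with rfl | hj
  · exact C.msg_causal (.given e) _ _ (sameView_override C h)
  · exact h j hj

/-- The deficit of a code in the key agreement for the copy `i`. -/
noncomputable def keyGap (i : P.Copy) : ℝ :=
  C.msgBits (.keyOut i.1.1) - (C.srcEntropy () - C.msgEntropy (.w2 i) -
    C.leakage (P.secured.target i) (P.secured.tap i) - fanoBound (copyError C i) * C.srcBits ())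

theorem condEntropy_keyOut_le (i : P.Copy) :
    entropy C.prob (fun ω => (C.msg (.keyOut i.1.1) ω, C.msg (.w4 i) ω)) -
      entropy C.prob (C.msg (.w4 i)) ≤ keyGap C i := by
  have h1 := le_mutualInfo_keyOut C i
  have h2 := C.msgEntropy_le_msgBits (.keyOut i.1.1)
  change entropy C.prob (C.msg (.keyOut i.1.1)) ≤ _ at h2
  rw [mutualInfo] at h1
  rw [keyGap]
  linarith

theorem condEntropy_nonneg {Ω A B : Type} [Fintype Ω] {p : Ω → ℝ} (hp : IsMass p) (X : Ω → A)
    (Y : Ω → B) : 0 ≤ entropy p (fun ω => (X ω, Y ω)) - entropy p Y :=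
  sub_nonneg.2 (entropy_le_of_determines hp fun _ _ h => (Prod.ext_iff.1 h).2)

/-- A receiver in the given network may use randomness to learn the key, but fixing that randomness
well costs nothing. Averaging the sum of the nonnegative deficits over all copies produces one `ρ`
that suits every receiver. -/
theorem exists_fixedVar_dest [DecidableEq (P.Session ⊕ P.Edge)] :
    ∃ ρ, ∀ s, ∀ v ∈ P.dest s, jointEntropy C.prob (fixedVar C ρ) (insert (.inl s) (P.inputs v)) ≤
      jointEntropy C.prob (fixedVar C ρ) (P.inputs v) + ∑ i : P.Copy, keyGap C i := by
  let φ : Outcome P.secured.toMulticastProblem C.Src C.Rnd ×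
      Outcome P.secured.toMulticastProblem C.Src C.Rnd → _ :=
    fun z => override (Set.range GluedNode.keyGen) z.1 z.2
  let D : P.Copy → Outcome P.secured.toMulticastProblem C.Src C.Rnd → ℝ := fun i ρ =>
    entropy C.prob (fun ω => (C.msg (.keyOut i.1.1) (φ (ρ, ω)), C.msg (.w4 i) (φ (ρ, ω)))) -
      entropy C.prob (fun ω => C.msg (.w4 i) (φ (ρ, ω)))
  have hD : ∀ i ρ, 0 ≤ D i ρ := fun i ρ => condEntropy_nonneg C.isMass_prob _ _
  have hle : ∑ ρ, C.prob ρ * ∑ i, D i ρ ≤ ∑ i : P.Copy, keyGap C i := by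
    simp only [Finset.mul_sum]
    rw [Finset.sum_comm]
    refine Finset.sum_le_sum fun i _ => ?_
    exact (average_condEntropy_le C.isMass_prob (φ := φ)
      (C.sum_override (Set.range GluedNode.keyGen)) _ _).trans (condEntropy_keyOut_le C i)
  obtain ⟨ρ, hρ⟩ := exists_le_of_average_le C.isMass_prob hle
  refine ⟨ρ, fun s v hv => ?_⟩
  let i : P.Copy := ⟨(s, v), hv⟩
  have h1 : D i ρ ≤ ∑ i : P.Copy, keyGap C i :=
    (Finset.single_le_sum (f := fun i => D i ρ) (fun i _ => hD i ρ) (Finset.mem_univ i)).trans hρ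
  -- With `ρ` fixed, `W₄` is a function of the inputs of `v`, so they know at least as much about
  -- the key as `W₄` does.
  have h2 := entropy_submodular C.isMass_prob
    (X := fun ω => (C.msg (.keyOut s) (φ (ρ, ω)), C.msg (.w4 i) (φ (ρ, ω))))
    (Y := fun ω (j : P.inputs v) => fixedVar C ρ j ω)
    (U := fun ω (j : (insert (Sum.inl s) (P.inputs v) : Finset _)) => fixedVar C ρ j ω)
    (I := fun ω => C.msg (.w4 i) (φ (ρ, ω)))
    (fun ω ω' h => restrict_eq_iff.2 fun j hj => by
      obtain ⟨ha, hb⟩ := Prod.ext_iff.1 h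
      rcases Finset.mem_insert.1 hj with rfl | hj
      · exact (Prod.ext_iff.1 ha).1
      · exact restrict_eq_iff.1 hb j hj)
    (fun ω ω' h => (Prod.ext_iff.1 h).2)
    (fun ω ω' h => C.msg_causal (.w4 i) _ _ (sameView_override C (restrict_eq_iff.1 h)))
  simp only [jointEntropy]
  simp only [D] at h1
  change entropy C.prob (fun ω => (C.msg (.keyOut s) (φ (ρ, ω)), C.msg (.w4 i) (φ (ρ, ω)))) -
    _ ≤ _ at h1
  linarith

end MulticastProblem

/-! ## Scaling entropic functions -/

section Scaling

variable {N : ℕ}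

theorem entropic_iff_jointEntropy {h : Finset (Fin N) → ℝ} :
    Entropic h ↔ ∃ (Ω : Type) (_ : Fintype Ω) (p : Ω → ℝ) (A : Fin N → Type)
      (X : (i : Fin N) → Ω → A i), IsMass p ∧ jointEntropy p X = h := by
  constructor
  · rintro ⟨Ω, _, p, A, X, h1, h2, h3⟩
    exact ⟨Ω, _, p, A, X, ⟨h1, h2⟩, funext h3⟩
  · rintro ⟨Ω, _, p, A, X, hp, rfl⟩
    exact ⟨Ω, _, p, A, X, hp.nonneg, hp.sum_one, fun _ => rfl⟩

theorem almostEntropic_iff_mem_closure {h : Finset (Fin N) → ℝ} :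
    AlmostEntropic h ↔ h ∈ closure {g | Entropic g} := by
  rw [mem_closure_iff_seq_limit]
  rfl

theorem isMass_unit : IsMass (fun _ : Unit => (1 : ℝ)) :=
  ⟨fun _ => zero_le_one, by simp⟩

theorem entropic_zero : Entropic (0 : Finset (Fin N) → ℝ) :=
  entropic_iff_jointEntropy.2 ⟨Unit, _, fun _ => 1, fun _ => Unit, fun _ _ => (), isMass_unit,
    funext fun _ => entropy_const isMass_unit fun _ _ => rfl⟩

/-- Realized by pairing the variables of two independent families index by index. -/
theorem Entropic.add {g h : Finset (Fin N) → ℝ} (hg : Entropic g) (hh : Entropic h) :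
    Entropic (g + h) := by
  classical
  obtain ⟨Ω, _, p, A, X, hp, rfl⟩ := entropic_iff_jointEntropy.1 hg
  obtain ⟨Ω', _, q, B, Y, hq, rfl⟩ := entropic_iff_jointEntropy.1 hh
  refine entropic_iff_jointEntropy.2 ⟨Ω × Ω', _, fun z => p z.1 * q z.2, fun i => A i × B i,
    fun i z => (X i z.1, Y i z.2), isMass_prod hp hq, funext fun α => ?_⟩
  let Xα := fun ω (i : α) => X i ω
  let Yα := fun ω (i : α) => Y i ω
  have h1 : jointEntropy (fun z : Ω × Ω' => p z.1 * q z.2) (fun i z => (X i z.1, Y i z.2)) α =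
      entropy (fun z : Ω × Ω' => p z.1 * q z.2) (fun z => (Xα z.1, Yα z.2)) := by
    refine entropy_congr (fun z z' h => ?_) (fun z z' h => ?_)
    · have h := (restrict_eq_iff (Y := fun i (z : Ω × Ω') => (X i z.1, Y i z.2))).1 h
      exact Prod.ext (restrict_eq_iff.2 fun i hi => (Prod.ext_iff.1 (h i hi)).1)
        (restrict_eq_iff.2 fun i hi => (Prod.ext_iff.1 (h i hi)).2)
    · obtain ⟨ha, hb⟩ := Prod.ext_iff.1 h
      exact (restrict_eq_iff (Y := fun i (z : Ω × Ω') => (X i z.1, Y i z.2))).2 fun i hi =>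
        Prod.ext (restrict_eq_iff.1 ha i hi) (restrict_eq_iff.1 hb i hi)
  have h2 : entropy (fun z : Ω × Ω' => p z.1 * q z.2) (fun z => Xα z.1) = entropy p Xα := by
    refine entropy_comp_of_law (φ := Prod.fst) (fun f => ?_) Xα
    rw [Fintype.sum_prod_type]
    refine Finset.sum_congr rfl fun ω _ => ?_
    simp only
    rw [← Finset.sum_mul, ← Finset.mul_sum, hq.sum_one, mul_one]
  have h3 : entropy (fun z : Ω × Ω' => p z.1 * q z.2) (fun z => Yα z.2) = entropy q Yα := by
    refine entropy_comp_of_law (φ := Prod.snd) (fun f => ?_) Yα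
    rw [Fintype.sum_prod_type_right]
    refine Finset.sum_congr rfl fun ω _ => ?_
    simp only
    rw [← Finset.sum_mul, ← Finset.sum_mul, hp.sum_one, one_mul]
  rw [h1, entropy_pair_of_indep (isMass_prod hp hq), h2, h3]
  · rfl
  · intro a b
    have e1 : probEq (fun z : Ω × Ω' => p z.1 * q z.2) (fun z => Xα z.1) a = probEq p Xα a := by
      rw [probEq, probEq, Finset.sum_filter, Finset.sum_filter, Fintype.sum_prod_type]
      refine Finset.sum_congr rfl fun ω _ => ?_
      by_cases h : Xα ω = a <;> simp [h, ← Finset.mul_sum, hq.sum_one]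
    have e2 : probEq (fun z : Ω × Ω' => p z.1 * q z.2) (fun z => Yα z.2) b = probEq q Yα b := by
      rw [probEq, probEq, Finset.sum_filter, Finset.sum_filter, Fintype.sum_prod_type_right]
      refine Finset.sum_congr rfl fun ω _ => ?_
      by_cases h : Yα ω = b <;> simp [h, ← Finset.sum_mul, hp.sum_one]
    rw [e1, e2, probEq, probEq, probEq, Finset.sum_filter, Finset.sum_filter, Finset.sum_filter,
      Finset.sum_mul_sum, Fintype.sum_prod_type]
    refine Finset.sum_congr rfl fun ω _ => Finset.sum_congr rfl fun ω' _ => ?_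
    by_cases h : Xα ω = a <;> by_cases h' : Yα ω' = b <;> simp [h, h']

theorem Entropic.nsmul {h : Finset (Fin N) → ℝ} (hh : Entropic h) (k : ℕ) :
    Entropic (k • h) := by
  induction k with
  | zero => rw [zero_smul]; exact entropic_zero
  | succ k ih => rw [succ_nsmul]; exact ih.add hh

/-- The law of a biased coin. -/
noncomputable def coin (t : ℝ) (b : Bool) : ℝ := if b then t else 1 - t

theorem isMass_coin {t : ℝ} (h0 : 0 ≤ t) (h1 : t ≤ 1) : IsMass (coin t) where
  nonneg b := by cases b <;> simp [coin, h0, h1]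
  sum_one := by simp [coin]

theorem entropy_coin (t : ℝ) : entropy (coin t) id = Real.binEntropy t / Real.log 2 := by
  classical
  have h : ∀ b, probEq (coin t) id b = coin t b := by
    intro b
    rw [probEq, Finset.sum_filter]
    cases b <;> simp
  rw [entropy_eq_sum, Real.binEntropy, Real.log_inv, Real.log_inv]
  simp [h, coin, add_comm]

/-- Erasing all variables, with a certain probability, scales their joint entropies. -/
theorem Entropic.erase {h : Finset (Fin N) → ℝ} (hh : Entropic h) {t : ℝ} (h0 : 0 ≤ t)
    (h1 : t ≤ 1) :
    Entropic fun α => (if α.Nonempty then Real.binEntropy t / Real.log 2 else 0) + t * h α := by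
  obtain ⟨Ω, _, p, A, X, hp, rfl⟩ := entropic_iff_jointEntropy.1 hh
  have hc := isMass_coin h0 h1
  let Y : (i : Fin N) → Bool × Ω → Option (A i) :=
    fun i z => if z.1 then some (X i z.2) else none
  refine entropic_iff_jointEntropy.2 ⟨Bool × Ω, _, fun z => coin t z.1 * p z.2, fun i => Option (A i),
    Y, isMass_prod hc hp, funext fun α => ?_⟩
  rcases α.eq_empty_or_nonempty with rfl | ⟨i, hi⟩
  · rw [(isPolymatroid_jointEntropy (isMass_prod hc hp)).empty,
      (isPolymatroid_jointEntropy hp).empty]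
    simp
  rw [if_pos ⟨i, hi⟩]
  -- Any single variable already shows whether erasure has occurred, so for nonempty `α` the coin
  -- may be added for free.
  have e1 : jointEntropy (fun z => coin t z.1 * p z.2) Y α =
      entropy (fun z => coin t z.1 * p z.2) (fun z => ((fun j : α => Y j z), z.1)) := by
    refine entropy_congr (fun z z' hz => Prod.ext hz ?_) (fun z z' hz => (Prod.ext_iff.1 hz).1)
    have := restrict_eq_iff.1 hz i hi
    simp only [Y] at this
    cases h1 : z.1 <;> cases h2 : z'.1 <;> simp_all
  rw [e1, entropy_pair_fst hc hp, entropy_coin, Fintype.sum_bool]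
  have e2 : entropy p (fun ω (j : α) => Y j (true, ω)) = jointEntropy p X α := by
    refine entropy_congr (fun ω ω' h => restrict_eq_iff.2 fun j hj => ?_)
      (fun ω ω' h => restrict_eq_iff.2 fun j hj => ?_)
    · simpa [Y] using restrict_eq_iff.1 h j hj
    · simpa [Y] using restrict_eq_iff.1 h j hj
  have e3 : entropy p (fun ω (j : α) => Y j (false, ω)) = 0 := by
    refine entropy_const hp (fun ω ω' => restrict_eq_iff.2 fun j hj => ?_)
    simp [Y]
  rw [e2, e3]
  simp [coin]

/-- Take `k` independent copies and keep all of them with probability `t / k`, erasing them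
otherwise. The main term is exactly `t * h`, and the entropy of the coin tends to 0. -/
theorem Entropic.smul_mem_closure {h : Finset (Fin N) → ℝ} (hh : Entropic h) {t : ℝ} (ht : 0 ≤ t) :
    t • h ∈ closure {g : Finset (Fin N) → ℝ | Entropic g} := by
  have hlim : Tendsto (fun k : ℕ => t / (k : ℝ)) atTop (𝓝 0) := tendsto_const_div_atTop_nhds_zero_nat t
  have hev : ∀ᶠ k : ℕ in atTop, t / k ≤ 1 := hlim.eventually (ge_mem_nhds one_pos |>.mono fun _ h => h)
  refine mem_closure_of_tendsto (f := fun (k : ℕ) α =>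
    (if α.Nonempty then Real.binEntropy (t / k) / Real.log 2 else 0) + t / k * (k • h) α) ?_
    (hev.mono fun k hk => (hh.nsmul k).erase (by positivity) hk) (b := atTop)
  refine tendsto_pi_nhds.2 fun α => ?_
  have h1 : Tendsto (fun k : ℕ => if α.Nonempty then Real.binEntropy (t / k) / Real.log 2 else 0)
      atTop (𝓝 0) := by
    split_ifs
    · have := ((Real.binEntropy_continuous.tendsto 0).comp hlim).div_const (Real.log 2)
      simpa using this
    · exact tendsto_const_nhds
  have h2 : Tendsto (fun k : ℕ => t / k * (k • h) α) atTop (𝓝 (t * h α)) := by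
    refine tendsto_const_nhds.congr' ?_
    filter_upwards [eventually_gt_atTop 0] with k hk
    have : (k : ℝ) ≠ 0 := by positivity
    simp only [Pi.smul_apply, nsmul_eq_mul]
    field_simp
  simpa using h1.add h2

theorem almostEntropic_of_tendsto {H : ℕ → Finset (Fin N) → ℝ} {r : ℕ → ℝ}
    {h : Finset (Fin N) → ℝ} (hH : ∀ n, Entropic (H n)) (hr : ∀ n, 0 < r n)
    (hlim : ∀ α, Tendsto (fun n => H n α / r n) atTop (𝓝 (h α))) : AlmostEntropic h := by
  rw [almostEntropic_iff_mem_closure, ← closure_closure]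
  refine mem_closure_of_tendsto (f := fun n => (r n)⁻¹ • H n) (b := atTop)
    (tendsto_pi_nhds.2 fun α => ?_)
    (Eventually.of_forall fun n => (hH n).smul_mem_closure (inv_nonneg.2 (hr n).le))
  refine (hlim α).congr fun n => ?_
  rw [Pi.smul_apply, smul_eq_mul, div_eq_inv_mul]

end Scaling

/-! ## The limit polymatroid of an achievable tuple -/

namespace MulticastProblem

/-- If a tuple is achievable for the secured problem, then the normalized entropies of the keys and
of the links of the given network accumulate at a polymatroid that obeys all constraints of the
given network. -/
theorem exists_limit_polymatroid (P : MulticastProblem) [DecidableEq (P.Session ⊕ P.Edge)]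
    (hdest : ∀ s, (P.dest s).Nonempty) {c : P.Session → ℝ} {cap : P.Edge → ℝ}
    (h : P.secured.Achievable (P.securedRate c) (P.securedCap c cap)) :
    ∃ g : Finset (P.Session ⊕ P.Edge) → ℝ, IsPolymatroid g ∧ (∀ e, g {.inr e} ≤ cap e) ∧
      (∀ A : Finset P.Session, g (A.image .inl) = ∑ s ∈ A, c s) ∧
      (∀ e, g (insert (.inr e) (P.inputs (P.tail e))) = g (P.inputs (P.tail e))) ∧
      (∀ s, ∀ v ∈ P.dest s, g (insert (.inl s) (P.inputs v)) = g (P.inputs v)) ∧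
      ∃ (H : ℕ → Finset (P.Session ⊕ P.Edge) → ℝ) (r : ℕ → ℝ), (∀ n, 0 < r n) ∧
        (∀ n, ∃ (Ω : Type) (_ : Fintype Ω) (p : Ω → ℝ) (V : P.Session ⊕ P.Edge → Type)
          (Y : (j : P.Session ⊕ P.Edge) → Ω → V j), IsMass p ∧ H n = jointEntropy p Y) ∧
        ∀ A, Tendsto (fun n => H n A / r n) atTop (𝓝 (g A)) := by
  obtain ⟨C, r, hr, hedge, hsrc, herr, hleak⟩ := h
  choose a b ha hb hab hbc using hedge
  obtain ⟨x, hx, hx', hxle⟩ := hsrc ()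
  choose ρ hρ using fun n => exists_fixedVar_dest (C n)
  let H : ℕ → Finset (P.Session ⊕ P.Edge) → ℝ := fun n =>
    jointEntropy (C n).prob (fixedVar (C n) (ρ n))
  have hpoly : ∀ n, IsPolymatroid (H n) := fun n => isPolymatroid_jointEntropy (C n).isMass_prob
  have hfano : ∀ i : P.Copy, Tendsto (fun n => fanoBound (copyError (C n) i)) atTop (𝓝 0) := by
    intro i
    have : Tendsto (fun n => copyError (C n) i) atTop (𝓝 0) :=
      squeeze_zero (fun n => copyError_nonneg (C n) i) (fun n => copyError_le (C n) i) herr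
    have := (continuous_fanoBound.tendsto 0).comp this
    rwa [fanoBound_zero] at this
  have hlow : ∀ i : P.Copy, Tendsto (fun n => ((C n).srcEntropy () - (C n).msgEntropy (.w2 i) -
      (C n).leakage (P.secured.target i) (P.secured.tap i) -
      fanoBound (copyError (C n) i) * (C n).srcBits ()) / r n) atTop (𝓝 (x - a (.w2 i))) := by
    intro i
    have := ((hx.sub (ha (.w2 i))).sub (hleak i)).sub ((hfano i).mul hx')
    simp only [sub_zero, zero_mul] at this
    refine this.congr fun n => ?_
    ring
  -- The source has rate at least `d` and `W₂` at most `d - c`, leaving `c` bits that have to pass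
  -- under the key.
  have hlow_le : ∀ i : P.Copy, c i.1.1 ≤ x - a (.w2 i) := by
    intro i
    have h1 : a (.w2 i) ≤ 2 * (∑ s, c s) - c i.1.1 := (hab (.w2 i)).trans (hbc (.w2 i))
    have h2 : 2 * ∑ s, c s ≤ x := hxle
    linarith
  have hgap : ∀ i : P.Copy, Tendsto (fun n => keyGap (C n) i / r n) atTop
      (𝓝 (b (.keyOut i.1.1) - (x - a (.w2 i)))) := fun i =>
    ((hb (.keyOut i.1.1)).sub (hlow i)).congr fun n => (sub_div _ _ _).symm
  have hgap_le : ∀ i : P.Copy, b (.keyOut i.1.1) - (x - a (.w2 i)) ≤ 0 := by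
    intro i
    have h1 : b (.keyOut i.1.1) ≤ c i.1.1 := hbc (.keyOut i.1.1)
    linarith [hlow_le i]
  -- Key agreement and the capacity of the key link squeeze the normalized key entropy. A receiver
  -- is needed for the lower bound, hence `hdest`.
  have hkey : ∀ s, a (.keyOut s) = c s := by
    intro s
    obtain ⟨u, hu⟩ := hdest s
    let i : P.Copy := ⟨(s, u), hu⟩
    refine le_antisymm ((hab (.keyOut s)).trans (hbc (.keyOut s))) ((hlow_le i).trans ?_)
    refine le_of_tendsto_of_tendsto' (hlow i) (ha (.keyOut s)) fun n => ?_
    refine div_le_div_of_nonneg_right ?_ (hr n).le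
    have h1 := le_mutualInfo_keyOut (C n) i
    have h2 := condEntropy_nonneg (C n).isMass_prob ((C n).msg (.keyOut s)) ((C n).msg (.w4 i))
    rw [mutualInfo] at h1
    change _ ≤ entropy (C n).prob ((C n).msg (.keyOut s)) + _ -
      entropy (C n).prob (fun ω => ((C n).msg (.keyOut s) ω, _)) at h1
    change _ ≤ entropy (C n).prob ((C n).msg (.keyOut s))
    linarith
  -- The normalized alphabet sizes converge, so all joint entropies stay in a compact box.
  obtain ⟨K, hK⟩ : ∃ K, ∀ n, ∑ j, (C n).msgBits (P.keyOrGiven j) / r n ≤ K := by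
    have : Tendsto (fun n => ∑ j, (C n).msgBits (P.keyOrGiven j) / r n) atTop
        (𝓝 (∑ j, b (P.keyOrGiven j))) := tendsto_finsetSum _ fun j _ => hb (P.keyOrGiven j)
    obtain ⟨K, hK⟩ := this.bddAbove_range
    exact ⟨K, fun n => hK ⟨n, rfl⟩⟩
  have hent : ∀ n j, entropy (C n).prob (fixedVar (C n) (ρ n) j) ≤
      (C n).msgBits (P.keyOrGiven j) := fun n j => entropy_le_log_card (C n).isMass_prob _
  have hmem : ∀ n, (fun A => H n A / r n) ∈ Set.Icc (fun _ => 0)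
      (fun _ : Finset (P.Session ⊕ P.Edge) => K) := by
    refine fun n => ⟨fun A => div_nonneg (entropy_nonneg (C n).isMass_prob _) (hr n).le,
      fun A => le_trans ?_ (hK n)⟩
    rw [← Finset.sum_div]
    refine div_le_div_of_nonneg_right ?_ (hr n).le
    refine ((hpoly n).mono _ _ (Finset.subset_univ A)).trans ?_
    exact (jointEntropy_le_sum (C n).isMass_prob _).trans (Finset.sum_le_sum fun j _ => hent n j)
  obtain ⟨g, -, φ, hφ, hg⟩ := isCompact_Icc.tendsto_subseq hmem
  have hg : ∀ A, Tendsto (fun n => H (φ n) A / r (φ n)) atTop (𝓝 (g A)) :=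
    fun A => tendsto_pi_nhds.1 hg A
  have hφ' := hφ.tendsto_atTop
  have hmono : ∀ A B, A ⊆ B → g A ≤ g B := fun A B hAB =>
    le_of_tendsto_of_tendsto' (hg A) (hg B) fun n =>
      div_le_div_of_nonneg_right ((hpoly _).mono _ _ hAB) (hr _).le
  refine ⟨g, ⟨?_, hmono, fun A B => ?_⟩, fun e => ?_, fun A => ?_, fun e => ?_, fun s v hv => ?_,
    H ∘ φ, r ∘ φ, fun n => hr _, fun n => ⟨_, _, _, _, _, (C (φ n)).isMass_prob, rfl⟩, hg⟩
  · refine tendsto_nhds_unique (hg ∅) ?_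
    simp only [(hpoly _).empty, zero_div]
    exact tendsto_const_nhds
  · refine le_of_tendsto_of_tendsto' ((hg _).add (hg _)) ((hg A).add (hg B)) fun n => ?_
    rw [← add_div, ← add_div]
    exact div_le_div_of_nonneg_right ((hpoly _).submod _ _) (hr _).le
  · refine le_trans ?_ (hbc (.given e))
    refine le_of_tendsto_of_tendsto' (hg _) ((hb (.given e)).comp hφ') fun n => ?_
    refine div_le_div_of_nonneg_right ?_ (hr _).le
    exact jointEntropy_singleton (Y := fixedVar (C (φ n)) (ρ (φ n))) _ |>.le.trans (hent _ (.inr e))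
  · refine tendsto_nhds_unique (hg _) ?_
    simp only [← hkey]
    refine (tendsto_finsetSum A fun s _ => (ha (.keyOut s)).comp hφ').congr fun n => ?_
    simp only [H, jointEntropy_fixedVar_image_inl, Function.comp_apply]
    rw [Finset.sum_div]
  · refine tendsto_nhds_unique ((hg _).congr fun n => ?_) (hg _)
    simp only [H, jointEntropy_fixedVar_edge]
  · refine le_antisymm ?_ (hmono _ _ (Finset.subset_insert _ _))
    have h1 : Tendsto (fun n => H (φ n) (P.inputs v) / r (φ n) +
        ∑ i : P.Copy, keyGap (C (φ n)) i / r (φ n)) atTop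
        (𝓝 (g (P.inputs v) + ∑ i : P.Copy, (b (.keyOut i.1.1) - (x - a (.w2 i))))) :=
      (hg _).add (tendsto_finsetSum _ fun i _ => (hgap i).comp hφ')
    -- The normalized deficits have nonpositive limits, so decoding becomes exact in `g`.
    have h2 := le_of_tendsto_of_tendsto' (hg (insert (.inl s) (P.inputs v))) h1 fun n => by
      rw [← Finset.sum_div, ← add_div]
      exact div_le_div_of_nonneg_right (hρ _ s v hv) (hr _).le
    linarith [Finset.sum_nonpos fun (i : P.Copy) (_ : i ∈ Finset.univ) => hgap_le i]

end MulticastProblem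

/-! ## Spans in polymatroids -/

/-- The element `j` does not increase the value of `A`. -/
def Spans {J : Type} [DecidableEq J] (g : Finset J → ℝ) (A : Finset J) (j : J) : Prop :=
  g (insert j A) = g A

section Spans

variable {J : Type} [DecidableEq J] {g : Finset J → ℝ} {A B Z : Finset J} {j : J}

theorem Spans.of_mem (h : j ∈ A) : Spans g A j := by rw [Spans, Finset.insert_eq_of_mem h]

namespace IsPolymatroid

variable (hg : IsPolymatroid g)
include hg

/-- Submodularity means diminishing marginal values: an element worthless over `A` stays worthless
over a larger set. -/
theorem spans_mono (hAB : A ⊆ B) (h : Spans g A j) : Spans g B j := by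
  refine le_antisymm ?_ (hg.mono _ _ (Finset.subset_insert _ _))
  have h1 := hg.submod (insert j A) B
  have h2 := hg.mono A (insert j A ∩ B)
    (Finset.subset_inter (Finset.subset_insert _ _) hAB)
  have h3 := hg.mono (insert j B) (insert j A ∪ B) (Finset.insert_subset
    (Finset.mem_union_left _ (Finset.mem_insert_self _ _)) Finset.subset_union_right)
  rw [Spans] at h
  linarith

theorem union_eq_of_spans (h : ∀ j ∈ B, Spans g A j) : g (A ∪ B) = g A := by
  induction B using Finset.induction_on with
  | empty => simp
  | insert k B _ ih =>
    rw [Finset.union_insert]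
    exact (hg.spans_mono Finset.subset_union_left (h k (by simp))).trans
      (ih fun j hj => h j (by simp [hj]))

theorem le_of_spans (h : ∀ j ∈ B, Spans g A j) : g B ≤ g A :=
  (hg.mono _ _ Finset.subset_union_right).trans (hg.union_eq_of_spans h).le

theorem spans_trans (h : ∀ j ∈ B, Spans g A j) (hj : Spans g B j) : Spans g A j := by
  refine le_antisymm ?_ (hg.mono _ _ (Finset.subset_insert _ _))
  refine (hg.mono _ _ (Finset.insert_subset_insert j (Finset.subset_union_left (s₂ := B)))).trans ?_
  exact ((hg.spans_mono (B := A ∪ B) Finset.subset_union_right hj).trans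
    (hg.union_eq_of_spans h)).le

theorem nonneg (A : Finset J) : 0 ≤ g A := hg.empty ▸ hg.mono ∅ A (Finset.empty_subset _)

theorem union_le (A B : Finset J) : g (A ∪ B) ≤ g A + g B := by
  have := hg.submod A B
  linarith [hg.nonneg (A ∩ B)]

theorem image_le_sum {ι : Type} (s : Finset ι) (f : ι → J) : g (s.image f) ≤ ∑ i ∈ s, g {f i} := by
  classical
  induction s using Finset.induction_on with
  | empty => simp [hg.empty]
  | insert i s hi ih =>
    rw [Finset.image_insert, Finset.sum_insert hi, Finset.insert_eq]
    linarith [hg.union_le {f i} (s.image f)]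

/-- Independence of `A` and `B` is inherited by everything that `B` spans. This is how independent
parts are split off in the type 2 subnetworks. -/
theorem union_eq_add_of_spans (h : g (A ∪ B) = g A + g B) (hZ : ∀ j ∈ Z, Spans g B j) :
    g (A ∪ Z) = g A + g Z := by
  refine le_antisymm (hg.union_le A Z) ?_
  have h1 := hg.submod (A ∪ Z) (B ∪ Z)
  have h2 := hg.union_eq_of_spans hZ
  have h3 := hg.mono (A ∪ B) (A ∪ Z ∪ (B ∪ Z))
    (Finset.union_subset_union Finset.subset_union_left Finset.subset_union_left)
  have h4 := hg.mono Z ((A ∪ Z) ∩ (B ∪ Z))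
    (Finset.subset_inter Finset.subset_union_right Finset.subset_union_right)
  linarith

end IsPolymatroid

end Spans

/-! ## Polymatroids on the network `G†` -/

section Dagger

variable {N : ℕ} [DecidableEq (Fin 2 ⊕ DaggerEdge N)] {h : Finset (Fin N) → ℝ}
  {g : Finset (Fin 2 ⊕ DaggerEdge N) → ℝ}

/-- The polymatroid `g` on the sessions and links of `G†` obeys the constraints of the network. -/
structure IsDaggerPolymatroid (h : Finset (Fin N) → ℝ)
    (g : Finset (Fin 2 ⊕ DaggerEdge N) → ℝ) : Prop extends IsPolymatroid g where
  cap : ∀ e, g {.inr e} ≤ daggerCap h e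
  rate_zero : g {.inl 0} = ∑ i, h {i}
  rate_both : g {.inl 0, .inl 1} = ∑ i, h {i} + h Finset.univ
  edge : ∀ e A, daggerTail e ≠ .source →
    (∀ e', daggerHead e' = daggerTail e → Spans g A (.inr e')) → Spans g A (.inr e)
  recv : ∀ s, ∀ v ∈ daggerDest s, ∀ A,
    (∀ e', daggerHead e' = v → Spans g A (.inr e')) → Spans g A (.inl s)

/-- The variables `U_j`, `j ∈ α`. -/
def daggerU (α : Finset (Fin N)) : Finset (Fin 2 ⊕ DaggerEdge N) := α.image fun i => .inr (.U i)

/-- The variables `V_j`, `j ∈ α`. -/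
def daggerV (α : Finset (Fin N)) : Finset (Fin 2 ⊕ DaggerEdge N) := α.image fun i => .inr (.V i)

namespace IsDaggerPolymatroid

variable (hg : IsDaggerPolymatroid h g) {A : Finset (Fin 2 ⊕ DaggerEdge N)}
include hg

/-- Here and below the topology of G† becomes spanning relations: links that only forward or combine
messages are spanned by what enters their tail. -/
theorem spans_of_u {e : DaggerEdge N} {i : Fin N} (he : daggerTail e = .u i)
    (hA : Spans g A (.inr (.U i))) : Spans g A (.inr e) := by
  refine hg.edge e A (by rw [he]; nofun) fun e' he' => ?_
  rw [he] at he'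
  cases e' with
  | U j => cases he'; exact hA
  | _ => cases he'

theorem spans_of_v {e : DaggerEdge N} {i : Fin N} (he : daggerTail e = .v i)
    (hA : Spans g A (.inr (.V i))) : Spans g A (.inr e) := by
  refine hg.edge e A (by rw [he]; nofun) fun e' he' => ?_
  rw [he] at he'
  cases e' with
  | V j => cases he'; exact hA
  | _ => cases he'

theorem spans_of_relay {e : DaggerEdge N} {t : Type2 N} (he : daggerTail e = .relay t)
    (hA : Spans g A (.inr (.W1 t))) : Spans g A (.inr e) := by
  refine hg.edge e A (by rw [he]; nofun) fun e' he' => ?_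
  rw [he] at he'
  cases e' with
  | W1 j => cases he'; exact hA
  | _ => cases he'

theorem spans_V {i : Fin N} (hA : Spans g A (.inr .toSplit)) : Spans g A (.inr (.V i)) := by
  refine hg.edge (.V i) A nofun fun e' he' => ?_
  cases e' with
  | toSplit => exact hA
  | _ => cases he'

theorem spans_W1 {t : Type2 N} (hU : Spans g A (.inr (.U t.1.2)))
    (hV : Spans g A (.inr (.V t.1.2))) : Spans g A (.inr (.W1 t)) := by
  refine hg.edge (.W1 t) A nofun fun e' he' => ?_
  cases e' with
  | mixU t' => cases he'; exact hg.spans_of_u rfl hU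
  | mixV t' => cases he'; exact hg.spans_of_v rfl hV
  | _ => cases he'

theorem spans_p0Out {t : Type2 N} (h1 : Spans g A (.inr (.W1 t))) (h2 : Spans g A (.inr (.W2 t))) :
    Spans g A (.inr (.p0Out t)) := by
  refine hg.edge (.p0Out t) A nofun fun e' he' => ?_
  cases e' with
  | W1p0 t' => cases he'; exact hg.spans_of_relay rfl h1
  | W2 t' => cases he'; exact h2
  | _ => cases he'

theorem spans_condOut {t : Type2 N}
    (hV : ∀ j ∈ insert t.1.2 t.1.1, Spans g A (.inr (.V j))) :
    Spans g A (.inr (.condOut t)) := by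
  refine hg.edge (.condOut t) A nofun fun e' he' => ?_
  cases e' with
  | condV t' j => cases he'; exact hg.spans_of_v rfl (hV j j.2)
  | _ => cases he'

theorem spans_W3 {t : Type2 N} (h1 : Spans g A (.inr (.W1 t)))
    (hc : Spans g A (.inr (.condOut t))) (hV : ∀ j ∈ t.1.1, Spans g A (.inr (.V j))) :
    Spans g A (.inr (.W3 t)) := by
  refine hg.edge (.W3 t) A nofun fun e' he' => ?_
  cases e' with
  | W1p1 t' => cases he'; exact hg.spans_of_relay rfl h1
  | condOut t' => cases he'; exact hc
  | p1V t' j => cases he'; exact hg.spans_of_v rfl (hV j j.2)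
  | _ => cases he'

theorem spans_midOut {t : Type1 N} (hV : ∀ j ∈ t.1, Spans g A (.inr (.V j))) :
    Spans g A (.inr (.midOut t)) := by
  refine hg.edge (.midOut t) A nofun fun e' he' => ?_
  cases e' with
  | midV t' j => cases he'; exact hg.spans_of_v rfl (hV j j.2)
  | _ => cases he'

theorem rate_le_of_recv {v : DaggerNode N} (hv : ∀ s, v ∈ daggerDest s)
    (hA : ∀ e', daggerHead e' = v → Spans g A (.inr e')) :
    ∑ i, h {i} + h Finset.univ ≤ g A := by
  rw [← hg.rate_both]
  refine hg.le_of_spans fun j hj => ?_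
  rcases Finset.mem_insert.1 hj with rfl | hj
  · exact hg.recv 0 v (hv 0) A hA
  · rw [Finset.mem_singleton.1 hj]
    exact hg.recv 1 v (hv 1) A hA

theorem daggerU_univ : g (daggerU Finset.univ) = ∑ i, h {i} := by
  refine le_antisymm ((hg.image_le_sum _ _).trans (Finset.sum_le_sum fun i _ => hg.cap (.U i))) ?_
  rw [← hg.rate_zero]
  refine hg.le_of_spans fun j hj => ?_
  rw [Finset.mem_singleton.1 hj]
  refine hg.recv 0 .recv0 (by simp [daggerDest]) _ fun e' he' => ?_
  cases e' with
  | recv0U i => exact hg.spans_of_u rfl (.of_mem (Finset.mem_image_of_mem _ (Finset.mem_univ i)))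
  | _ => cases he'

/-- The `U_j` together span session `0` and have the same value, so conversely the session spans
each of them. -/
theorem spans_U_of_session (i : Fin N) : Spans g {.inl 0} (.inr (.U i)) := by
  refine le_antisymm ?_ (hg.mono _ _ (Finset.subset_insert _ _))
  rw [hg.rate_zero, ← hg.daggerU_univ]
  have h1 : Spans g (daggerU Finset.univ) (.inl 0) := by
    refine hg.recv 0 .recv0 (by simp [daggerDest]) _ fun e' he' => ?_
    cases e' with
    | recv0U i => exact hg.spans_of_u rfl (.of_mem (Finset.mem_image_of_mem _ (Finset.mem_univ i)))
    | _ => cases he'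
  rw [← show g (insert (.inl 0) (daggerU Finset.univ)) = _ from h1]
  refine hg.mono _ _ fun j hj => ?_
  rcases Finset.mem_insert.1 hj with rfl | hj
  · exact Finset.mem_insert_of_mem (Finset.mem_image_of_mem _ (Finset.mem_univ i))
  · rw [Finset.mem_singleton.1 hj]
    exact Finset.mem_insert_self _ _

theorem daggerV_univ_le : g (daggerV Finset.univ) ≤ h Finset.univ := by
  refine le_trans (hg.le_of_spans (A := {.inr .toSplit}) fun j hj => ?_) (hg.cap .toSplit)
  obtain ⟨i, -, rfl⟩ := Finset.mem_image.1 hj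
  exact hg.spans_V (.of_mem (Finset.mem_singleton_self _))

theorem rate_le_daggerU_union_daggerV :
    ∑ i, h {i} + h Finset.univ ≤ g (daggerU Finset.univ ∪ daggerV Finset.univ) := by
  refine hg.rate_le_of_recv (v := .recv01) (fun s => by simp [daggerDest]) fun e' he' => ?_
  cases e' with
  | recv01U i =>
    exact hg.spans_of_u rfl (.of_mem (Finset.mem_union_left _
      (Finset.mem_image_of_mem _ (Finset.mem_univ i))))
  | recv01V i =>
    exact hg.spans_of_v rfl (.of_mem (Finset.mem_union_right _
      (Finset.mem_image_of_mem _ (Finset.mem_univ i))))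
  | _ => cases he'

/-- All `V_j` pass through one link of capacity `h Finset.univ`, and next to the `U_j` they must
supply the whole of session `1`. -/
theorem daggerV_univ : g (daggerV Finset.univ) = h Finset.univ := by
  refine le_antisymm hg.daggerV_univ_le ?_
  have h1 := hg.rate_le_daggerU_union_daggerV
  have h2 := hg.union_le (daggerU Finset.univ) (daggerV Finset.univ)
  rw [hg.daggerU_univ] at h2
  linarith

/-- The type 1 subnetworks bound the entropies from below. -/
theorem le_daggerV (t : Type1 N) : h t.1 ≤ g (daggerV t.1) := by
  -- Of the demand, the `U_j` cover at most `∑ i, h {i}` and the direct link at most `h Finset.univ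
  -- - h t.1`; the remainder must come through `midOut`, a function of the `V_j` with `j ∈ t.1`.
  have h1 : ∑ i, h {i} + h Finset.univ ≤
      g (Finset.univ.image (fun j => .inr (.recv1U t j)) ∪ {.inr (.midOut t)} ∪
        {.inr (.recv1Src t)}) := by
    refine hg.rate_le_of_recv (v := .recv1 t) (fun s => by simp [daggerDest]) fun e' he' => ?_
    cases e' with
    | midOut t' => cases he'; exact .of_mem (by simp)
    | recv1Src t' => cases he'; exact .of_mem (by simp)
    | recv1U t' j => cases he'; exact .of_mem (by simp)
    | _ => cases he'
  have h2 := hg.union_le (Finset.univ.image (fun j => .inr (.recv1U t j)) ∪ {.inr (.midOut t)})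
    {.inr (.recv1Src t)}
  have h3 := hg.union_le (Finset.univ.image (fun j => .inr (.recv1U t j))) {.inr (.midOut t)}
  have h4 := (hg.image_le_sum Finset.univ (fun j => .inr (.recv1U t j))).trans
    (Finset.sum_le_sum fun j _ => hg.cap (.recv1U t j))
  have h5 : g {.inr (.recv1Src t)} ≤ h Finset.univ - h t.1 := hg.cap (.recv1Src t)
  have h6 : g {.inr (.midOut t)} ≤ g (daggerV t.1) := by
    refine hg.le_of_spans fun j hj => ?_
    rw [Finset.mem_singleton.1 hj]
    exact hg.spans_midOut fun j hj => .of_mem (Finset.mem_image_of_mem _ hj)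
  change _ ≤ ∑ j, h {j} at h4
  linarith

/-- The upper receiver can succeed only if `W₁` and `U_i` jointly have value at least `2 h(i)`.
Adding `V_i` cannot exceed this, as `U_i` and `V_i` span `W₁` and have capacity `h(i)` each. -/
theorem spans_V_of_W1_U (t : Type2 N) :
    Spans g {.inr (.W1 t), .inr (.U t.1.2)} (.inr (.V t.1.2)) := by
  have h1 : ∑ i, h {i} + h Finset.univ ≤
      g (Finset.univ.image (fun j => .inr (.upperU t j)) ∪ {.inr (.p0Out t)} ∪
        {.inr (.upperSrc t)}) := by
    refine hg.rate_le_of_recv (v := .upper t) (fun s => by simp [daggerDest]) fun e' he' => ?_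
    cases e' with
    | p0Out t' => cases he'; exact .of_mem (by simp)
    | upperSrc t' => cases he'; exact .of_mem (by simp)
    | upperU t' j => cases he'; exact .of_mem (by simp)
    | _ => cases he'
  have h2 := hg.union_le (Finset.univ.image (fun j => .inr (.upperU t j)) ∪ {.inr (.p0Out t)})
    {.inr (.upperSrc t)}
  have h3 := hg.union_le (Finset.univ.image (fun j => .inr (.upperU t j))) {.inr (.p0Out t)}
  have h4 := (hg.image_le_sum Finset.univ (fun j => .inr (.upperU t j))).trans
    (Finset.sum_le_sum fun j _ => hg.cap (.upperU t j))
  have h5 : g {.inr (.upperSrc t)} ≤ h Finset.univ - h {t.1.2} := hg.cap (.upperSrc t)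
  have h6 : ∑ j : {j : Fin N // j ≠ t.1.2}, h {j.1} + h {t.1.2} = ∑ i, h {i} := by
    rw [← Finset.sum_subtype (Finset.univ.erase t.1.2) (by simp) (fun j => h {j}),
      Finset.sum_erase_add _ _ (Finset.mem_univ _)]
  change _ ≤ ∑ j : {j : Fin N // j ≠ t.1.2}, h {j.1} at h4
  have h7 : g {.inr (.p0Out t)} ≤ g {.inr (.W1 t), .inr (.U t.1.2)} := by
    refine hg.le_of_spans fun j hj => ?_
    rw [Finset.mem_singleton.1 hj]
    exact hg.spans_p0Out (.of_mem (by simp)) (hg.spans_of_u rfl (.of_mem (by simp)))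
  have h8 : g (insert (.inr (.V t.1.2)) {.inr (.W1 t), .inr (.U t.1.2)}) ≤
      g ({.inr (.U t.1.2)} ∪ {.inr (.V t.1.2)}) := by
    refine hg.le_of_spans fun j hj => ?_
    simp only [Finset.mem_insert, Finset.mem_singleton] at hj
    rcases hj with rfl | rfl | rfl
    · exact .of_mem (by simp)
    · exact hg.spans_W1 (.of_mem (by simp)) (.of_mem (by simp))
    · exact .of_mem (by simp)
  have h9 := hg.union_le {.inr (.U t.1.2)} {.inr (.V t.1.2)}
  have h10 : g {.inr (.U t.1.2)} ≤ h {t.1.2} := hg.cap (.U t.1.2)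
  have h11 : g {.inr (.V t.1.2)} ≤ h {t.1.2} := hg.cap (.V t.1.2)
  refine le_antisymm ?_ (hg.mono _ _ (Finset.subset_insert _ _))
  linarith

/-- The type 2 subnetworks bound the conditional entropies from above. -/
theorem daggerV_insert_le (t : Type2 N) :
    g (daggerV (insert t.1.2 t.1.1)) ≤ g (daggerV t.1.1) + (h (insert t.1.2 t.1.1) - h t.1.1) := by
  set U' := daggerU (N := N) (Finset.univ.erase t.1.2)
  set V := daggerV (N := N) Finset.univ
  set Z₀ : Finset (Fin 2 ⊕ DaggerEdge N) := insert (.inr (.condOut t)) (daggerV t.1.1)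
  have hVmem : ∀ j, (.inr (.V j)) ∈ V := fun j => Finset.mem_image_of_mem _ (Finset.mem_univ j)
  have hVsub : ∀ α, daggerV α ⊆ V := fun α => Finset.image_subset_image (Finset.subset_univ α)
  have hU' : g U' ≤ ∑ i, h {i} - h {t.1.2} := by
    refine ((hg.image_le_sum _ _).trans (Finset.sum_le_sum fun j _ => hg.cap (.U j))).trans ?_
    change ∑ j ∈ Finset.univ.erase t.1.2, h {j} ≤ _
    rw [← Finset.sum_erase_add _ _ (Finset.mem_univ t.1.2)]
    linarith
  have hUi : g {.inr (.U t.1.2)} ≤ h {t.1.2} := hg.cap (.U t.1.2)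
  have hW1 : g {.inr (.W1 t)} ≤ h {t.1.2} := hg.cap (.W1 t)
  have hV : g V = h Finset.univ := hg.daggerV_univ
  have hUV := hg.union_le {.inr (.U t.1.2)} V
  have hall : ∑ i, h {i} + h Finset.univ ≤ g (U' ∪ ({.inr (.U t.1.2)} ∪ V)) := by
    refine hg.rate_le_daggerU_union_daggerV.trans (hg.mono _ _ fun j hj => ?_)
    rcases Finset.mem_union.1 hj with hj | hj
    · obtain ⟨i, -, rfl⟩ := Finset.mem_image.1 hj
      by_cases hi : i = t.1.2
      · simp [hi]
      · exact Finset.mem_union_left _ (Finset.mem_image_of_mem _ (by simp [hi]))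
    · exact Finset.mem_union_right _ (Finset.mem_union_right _ hj)
  -- The capacities only just suffice for the joint demand at `recv01`, so the other `U_j` are
  -- independent of `U_i` and all `V_j`.
  have hind : g (U' ∪ ({.inr (.U t.1.2)} ∪ V)) = g U' + g ({.inr (.U t.1.2)} ∪ V) :=
    le_antisymm (hg.union_le _ _) (by linarith)
  have hZ₀ : ∀ B, V ⊆ B → ∀ j ∈ Z₀, Spans g B j := by
    intro B hB j hj
    rcases Finset.mem_insert.1 hj with rfl | hj
    · exact hg.spans_condOut fun j _ => .of_mem (hB (hVmem j))
    · exact .of_mem (hB (hVsub _ hj))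
  have hZ : ∀ j ∈ {.inr (.W1 t)} ∪ Z₀, Spans g ({.inr (.U t.1.2)} ∪ V) j := by
    intro j hj
    rcases Finset.mem_union.1 hj with hj | hj
    · rw [Finset.mem_singleton.1 hj]
      exact hg.spans_W1 (.of_mem (by simp)) (.of_mem (Finset.mem_union_right _ (hVmem _)))
    · exact hZ₀ _ Finset.subset_union_right j hj
  -- The lower receiver decodes session `0`, which spans `U_i`.
  have hlower : Spans g (U' ∪ ({.inr (.W1 t)} ∪ Z₀)) (.inr (.U t.1.2)) := by
    refine hg.spans_trans (B := {.inl 0}) (fun j hj => ?_) (hg.spans_U_of_session _)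
    rw [Finset.mem_singleton.1 hj]
    refine hg.recv 0 (.lower t) (by simp [daggerDest]) _ fun e' he' => ?_
    cases e' with
    | W3 t' =>
      cases he'
      exact hg.spans_W3 (.of_mem (by simp)) (.of_mem (by simp [Z₀]))
        fun j hj => .of_mem (by simp [Z₀, daggerV, hj])
    | lowerU t' j =>
      cases he'
      exact hg.spans_of_u rfl (.of_mem (Finset.mem_union_left _
        (Finset.mem_image_of_mem _ (by simp [j.2]))))
    | _ => cases he'
  -- The other `U_j` are independent of everything involved here, so they can be dropped.
  have hZU : Spans g ({.inr (.W1 t)} ∪ Z₀) (.inr (.U t.1.2)) := by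
    have h1 := hg.union_eq_add_of_spans hind hZ
    have h2 := hg.union_eq_add_of_spans hind (Z := insert (.inr (.U t.1.2)) ({.inr (.W1 t)} ∪ Z₀))
      fun j hj => by
        rcases Finset.mem_insert.1 hj with rfl | hj
        · exact .of_mem (by simp)
        · exact hZ j hj
    rw [Spans] at hlower ⊢
    rw [Finset.union_insert] at h2
    linarith
  have hZV : Spans g ({.inr (.W1 t)} ∪ Z₀) (.inr (.V t.1.2)) := by
    refine hg.spans_trans (fun j hj => ?_) (hg.spans_V_of_W1_U t)
    rcases Finset.mem_insert.1 hj with rfl | hj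
    · exact .of_mem (by simp)
    · rw [Finset.mem_singleton.1 hj]
      exact hZU
  -- `W₁` and all `V_j` span `U_i`, so together they have value at least that of `U_i` with all
  -- `V_j`. The capacity `h(i)` of `W₁` then makes it independent of the `V_j`.
  have hWV : g ({.inr (.W1 t)} ∪ V) = g {.inr (.W1 t)} + g V := by
    refine le_antisymm (hg.union_le _ _) ?_
    have h1 : g ({.inr (.U t.1.2)} ∪ V) ≤ g ({.inr (.W1 t)} ∪ V) := by
      refine hg.le_of_spans fun j hj => ?_
      rcases Finset.mem_union.1 hj with hj | hj
      · rw [Finset.mem_singleton.1 hj]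
        refine hg.spans_trans (fun j hj => ?_) hZU
        rcases Finset.mem_union.1 hj with hj | hj
        · exact .of_mem (Finset.mem_union_left _ hj)
        · exact hZ₀ _ Finset.subset_union_right j hj
      · exact .of_mem (Finset.mem_union_right _ hj)
    linarith
  -- By this independence `W₁` can be dropped too: `V_α` and the message `condOut` alone determine
  -- `V_i`.
  have hV₀ : g (insert (.inr (.V t.1.2)) Z₀) = g Z₀ := by
    have h1 := hg.union_eq_add_of_spans hWV (hZ₀ V subset_rfl)
    have h2 := hg.union_eq_add_of_spans hWV (Z := insert (.inr (.V t.1.2)) Z₀) fun j hj => by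
      rcases Finset.mem_insert.1 hj with rfl | hj
      · exact .of_mem (hVmem _)
      · exact hZ₀ V subset_rfl j hj
    rw [Spans] at hZV
    rw [Finset.union_insert] at h2
    linarith
  have h1 : g (daggerV (insert t.1.2 t.1.1)) ≤ g (insert (.inr (.V t.1.2)) Z₀) := by
    refine hg.mono _ _ ?_
    rw [daggerV, Finset.image_insert]
    exact Finset.insert_subset_insert _ (Finset.subset_insert _ _)
  have h2 := hg.union_le {.inr (.condOut t)} (daggerV t.1.1)
  have h3 : g {.inr (.condOut t)} ≤ h (insert t.1.2 t.1.1) - h t.1.1 := hg.cap (.condOut t)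
  rw [← Finset.insert_eq] at h2
  linarith

/-- The upper bound is built up one element at a time from the type 2 increments, starting from the
capacity of a single `V_i`; type 1 gives the lower bound. -/
theorem daggerV_eq (h0 : h ∅ = 0) (α : Finset (Fin N)) : g (daggerV α) = h α := by
  have hle : ∀ α : Finset (Fin N), g (daggerV α) ≤ h α := by
    intro α
    induction α using Finset.induction_on with
    | empty => simp [daggerV, hg.empty, h0]
    | insert i α hi ih =>
      rcases α.eq_empty_or_nonempty with rfl | hα
      · simpa [daggerV, daggerCap] using hg.cap (.V i)
      · have := hg.daggerV_insert_le ⟨(α, i), hα, hi⟩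
        simp only at this
        linarith
  refine le_antisymm (hle α) ?_
  rcases α.eq_empty_or_nonempty with rfl | hα
  · simp [daggerV, hg.empty, h0]
  · exact hg.le_daggerV ⟨α, hα⟩

end IsDaggerPolymatroid

end Dagger

theorem almostEntropic_of_achievable {N : ℕ} {h : Finset (Fin N) → ℝ} (h0 : h ∅ = 0)
    (hach : (dagger N).secured.Achievable ((dagger N).securedRate (daggerRate h))
      ((dagger N).securedCap (daggerRate h) (daggerCap h))) : AlmostEntropic h := by
  let inst : DecidableEq (Fin 2 ⊕ DaggerEdge N) := Classical.decEq _
  let inst' : DecidableEq ((dagger N).Session ⊕ (dagger N).Edge) := inst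
  have hdest : ∀ s : (dagger N).Session, ((dagger N).dest s).Nonempty := fun s =>
    ⟨DaggerNode.recv01, Or.inl (Or.inl (Or.inl rfl))⟩
  obtain ⟨(g : Finset (Fin 2 ⊕ DaggerEdge N) → ℝ), hpoly, hcap, hrate, hedge, hrecv, H, r, hr, hH, hlim⟩ :=
    (dagger N).exists_limit_polymatroid hdest hach
  have hrate' : ∀ A : Finset (Fin 2), g (A.image Sum.inl) =
    ∑ s ∈ A, if s = 0 then ∑ i, h {i} else h Finset.univ := hrate
  have hg : IsDaggerPolymatroid (N := N) h g :=
    { toIsPolymatroid := hpoly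
      cap := hcap
      rate_zero := by simpa using hrate' {0}
      rate_both := by
        have := hrate' {0, 1}
        rwa [Finset.image_insert, Finset.image_singleton, Finset.sum_pair (by decide), if_pos rfl,
          if_neg (by decide)] at this
      edge := fun e A he hA => by
        refine hpoly.spans_trans (B := (dagger N).inputs (daggerTail e)) (fun j hj => ?_) (hedge e)
        rcases j with s | e'
        · exact absurd (MulticastProblem.inl_mem_inputs.1 hj).symm he
        · exact hA e' (MulticastProblem.inr_mem_inputs.1 hj)
      recv := fun s v hv A hA => by
        refine hpoly.spans_trans (B := (dagger N).inputs v) (fun j hj => ?_) (hrecv s v hv)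
        rcases j with s' | e'
        -- A session is a direct input only at the source, which is not a receiver.
        · have hsrc : DaggerNode.source = v := MulticastProblem.inl_mem_inputs.1 hj
          rw [← hsrc] at hv
          simp only [daggerDest] at hv
          split_ifs at hv <;> simp at hv
        · exact hA e' (MulticastProblem.inr_mem_inputs.1 hj) }
  refine almostEntropic_of_tendsto (H := fun n α => H n (daggerV α)) (fun n => ?_) hr fun α => ?_
  · obtain ⟨Ω, _, p, W, Y, hp, hHn⟩ := hH n
    refine entropic_iff_jointEntropy.2 ⟨Ω, _, p, fun i => W (.inr (.V i)), fun i => Y (.inr (.V i)),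
      hp, funext fun α => ?_⟩
    rw [hHn]
    refine entropy_congr (fun ω ω' hω => restrict_eq_iff.2 fun j hj => ?_)
      (fun ω ω' hω => (restrict_eq_iff (Y := fun i => Y (.inr (.V i)))).2 fun i hi => ?_)
    · obtain ⟨i, hi, rfl⟩ := Finset.mem_image.1 hj
      exact (restrict_eq_iff (Y := fun i => Y (.inr (.V i)))).1 hω i hi
    · exact restrict_eq_iff.1 hω (.inr (.V i)) (Finset.mem_image_of_mem _ hi)
  · rw [← hg.daggerV_eq h0 α]
    exact hlim _

/-! ## Achievability from exact codes -/

/-- Secure zero-error codes whose normalized tuples converge achieve the limit tuple. -/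
theorem SecureMulticastProblem.achievable_of_tendsto (Q : SecureMulticastProblem)
    {C : ℕ → NetworkCode Q.toMulticastProblem} {r : ℕ → ℝ} {rate' : ℕ → Q.Session → ℝ}
    {cap' : ℕ → Q.Edge → ℝ} {rate : Q.Session → ℝ} {cap : Q.Edge → ℝ} (hr : ∀ n, 0 < r n)
    (hmsg : ∀ n e, (C n).msgBits e ≤ cap' n e) (hsrc : ∀ n s, (C n).srcBits s = rate' n s)
    (herr : ∀ n, (C n).errorProb = 0)
    (hleak : ∀ n q, (C n).leakage (Q.target q) (Q.tap q) = 0)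
    (hrate : ∀ s, Tendsto (fun n => rate' n s / r n) atTop (𝓝 (rate s)))
    (hcap : ∀ e, Tendsto (fun n => cap' n e / r n) atTop (𝓝 (cap e))) :
    Q.Achievable rate cap := by
  choose K hK using fun e => (hcap e).bddAbove_range
  have hle : ∀ n e, (C n).msgEntropy e / r n ≤ (C n).msgBits e / r n := fun n e =>
    div_le_div_of_nonneg_right ((C n).msgEntropy_le_msgBits e) (hr n).le
  have hle' : ∀ n e, (C n).msgBits e / r n ≤ cap' n e / r n := fun n e =>
    div_le_div_of_nonneg_right (hmsg n e) (hr n).le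
  have h0 : ∀ n e, 0 ≤ (C n).msgEntropy e / r n := fun n e =>
    div_nonneg (entropy_nonneg (C n).isMass_prob _) (hr n).le
  have hmem : ∀ n, ((fun e => (C n).msgEntropy e / r n, fun e => (C n).msgBits e / r n) :
      (Q.Edge → ℝ) × (Q.Edge → ℝ)) ∈ Set.Icc (0, 0) (K, K) := fun n =>
    ⟨⟨h0 n, fun e => (h0 n e).trans (hle n e)⟩,
      ⟨fun e => (hle n e).trans ((hle' n e).trans (hK e ⟨n, rfl⟩)),
        fun e => (hle' n e).trans (hK e ⟨n, rfl⟩)⟩⟩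
  -- Achievability demands that the normalized message entropies and alphabet sizes converge,
  -- whereas only their upper bounds are known to; a subsequence repairs this.
  obtain ⟨⟨a, b⟩, -, φ, hφ, hlim⟩ := isCompact_Icc.tendsto_subseq hmem
  have hφ' := hφ.tendsto_atTop
  have ha : ∀ e, Tendsto (fun n => (C (φ n)).msgEntropy e / r (φ n)) atTop (𝓝 (a e)) := fun e =>
    tendsto_pi_nhds.1 ((continuous_fst.tendsto _).comp hlim) e
  have hb : ∀ e, Tendsto (fun n => (C (φ n)).msgBits e / r (φ n)) atTop (𝓝 (b e)) := fun e =>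
    tendsto_pi_nhds.1 ((continuous_snd.tendsto _).comp hlim) e
  refine ⟨fun n => C (φ n), fun n => r (φ n), fun n => hr _, fun e => ⟨a e, b e, ha e, hb e, ?_, ?_⟩,
    fun s => ⟨rate s, ?_, ?_, le_rfl⟩, ?_, fun q => ?_⟩
  · exact le_of_tendsto_of_tendsto' (ha e) (hb e) fun n => hle _ e
  · exact le_of_tendsto_of_tendsto' (hb e) ((hcap e).comp hφ') fun n => hle' _ e
  · simp only [NetworkCode.srcEntropy_eq_srcBits, hsrc]
    exact (hrate s).comp hφ'
  · simp only [hsrc]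
    exact (hrate s).comp hφ'
  · simp only [herr]
    exact tendsto_const_nhds
  · simp only [hleak, zero_div]
    exact tendsto_const_nhds

/-! ## Encoding variables with constant fibre sizes -/

/-- If all fibres of `f` have size `m` and all fibres of the finer variable `g` have size `k`, then,
given `f`, the variable `g` can be encoded with exactly `m / k` values. -/
theorem exists_encoding {Q A B : Type} [Fintype Q] [Nonempty Q] [DecidableEq A] [DecidableEq B]
    {f : Q → A} {g : Q → B} {m k : ℕ} (hgf : Determines g f)
    (hf : ∀ q, (Finset.univ.filter fun q' => f q' = f q).card = m)
    (hg : ∀ q, (Finset.univ.filter fun q' => g q' = g q).card = k) :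
    k ∣ m ∧ ∃ c : Q → Fin (m / k), Determines g c ∧ Determines (fun q => (f q, c q)) g ∧
      ∀ q j, ∃ q', f q' = f q ∧ c q' = j := by
  classical
  let G : Q → Finset B := fun q => (Finset.univ.filter fun q' => f q' = f q).image g
  have hGk : ∀ q, m = (G q).card * k := by
    intro q
    rw [← hf q, Finset.card_eq_sum_card_image g, ← smul_eq_mul, ← Finset.sum_const]
    refine Finset.sum_congr rfl fun b hb => ?_
    obtain ⟨q', hq', rfl⟩ := Finset.mem_image.1 hb
    rw [← hg q', Finset.filter_filter]
    congr 1
    ext q''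
    simp only [Finset.mem_filter, Finset.mem_univ, true_and, and_iff_right_iff_imp] at hq' ⊢
    exact fun h => (hgf _ _ h).trans hq'
  have hG : ∀ q, (G q).card = m / k := by
    intro q
    have hk : 0 < k := by
      rw [← hg q]
      exact Finset.card_pos.2 ⟨q, by simp⟩
    exact (Nat.div_eq_of_eq_mul_left hk (hGk q)).symm
  have hdvd : k ∣ m := Dvd.intro_left _ (hGk (Classical.arbitrary Q)).symm
  have hmem : ∀ q, g q ∈ G q := fun q => Finset.mem_image_of_mem _ (by simp)
  let e : ∀ q, G q ≃ Fin (m / k) := fun q => Finset.equivFinOfCardEq (hG q)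
  -- Numbers the values of `g` on the fibre of `q`; the other branch is an arbitrary default.
  let u : Q → B → Fin (m / k) := fun q b => if h : b ∈ G q then e q ⟨b, h⟩ else e q ⟨g q, hmem q⟩
  have hu : ∀ q b b', b ∈ G q → b' ∈ G q → u q b = u q b' → b = b' := by
    intro q b b' h h' huu
    simp only [u, h, h', dif_pos] at huu
    simpa using huu
  -- The numbering must be the same along a fibre of `f`, so it is taken from one representative.
  let rep : Q → Q := fun q => (Quotient.mk (Setoid.ker f) q).out
  have hrep : ∀ q, f (rep q) = f q := fun q => Quotient.mk_out (s := Setoid.ker f) q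
  have hrep' : ∀ q q', f q = f q' → rep q = rep q' := fun q q' h =>
    congrArg Quotient.out (Quotient.sound (s := Setoid.ker f) h)
  have hmem' : ∀ q q', f q = f q' → g q' ∈ G (rep q) := fun q q' h =>
    Finset.mem_image_of_mem _ (by simp [hrep, h])
  refine ⟨hdvd, fun q => u (rep q) (g q), fun q q' h => ?_, fun q q' h => ?_, fun q j => ?_⟩
  · simp only [hrep' q q' (hgf _ _ h), h]
  · obtain ⟨h1, h2⟩ := Prod.ext_iff.1 h
    simp only at h1 h2
    rw [hrep' q' q h1.symm] at h2
    exact hu _ _ _ (hmem' q q rfl) (hmem' q q' h1) h2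
  · obtain ⟨q', hq', hb⟩ := Finset.mem_image.1 ((e (rep q)).symm j).2
    have h1 : f q' = f q := by simpa [hrep] using hq'
    refine ⟨q', h1, ?_⟩
    simp only [hrep' q' q h1, hb, u]
    simp

/-! ## Codes for `G†` from quasi-uniform variables -/

section DaggerCode

variable {N : ℕ} (n : Fin N → ℕ) (M : ℕ) (E R : Type1 N → ℕ) (R' K : Type2 N → ℕ)

/-- Source alphabets of the code for `G†`. -/
def DaggerSrc : Fin 2 → Type
  | 0 => ∀ i, Fin (n i)
  | 1 => Fin M

instance instFintypeDaggerSrc : ∀ s, Fintype (DaggerSrc n M s)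
  | 0 => inferInstanceAs (Fintype (∀ i, Fin (n i)))
  | 1 => inferInstanceAs (Fintype (Fin M))

instance instNonemptyDaggerSrc [∀ i, NeZero (n i)] [NeZero M] : ∀ s, Nonempty (DaggerSrc n M s)
  | 0 => inferInstanceAs (Nonempty (∀ i, Fin (n i)))
  | 1 => inferInstanceAs (Nonempty (Fin M))

/-- Message alphabets of the code for `G†`. -/
def DaggerMsg : DaggerEdge N → Type
  | .toSplit => Fin M
  | .U i => Fin (n i)
  | .V i => Fin (n i)
  | .recv0U i => Fin (n i)
  | .recv01U i => Fin (n i)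
  | .recv01V i => Fin (n i)
  | .midV _ j => Fin (n j.1)
  | .midOut t => Fin (E t)
  | .recv1Src t => Fin (R t)
  | .recv1U _ j => Fin (n j)
  | .mixU t => Fin (n t.1.2)
  | .mixV t => Fin (n t.1.2)
  | .W1 t => Fin (n t.1.2)
  | .W1p0 t => Fin (n t.1.2)
  | .W1p1 t => Fin (n t.1.2)
  | .W2 t => Fin (n t.1.2)
  | .p0Out t => Fin (n t.1.2) × Fin (n t.1.2)
  | .upperSrc t => Fin (R' t)
  | .upperU _ j => Fin (n j.1)
  | .condV _ j => Fin (n j.1)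
  | .condOut t => Fin (K t)
  | .p1V _ j => Fin (n j.1)
  | .W3 t => Fin (n t.1.2)
  | .lowerU _ j => Fin (n j.1)

instance instFintypeDaggerMsg (e : DaggerEdge N) : Fintype (DaggerMsg n M E R R' K e) :=
  match e with
  | .toSplit => inferInstanceAs (Fintype (Fin M))
  | .U i => inferInstanceAs (Fintype (Fin (n i)))
  | .V i => inferInstanceAs (Fintype (Fin (n i)))
  | .recv0U i => inferInstanceAs (Fintype (Fin (n i)))
  | .recv01U i => inferInstanceAs (Fintype (Fin (n i)))
  | .recv01V i => inferInstanceAs (Fintype (Fin (n i)))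
  | .midV _ j => inferInstanceAs (Fintype (Fin (n j.1)))
  | .midOut t => inferInstanceAs (Fintype (Fin (E t)))
  | .recv1Src t => inferInstanceAs (Fintype (Fin (R t)))
  | .recv1U _ j => inferInstanceAs (Fintype (Fin (n j)))
  | .mixU t => inferInstanceAs (Fintype (Fin (n t.1.2)))
  | .mixV t => inferInstanceAs (Fintype (Fin (n t.1.2)))
  | .W1 t => inferInstanceAs (Fintype (Fin (n t.1.2)))
  | .W1p0 t => inferInstanceAs (Fintype (Fin (n t.1.2)))
  | .W1p1 t => inferInstanceAs (Fintype (Fin (n t.1.2)))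
  | .W2 t => inferInstanceAs (Fintype (Fin (n t.1.2)))
  | .p0Out t => inferInstanceAs (Fintype (Fin (n t.1.2) × Fin (n t.1.2)))
  | .upperSrc t => inferInstanceAs (Fintype (Fin (R' t)))
  | .upperU _ j => inferInstanceAs (Fintype (Fin (n j.1)))
  | .condV _ j => inferInstanceAs (Fintype (Fin (n j.1)))
  | .condOut t => inferInstanceAs (Fintype (Fin (K t)))
  | .p1V _ j => inferInstanceAs (Fintype (Fin (n j.1)))
  | .W3 t => inferInstanceAs (Fintype (Fin (n t.1.2)))
  | .lowerU _ j => inferInstanceAs (Fintype (Fin (n j.1)))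

variable {n M E R R' K}

/-- The messages of the code for `G†`, in terms of `u = (U_1, …, U_N)` and `x`, where `V i x` is the
value of `V_i` and `f` is used to mix `U_i` and `V_i`. -/
def daggerMsg (V : ∀ i, Fin M → Fin (n i)) (enc : ∀ t, Fin M → Fin (E t))
    (rest : ∀ t, Fin M → Fin (R t)) (rest' : ∀ t, Fin M → Fin (R' t))
    (cnd : ∀ t, Fin M → Fin (K t)) (f : ∀ i, Fin (n i) → Fin (n i) → Fin (n i))
    (u : ∀ i, Fin (n i)) (x : Fin M) : (e : DaggerEdge N) → DaggerMsg n M E R R' K e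
  | .toSplit => x
  | .U i => u i
  | .V i => V i x
  | .recv0U i => u i
  | .recv01U i => u i
  | .recv01V i => V i x
  | .midV _ j => V j.1 x
  | .midOut t => enc t x
  | .recv1Src t => rest t x
  | .recv1U _ j => u j
  | .mixU t => u t.1.2
  | .mixV t => V t.1.2 x
  | .W1 t => f t.1.2 (u t.1.2) (V t.1.2 x)
  | .W1p0 t => f t.1.2 (u t.1.2) (V t.1.2 x)
  | .W1p1 t => f t.1.2 (u t.1.2) (V t.1.2 x)
  | .W2 t => u t.1.2
  | .p0Out t => (u t.1.2, V t.1.2 x)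
  | .upperSrc t => rest' t x
  | .upperU _ j => u j.1
  | .condV _ j => V j.1 x
  | .condOut t => cnd t x
  | .p1V _ j => V j.1 x
  | .W3 t => u t.1.2
  | .lowerU _ j => u j.1

/-- `W₁` is a Latin square entry in `U_i` and `V_i`, which can be solved for either argument. `P₀`
knows `U_i` and recovers `V_i`; `P₁` gets `V_i` from `V_α` and the conditional encoding `cnd`, and
recovers `U_i`. -/
theorem zeroErrorSolvable_dagger {h : Finset (Fin N) → ℝ} [∀ i, NeZero (n i)] [NeZero M]
    (V : ∀ i, Fin M → Fin (n i)) (enc : ∀ t, Fin M → Fin (E t))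
    (rest : ∀ t, Fin M → Fin (R t)) (rest' : ∀ t, Fin M → Fin (R' t))
    (cnd : ∀ t, Fin M → Fin (K t))
    (hfull : ∀ x y, (∀ i, V i x = V i y) → x = y)
    (henc : ∀ t x y, (∀ j ∈ t.1, V j x = V j y) → enc t x = enc t y)
    (hrest : ∀ t x y, enc t x = enc t y → rest t x = rest t y → x = y)
    (hrest' : ∀ t x y, V t.1.2 x = V t.1.2 y → rest' t x = rest' t y → x = y)
    (hcnd : ∀ t x y, (∀ j ∈ insert t.1.2 t.1.1, V j x = V j y) → cnd t x = cnd t y)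
    (hcnd' : ∀ t x y, (∀ j ∈ t.1.1, V j x = V j y) → cnd t x = cnd t y →
      V t.1.2 x = V t.1.2 y)
    (hn : ∀ i, Real.logb 2 (n i) = h {i}) (hM : Real.logb 2 M = h Finset.univ)
    (hE : ∀ t, Real.logb 2 (E t) = h t.1) (hR : ∀ t, Real.logb 2 (R t) = h Finset.univ - h t.1)
    (hR' : ∀ t, Real.logb 2 (R' t) = h Finset.univ - h {t.1.2})
    (hK : ∀ t, Real.logb 2 (K t) = h (insert t.1.2 t.1.1) - h t.1.1) :
    ZeroErrorSolvable (dagger N) (DaggerSrc n M) (daggerCap h) := by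
  choose f hf hf' using fun i => exists_latinSquare (Fin (n i))
  refine ⟨DaggerMsg n M E R R' K, fun e => instFintypeDaggerMsg n M E R R' K e,
    fun e y => daggerMsg V enc rest rest' cnd f (y (0 : Fin 2)) (y (1 : Fin 2)) e,
    fun e => ?_, fun e y y' hv => ?_, fun s v hv y y' ⟨_, he⟩ => ?_⟩
  · have hcard : ∀ k, Real.logb 2 (Fintype.card (Fin k)) = Real.logb 2 k := by simp
    cases e with
    | toSplit => exact ((hcard _).trans hM).le
    | midOut t => exact ((hcard _).trans (hE t)).le
    | recv1Src t => exact ((hcard _).trans (hR t)).le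
    | upperSrc t => exact ((hcard _).trans (hR' t)).le
    | condOut t => exact ((hcard _).trans (hK t)).le
    | p0Out t =>
      change Real.logb 2 (Fintype.card (Fin (n t.1.2) × Fin (n t.1.2))) ≤ 2 * h {t.1.2}
      have : (n t.1.2 : ℝ) ≠ 0 := Nat.cast_ne_zero.2 (NeZero.ne _)
      rw [Fintype.card_prod, Nat.cast_mul, Fintype.card_fin, Real.logb_mul this this, hn]
      linarith
    | _ => exact ((hcard _).trans (hn _)).le
  · obtain ⟨hs, he⟩ := hv
    cases e with
    | toSplit => exact hs (1 : Fin 2) rfl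
    | U i => exact congrFun (hs (0 : Fin 2) rfl) i
    | V i => exact congrArg (V i) (he .toSplit rfl)
    | recv0U i => exact he (.U i) rfl
    | recv01U i => exact he (.U i) rfl
    | recv01V i => exact he (.V i) rfl
    | midV t j => exact he (.V j.1) rfl
    | midOut t => exact henc t _ _ fun j hj => he (.midV t ⟨j, hj⟩) rfl
    | recv1Src t => exact congrArg (rest t) (hs (1 : Fin 2) rfl)
    | recv1U t j => exact he (.U j) rfl
    | mixU t => exact he (.U t.1.2) rfl
    | mixV t => exact he (.V t.1.2) rfl
    | W1 t =>
      exact (congrArg (fun a => f t.1.2 a _) (he (.mixU t) rfl)).trans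
        (congrArg (f t.1.2 _) (he (.mixV t) rfl))
    | W1p0 t => exact he (.W1 t) rfl
    | W1p1 t => exact he (.W1 t) rfl
    | W2 t => exact he (.U t.1.2) rfl
    | p0Out t =>
      have h2 : (y (0 : Fin 2) : ∀ i, Fin (n i)) t.1.2 = (y' (0 : Fin 2) : ∀ i, Fin (n i)) t.1.2 :=
        he (.W2 t) rfl
      have h1 : f t.1.2 ((y (0 : Fin 2) : ∀ i, Fin (n i)) t.1.2) (V t.1.2 (y (1 : Fin 2))) =
          f t.1.2 ((y' (0 : Fin 2) : ∀ i, Fin (n i)) t.1.2) (V t.1.2 (y' (1 : Fin 2))) :=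
        he (.W1p0 t) rfl
      rw [h2] at h1
      exact Prod.ext h2 (hf _ _ h1)
    | upperSrc t => exact congrArg (rest' t) (hs (1 : Fin 2) rfl)
    | upperU t j => exact he (.U j.1) rfl
    | condV t j => exact he (.V j.1) rfl
    | condOut t => exact hcnd t _ _ fun j hj => he (.condV t ⟨j, hj⟩) rfl
    | p1V t j => exact he (.V j.1) rfl
    | W3 t =>
      have h1 : f t.1.2 ((y (0 : Fin 2) : ∀ i, Fin (n i)) t.1.2) (V t.1.2 (y (1 : Fin 2))) =
          f t.1.2 ((y' (0 : Fin 2) : ∀ i, Fin (n i)) t.1.2) (V t.1.2 (y' (1 : Fin 2))) :=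
        he (.W1p1 t) rfl
      rw [hcnd' t _ _ (fun j hj => he (.p1V t ⟨j, hj⟩) rfl) (he (.condOut t) rfl)] at h1
      exact hf' _ _ h1
    | lowerU t j => exact he (.U j.1) rfl
  · have hboth : v ∈ daggerDest (N := N) 1 → y (0 : Fin 2) = y' (0 : Fin 2) ∧
        y (1 : Fin 2) = y' (1 : Fin 2) := by
      rintro (((rfl | ⟨t, rfl⟩) | ⟨t, rfl⟩) | hv)
      · exact ⟨funext fun i => he (.recv01U i) rfl, hfull _ _ fun i => he (.recv01V i) rfl⟩
      · exact ⟨funext fun i => he (.recv1U t i) rfl,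
          hrest t _ _ (he (.midOut t) rfl) (he (.recv1Src t) rfl)⟩
      · have hp := Prod.ext_iff.1 (he (.p0Out t) rfl)
        refine ⟨funext fun i => ?_, hrest' t _ _ hp.2 (he (.upperSrc t) rfl)⟩
        by_cases hi : i = t.1.2
        · subst hi; exact hp.1
        · exact he (.upperU t ⟨i, hi⟩) rfl
      · rw [if_neg (by decide)] at hv
        exact absurd hv (Set.notMem_empty _)
    have hs : ∀ s : Fin 2, s = 0 ∨ s = 1 := by decide
    rcases hs s with rfl | rfl
    · rcases hv with hv | hv
      · exact (hboth (Or.inl hv)).1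
      · rcases hv with rfl | ⟨t, rfl⟩
        · exact funext fun i => he (.recv0U i) rfl
        · refine funext fun i => ?_
          by_cases hi : i = t.1.2
          · subst hi; exact he (.W3 t) rfl
          · exact he (.lowerU t ⟨i, hi⟩) rfl
    · exact (hboth hv).2

end DaggerCode

/-- `h` is the entropy function of variables on a uniform sample space such that the size of a fibre
of `X_α` depends on `α` only. -/
def IsQuasiUniform {N : ℕ} (h : Finset (Fin N) → ℝ) : Prop :=
  ∃ (Q : Type) (_ : Fintype Q) (_ : Nonempty Q) (A : Fin N → Type) (X : (i : Fin N) → Q → A i)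
    (m : Finset (Fin N) → ℕ),
    (open Classical in ∀ α q, (Finset.univ.filter fun q' => ∀ i ∈ α, X i q' = X i q).card = m α) ∧
    ∀ α, h α = Real.logb 2 (Fintype.card Q) - Real.logb 2 (m α)

/-- Given X_α, the finer X_β can be encoded with exactly m(α)/m(β) values, whose logarithm is h(β) -
h(α). Every rate and capacity of the tuple is thus met with equality, without rounding. -/
theorem IsQuasiUniform.exists_securedCode {N : ℕ} {h : Finset (Fin N) → ℝ} (hh : IsQuasiUniform h) :
    ∃ C : NetworkCode (dagger N).secured.toMulticastProblem,
      (∀ e, C.msgBits e ≤ (dagger N).securedCap (daggerRate h) (daggerCap h) e) ∧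
      (∀ s, C.srcBits s = (dagger N).securedRate (daggerRate h) s) ∧ C.errorProb = 0 ∧
      ∀ r, C.leakage ((dagger N).secured.target r) ((dagger N).secured.tap r) = 0 := by
  classical
  obtain ⟨Q, _, _, A, X, m, hm, hh⟩ := hh
  have hm0 : m ∅ = Fintype.card Q := by
    rw [← hm ∅ (Classical.arbitrary Q), Finset.filter_true_of_mem fun q _ i hi =>
      absurd hi (Finset.notMem_empty i), Finset.card_univ]
  have hpos : ∀ α, 0 < m α := fun α => by
    rw [← hm α (Classical.arbitrary Q)]
    exact Finset.card_pos.2 ⟨Classical.arbitrary Q, by simp⟩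
  have henc : ∀ α β : Finset (Fin N), α ⊆ β → m β ∣ m α ∧ ∃ c : Q → Fin (m α / m β),
      (∀ q q', (∀ i ∈ β, X i q = X i q') → c q = c q') ∧
      (∀ q q', (∀ i ∈ α, X i q = X i q') → c q = c q' → ∀ i ∈ β, X i q = X i q') ∧
      ∀ q j, ∃ q', (∀ i ∈ α, X i q' = X i q) ∧ c q' = j := by
    intro α β hαβ
    obtain ⟨h1, c, h2, h3, h4⟩ := exists_encoding (f := fun q (i : α) => X i q)
      (g := fun q (i : β) => X i q) (m := m α) (k := m β)
      (fun q q' h => restrict_eq_iff.2 fun i hi => restrict_eq_iff.1 h i (hαβ hi))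
      (fun q => by simp only [restrict_eq_iff, hm]) (fun q => by simp only [restrict_eq_iff, hm])
    refine ⟨h1, c, fun q q' h => h2 _ _ (restrict_eq_iff.2 h), fun q q' h hc =>
      restrict_eq_iff.1 (h3 _ _ (Prod.ext (restrict_eq_iff.2 h) hc)), fun q j => ?_⟩
    obtain ⟨q', ha, hb⟩ := h4 q j
    exact ⟨q', restrict_eq_iff.1 ha, hb⟩
  choose hdvd c hc hc' hc'' using henc
  have hlog : ∀ α β, α ⊆ β → Real.logb 2 ((m α / m β : ℕ) : ℝ) = h β - h α := by
    intro α β hαβ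
    have hα : (m α : ℝ) ≠ 0 := Nat.cast_ne_zero.2 (hpos α).ne'
    have hβ : (m β : ℝ) ≠ 0 := Nat.cast_ne_zero.2 (hpos β).ne'
    rw [Nat.cast_div (hdvd α β hαβ) hβ, Real.logb_div hα hβ, hh, hh]
    ring
  have hdiv : ∀ α β, α ⊆ β → m α / m β ≠ 0 := fun α β hαβ =>
    (Nat.div_pos (Nat.le_of_dvd (hpos α) (hdvd α β hαβ)) (hpos β)).ne'
  have hh0 : h ∅ = 0 := by rw [hh, hm0, sub_self]
  have he : ∀ β : Finset (Fin N), ∅ ⊆ β := fun β => Finset.empty_subset β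
  -- Session `1` carries the index of the full tuple; `σ` picks a point of `Q` for each index.
  choose σ _ hσ using fun j => hc'' ∅ Finset.univ (he _) (Classical.arbitrary Q) j
  have hσ' : ∀ x y, (∀ i, X i (σ x) = X i (σ y)) → x = y := fun x y hxy => by
    rw [← hσ x, ← hσ y]
    exact hc _ _ _ _ _ fun i _ => hxy i
  have hV : ∀ i x y, c ∅ {i} (he _) (σ x) = c ∅ {i} (he _) (σ y) ↔ X i (σ x) = X i (σ y) :=
    fun i x y => ⟨fun h => hc' _ _ _ _ _ (fun j hj => absurd hj (Finset.notMem_empty j)) h i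
      (Finset.mem_singleton_self i), fun h => hc _ _ _ _ _ fun j hj => by
        rw [Finset.mem_singleton.1 hj]; exact h⟩
  have : ∀ i, NeZero (m ∅ / m {i}) := fun i => ⟨hdiv _ _ (he _)⟩
  have : NeZero (m ∅ / m Finset.univ) := ⟨hdiv _ _ (he _)⟩
  have hn : ∀ i : Fin N, Real.logb 2 ((m ∅ / m {i} : ℕ) : ℝ) = h {i} := fun i => by
    rw [hlog _ _ (he _), hh0, sub_zero]
  have hM : Real.logb 2 ((m ∅ / m Finset.univ : ℕ) : ℝ) = h Finset.univ := by
    rw [hlog _ _ (he _), hh0, sub_zero]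
  have hsolv : ZeroErrorSolvable (dagger N)
      (DaggerSrc (fun i => m ∅ / m {i}) (m ∅ / m Finset.univ)) (daggerCap h) :=
    zeroErrorSolvable_dagger (E := fun t => m ∅ / m t.1) (R := fun t => m t.1 / m Finset.univ)
      (R' := fun t => m {t.1.2} / m Finset.univ)
      (K := fun t => m t.1.1 / m (insert t.1.2 t.1.1))
      (fun i x => c ∅ {i} (he _) (σ x)) (fun t x => c ∅ t.1 (he _) (σ x))
      (fun t x => c t.1 Finset.univ (Finset.subset_univ _) (σ x))
      (fun t x => c {t.1.2} Finset.univ (Finset.subset_univ _) (σ x))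
      (fun t x => c t.1.1 (insert t.1.2 t.1.1) (Finset.subset_insert _ _) (σ x))
      (fun x y hxy => hσ' x y fun i => (hV i x y).1 (hxy i))
      (fun t x y hxy => hc _ _ _ _ _ fun i hi => (hV i x y).1 (hxy i hi))
      (fun t x y h1 h2 => hσ' x y fun i => hc' _ _ _ _ _ (fun j hj =>
        hc' _ _ _ _ _ (fun k hk => absurd hk (Finset.notMem_empty k)) h1 j hj) h2 i
          (Finset.mem_univ i))
      (fun t x y h1 h2 => hσ' x y fun i => hc' _ _ _ _ _ (fun j hj => by
        rw [Finset.mem_singleton.1 hj]; exact (hV _ _ _).1 h1) h2 i (Finset.mem_univ i))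
      (fun t x y hxy => hc _ _ _ _ _ fun i hi => (hV i x y).1 (hxy i hi))
      (fun t x y h1 h2 => (hV _ _ _).2 (hc' _ _ _ _ _ (fun j hj => (hV j x y).1 (h1 j hj)) h2 _
        (Finset.mem_insert_self _ _)))
      hn hM (fun t => by rw [hlog _ _ (he _), hh0, sub_zero])
      (fun t => hlog _ _ (Finset.subset_univ _)) (fun t => hlog _ _ (Finset.subset_univ _))
      (fun t => hlog _ _ (Finset.subset_insert _ _))
  let _ : ∀ s : (dagger N).Session,
      Fintype (DaggerSrc (fun i => m ∅ / m {i}) (m ∅ / m Finset.univ) s) :=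
    instFintypeDaggerSrc _ _
  have : ∀ s : (dagger N).Session,
      Nonempty (DaggerSrc (fun i => m ∅ / m {i}) (m ∅ / m Finset.univ) s) :=
    instNonemptyDaggerSrc _ _
  refine hsolv.exists_securedCode fun s => ?_
  have hs : ∀ s : Fin 2, s = 0 ∨ s = 1 := by decide
  rcases hs s with rfl | rfl
  · change ∑ i, h {i} = Real.logb 2 (Fintype.card (∀ i, Fin (m ∅ / m {i})))
    rw [Fintype.card_pi, Nat.cast_prod, Real.logb_prod _ _ fun i _ =>
      Nat.cast_ne_zero.2 Fintype.card_ne_zero]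
    exact Finset.sum_congr rfl fun i _ => by rw [Fintype.card_fin, hn]
  · change h Finset.univ = Real.logb 2 (Fintype.card (Fin (m ∅ / m Finset.univ)))
    rw [Fintype.card_fin, hM]

/-! ## Quasi-uniform approximation of entropic functions -/

/-- Stirling's formula with log k written as log m + log (k/m). The terms linear in `k` are moved to
the left side because they cancel in multinomial coefficients. -/
theorem tendsto_log_factorial {k : ℕ → ℕ} {x : ℝ}
    (hk : Tendsto (fun m => (k m : ℝ) / m) atTop (𝓝 x)) :
    Tendsto (fun m => (Real.log (k m).factorial - k m * Real.log m + k m) / m) atTop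
      (𝓝 (-Real.negMulLog x)) := by
  have hlog : Tendsto (fun n => Real.log (Stirling.stirlingSeq n)) atTop
      (𝓝 (Real.log √Real.pi)) :=
    (Real.continuousAt_log (Real.sqrt_ne_zero'.2 Real.pi_pos)).tendsto.comp
      Stirling.tendsto_stirlingSeq_sqrt_pi
  obtain ⟨B, hB⟩ := hlog.abs.bddAbove_range
  have hB' : ∀ n, |Real.log (Stirling.stirlingSeq n)| ≤ B := fun n => hB ⟨n, rfl⟩
  have hinv : Tendsto (fun m : ℕ => ((m : ℝ))⁻¹) atTop (𝓝 0) :=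
    tendsto_inv_atTop_zero.comp tendsto_natCast_atTop_atTop
  -- A crude bound is enough, since a square root of order √m is negligible after division by `m`.
  have hlog2 : ∀ n : ℕ, |1 / 2 * Real.log (2 * n)| ≤ √(2 * n) := by
    intro n
    rcases n.eq_zero_or_pos with rfl | hn
    · simp
    have h1 : (1 : ℝ) ≤ n := by exact_mod_cast hn
    have h2 : (0 : ℝ) < 2 * n := by linarith
    rw [abs_of_nonneg (mul_nonneg (by norm_num) (Real.log_nonneg (by linarith)))]
    have := Real.log_le_sub_one_of_pos (Real.sqrt_pos.2 h2)
    rw [Real.log_sqrt h2.le] at this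
    linarith
  have herr : Tendsto (fun m => (Real.log (Stirling.stirlingSeq (k m)) +
      1 / 2 * Real.log (2 * k m)) / m) atTop (𝓝 0) := by
    have hbound : Tendsto (fun m : ℕ => B * ((m : ℝ))⁻¹ + √(2 * ((k m : ℝ) / m) * ((m : ℝ))⁻¹)) atTop
        (𝓝 (B * 0 + √(2 * x * 0))) :=
      (hinv.const_mul B).add (((hk.const_mul 2).mul hinv).sqrt)
    simp only [mul_zero, Real.sqrt_zero, add_zero] at hbound
    refine squeeze_zero_norm' ?_ hbound
    filter_upwards [eventually_gt_atTop 0] with m hm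
    have hm' : (0 : ℝ) < m := Nat.cast_pos.2 hm
    have hsq : √(2 * ((k m : ℝ) / m) * ((m : ℝ))⁻¹) = √(2 * k m) / m := by
      rw [← Real.sqrt_sq hm'.le, ← Real.sqrt_div (by positivity), Real.sqrt_sq hm'.le]
      congr 1
      field_simp
    rw [hsq, ← div_eq_mul_inv, ← add_div, Real.norm_eq_abs, abs_div, abs_of_pos hm']
    gcongr
    exact (abs_add_le _ _).trans (add_le_add (hB' _) (hlog2 _))
  have hmain : Tendsto (fun m => -Real.negMulLog ((k m : ℝ) / m)) atTop (𝓝 (-Real.negMulLog x)) :=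
    ((Real.continuous_negMulLog.tendsto x).comp hk).neg
  have := herr.add hmain
  rw [zero_add] at this
  refine this.congr' ?_
  filter_upwards [eventually_gt_atTop 0] with m hm
  have hm' : (m : ℝ) ≠ 0 := Nat.cast_ne_zero.2 hm.ne'
  have hs := Stirling.log_stirlingSeq_formula (k m)
  rcases (k m).eq_zero_or_pos with h0 | h0
  · simp [h0]
  have h0' : (k m : ℝ) ≠ 0 := Nat.cast_ne_zero.2 h0.ne'
  rw [Real.log_div h0' (Real.exp_ne_zero 1), Real.log_exp] at hs
  rw [Real.negMulLog, Real.log_div h0' hm', hs]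
  field_simp
  ring

/-- The exponential growth rate of multinomial coefficients is an entropy. -/
theorem tendsto_log_multinomial {ι : Type*} (s : Finset ι) {k : ι → ℕ → ℕ} {x : ι → ℝ}
    (hk : ∀ i, Tendsto (fun m => (k i m : ℝ) / m) atTop (𝓝 (x i))) (hx : ∑ i ∈ s, x i = 1) :
    Tendsto (fun m => (Real.log (∑ i ∈ s, k i m).factorial -
      ∑ i ∈ s, Real.log (k i m).factorial) / m) atTop (𝓝 (∑ i ∈ s, Real.negMulLog (x i))) := by
  have h1 : Tendsto (fun m => ((∑ i ∈ s, k i m : ℕ) : ℝ) / m) atTop (𝓝 1) := by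
    rw [← hx]
    simp only [Nat.cast_sum, Finset.sum_div]
    exact tendsto_finsetSum _ fun i _ => hk i
  -- The terms linear in `k` cancel between the total and its parts, and the total contributes
  -- `negMulLog 1 = 0`.
  have h2 := (tendsto_log_factorial h1).sub
    (tendsto_finsetSum s fun i _ => tendsto_log_factorial (hk i))
  simp only [Real.negMulLog_one, neg_zero, Finset.sum_neg_distrib, zero_sub, neg_neg] at h2
  refine h2.congr fun m => ?_
  rw [← Finset.sum_div, ← sub_div, Finset.sum_add_distrib, Finset.sum_sub_distrib,
    ← Finset.sum_mul, Nat.cast_sum]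
  congr 1
  ring

/-- Permuting a list in which `ω` occurs `k ω` times yields quasi-uniform variables. -/
theorem isQuasiUniform_perm {N : ℕ} {Ω : Type} [Fintype Ω] {A : Fin N → Type}
    (X : (i : Fin N) → Ω → A i) (k : Ω → ℕ) :
    open Classical in
    IsQuasiUniform fun α : Finset (Fin N) => (Real.log (∑ ω, k ω).factorial -
      ∑ a ∈ Finset.univ.image (fun ω (i : α) => X i ω),
        Real.log (∑ ω with (fun i : α => X i ω) = a, k ω).factorial) / Real.log 2 := by
  classical
  let S : Type := Σ ω, Fin (k ω)
  let F : ∀ α : Finset (Fin N), S → ∀ i : α, A i := fun α s i => X i s.1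
  refine ⟨Equiv.Perm S, inferInstance, inferInstance, fun i => S → A i, fun i σ s => X i (σ s).1,
    fun α => Fintype.card {τ : Equiv.Perm S // F α ∘ τ = F α}, fun α σ => ?_, fun α => ?_⟩
  · refine Eq.trans ?_ (Fintype.card_subtype fun τ : Equiv.Perm S => F α ∘ τ = F α).symm
    -- The fibre through `σ` is a right coset of the stabilizer of the labelling `F α`, so all
    -- fibres have the same size.
    refine Finset.card_equiv (Equiv.mulRight σ⁻¹) fun τ => ?_
    simp only [Finset.mem_filter, Finset.mem_univ, true_and, Equiv.coe_mulRight]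
    constructor
    · intro h
      funext s i
      simpa [F] using congrFun (h i.1 i.2) (σ⁻¹ s)
    · intro h i hi
      funext s
      simpa [F] using congrFun (congrFun h (σ s)) ⟨i, hi⟩
  · have hcard : Fintype.card (Equiv.Perm S) = (∑ ω, k ω).factorial := by
      rw [Fintype.card_perm, Fintype.card_sigma]
      simp
    have hfib : ∀ a, Fintype.card {s : S // F α s = a} =
        ∑ ω with (fun i : α => X i ω) = a, k ω := by
      intro a
      rw [Fintype.card_subtype, Finset.card_filter, Fintype.sum_sigma, Finset.sum_filter]
      refine Finset.sum_congr rfl fun ω _ => ?_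
      change ∑ _j : Fin (k ω), (if (fun i : α => X i ω) = a then 1 else 0) = _
      rw [Finset.sum_const, Finset.card_univ, Fintype.card_fin]
      split_ifs <;> simp
    have hprod : Fintype.card {τ : Equiv.Perm S // F α ∘ τ = F α} =
        ∏ a ∈ Finset.univ.image (fun ω (i : α) => X i ω),
          (∑ ω with (fun i : α => X i ω) = a, k ω).factorial := by
      -- A stabilizing permutation permutes each class of equal labels separately, hence the product
      -- of factorials.
      rw [DomMulAct.stabilizer_card' (F α)]
      simp only [hfib]
      refine Finset.prod_subset (fun a ha => ?_) fun a _ ha => ?_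
      · obtain ⟨s, -, rfl⟩ := Finset.mem_image.1 ha
        exact Finset.mem_image.2 ⟨s.1, Finset.mem_univ _, rfl⟩
      · rw [← hfib a, Fintype.card_eq_zero_iff.2
          ⟨fun s => ha (Finset.mem_image.2 ⟨s.1, Finset.mem_univ _, s.2⟩)⟩, Nat.factorial_zero]
    simp only [hcard, hprod]
    rw [Nat.cast_prod, Real.logb, Real.logb, Real.log_prod fun a _ =>
      Nat.cast_ne_zero.2 (Nat.factorial_ne_zero _), sub_div]

/-- A list in which each `ω` occurs about `p ω * m` times gives quasi-uniform variables whose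
entropies are logarithms of multinomial coefficients. Rounding up makes the list longer than `m` in
general, but this is negligible in the limit. -/
theorem Entropic.mem_closure {N : ℕ} {h : Finset (Fin N) → ℝ} (hh : Entropic h) :
    h ∈ closure {g | ∃ q r, IsQuasiUniform q ∧ 0 < r ∧ g = fun α => q α / r} := by
  classical
  obtain ⟨Ω, _, p, A, X, hp0, hp1, hh⟩ := hh
  let k : ℕ → Ω → ℕ := fun m ω => ⌈p ω * m⌉₊
  have hk : ∀ ω, Tendsto (fun m => (k m ω : ℝ) / m) atTop (𝓝 (p ω)) := fun ω =>
    (tendsto_nat_ceil_mul_div_atTop (hp0 ω)).comp tendsto_natCast_atTop_atTop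
  have hlim : ∀ α : Finset (Fin N), Tendsto (fun m : ℕ => (Real.log (∑ ω, k m ω).factorial -
      ∑ a ∈ Finset.univ.image (fun ω (i : α) => X i ω),
        Real.log (∑ ω with (fun i : α => X i ω) = a, k m ω).factorial) / Real.log 2 / m) atTop
      (𝓝 (h α)) := by
    intro α
    have hmem : ∀ ω ∈ (Finset.univ : Finset Ω), (fun i : α => X i ω) ∈
        Finset.univ.image (fun ω (i : α) => X i ω) := fun ω hω =>
      Finset.mem_image_of_mem (fun ω (i : α) => X i ω) hω
    have h1 := tendsto_log_multinomial (Finset.univ.image (fun ω (i : α) => X i ω))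
      (k := fun a m => ∑ ω with (fun i : α => X i ω) = a, k m ω)
      (x := fun a => ∑ ω with (fun i : α => X i ω) = a, p ω)
      (fun a => by
        simp only [Nat.cast_sum, Finset.sum_div]
        exact tendsto_finsetSum _ fun ω _ => hk ω)
      (by rw [Finset.sum_fiberwise_of_maps_to hmem, hp1])
    have h2 := h1.div_const (Real.log 2)
    have h3 : (∑ a ∈ Finset.univ.image (fun ω (i : α) => X i ω),
        Real.negMulLog (∑ ω with (fun i : α => X i ω) = a, p ω)) / Real.log 2 = h α := by
      rw [← hh α, entropy]
      simp only [probEq]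
      congr!
    rw [h3] at h2
    refine h2.congr fun m => ?_
    rw [Finset.sum_fiberwise_of_maps_to hmem, div_right_comm]
  refine mem_closure_of_tendsto (tendsto_pi_nhds.2 hlim) ?_
  filter_upwards [eventually_gt_atTop 0] with m hm
  exact ⟨_, m, isQuasiUniform_perm X (k m), Nat.cast_pos.2 hm, rfl⟩

theorem AlmostEntropic.exists_isQuasiUniform {N : ℕ} {h : Finset (Fin N) → ℝ}
    (hh : AlmostEntropic h) : ∃ (q : ℕ → Finset (Fin N) → ℝ) (r : ℕ → ℝ),
      (∀ n, IsQuasiUniform (q n)) ∧ (∀ n, 0 < r n) ∧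
      ∀ α, Tendsto (fun n => q n α / r n) atTop (𝓝 (h α)) := by
  have h1 := closure_minimal (fun g (hg : Entropic g) => hg.mem_closure) isClosed_closure
    (almostEntropic_iff_mem_closure.1 hh)
  obtain ⟨g, hg, hlim⟩ := mem_closure_iff_seq_limit.1 h1
  choose q r hq hr hgq using hg
  refine ⟨q, r, hq, hr, fun α => ?_⟩
  simpa only [hgq] using tendsto_pi_nhds.1 hlim α

/-! ## Achievability of almost entropic functions -/

theorem tendsto_daggerRate {N : ℕ} {q : ℕ → Finset (Fin N) → ℝ} {r : ℕ → ℝ}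
    {h : Finset (Fin N) → ℝ} (hq : ∀ α, Tendsto (fun n => q n α / r n) atTop (𝓝 (h α)))
    (s : (dagger N).Session) :
    Tendsto (fun n => daggerRate (q n) s / r n) atTop (𝓝 (daggerRate h s)) := by
  have hs : ∀ s : Fin 2, s = 0 ∨ s = 1 := by decide
  rcases hs s with rfl | rfl
  · change Tendsto (fun n => (∑ i, q n {i}) / r n) atTop (𝓝 (∑ i, h {i}))
    simp only [Finset.sum_div]
    exact tendsto_finsetSum _ fun i _ => hq {i}
  · exact hq Finset.univ

theorem tendsto_daggerCap {N : ℕ} {q : ℕ → Finset (Fin N) → ℝ} {r : ℕ → ℝ}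
    {h : Finset (Fin N) → ℝ} (hq : ∀ α, Tendsto (fun n => q n α / r n) atTop (𝓝 (h α)))
    (e : (dagger N).Edge) :
    Tendsto (fun n => daggerCap (q n) e / r n) atTop (𝓝 (daggerCap h e)) := by
  have hsub : ∀ α β, Tendsto (fun n => (q n α - q n β) / r n) atTop (𝓝 (h α - h β)) :=
    fun α β => by
      simp only [sub_div]
      exact (hq α).sub (hq β)
  cases e with
  | recv1Src t => exact hsub _ _
  | upperSrc t => exact hsub _ _
  | condOut t => exact hsub _ _
  | p0Out t =>
    change Tendsto (fun n => 2 * q n {t.1.2} / r n) atTop (𝓝 (2 * h {t.1.2}))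
    simp only [mul_div_assoc]
    exact (hq _).const_mul 2
  | _ => exact hq _

theorem MulticastProblem.tendsto_securedRate (P : MulticastProblem) {c' : ℕ → P.Session → ℝ}
    {r : ℕ → ℝ} {c : P.Session → ℝ} (hc : ∀ s, Tendsto (fun n => c' n s / r n) atTop (𝓝 (c s)))
    (s : P.secured.Session) :
    Tendsto (fun n => P.securedRate (c' n) s / r n) atTop (𝓝 (P.securedRate c s)) := by
  simp only [MulticastProblem.securedRate, mul_div_assoc, Finset.sum_div]
  exact (tendsto_finsetSum _ fun s _ => hc s).const_mul 2

theorem MulticastProblem.tendsto_securedCap (P : MulticastProblem) {c' : ℕ → P.Session → ℝ}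
    {cap' : ℕ → P.Edge → ℝ} {r : ℕ → ℝ} {c : P.Session → ℝ} {cap : P.Edge → ℝ}
    (hc : ∀ s, Tendsto (fun n => c' n s / r n) atTop (𝓝 (c s)))
    (hcap : ∀ e, Tendsto (fun n => cap' n e / r n) atTop (𝓝 (cap e))) (e : P.secured.Edge) :
    Tendsto (fun n => P.securedCap (c' n) (cap' n) e / r n) atTop (𝓝 (P.securedCap c cap e)) := by
  cases e with
  | given e => exact hcap e
  | w2 i =>
    change Tendsto (fun n => (2 * (∑ s, c' n s) - c' n i.1.1) / r n) atTop
      (𝓝 (2 * (∑ s, c s) - c i.1.1))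
    simp only [sub_div]
    exact (P.tendsto_securedRate hc ()).sub (hc _)
  | _ => exact hc _

/-- Exact codes for quasi-uniform approximants suffice, because the tuple is linear in `h` and so
converges along with them. -/
theorem achievable_of_almostEntropic {N : ℕ} {h : Finset (Fin N) → ℝ} (hh : AlmostEntropic h) :
    (dagger N).secured.Achievable ((dagger N).securedRate (daggerRate h))
      ((dagger N).securedCap (daggerRate h) (daggerCap h)) := by
  obtain ⟨q, r, hq, hr, hlim⟩ := hh.exists_isQuasiUniform
  choose C hmsg hsrc herr hleak using fun n => (hq n).exists_securedCode
  exact SecureMulticastProblem.achievable_of_tendsto _ hr hmsg hsrc herr hleak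
    ((dagger N).tendsto_securedRate (tendsto_daggerRate hlim))
    ((dagger N).tendsto_securedCap (tendsto_daggerRate hlim) (tendsto_daggerCap hlim))

theorem mainTheorem6 :
    (∀ (P : MulticastProblem) (rate : P.Session → ℝ) (cap : P.Edge → ℝ) (c : P.Session → ℝ),
      (∀ s, c s = Real.logb 2 (⌈(2 : ℝ) ^ rate s⌉₊ : ℝ)) →
      (P.withoutSecrecy.Admissible rate cap ↔
        P.secured.Admissible (P.securedRate c) (P.securedCap c cap))) ∧
    (∀ (N : ℕ) (h : Finset (Fin N) → ℝ), h ∅ = 0 →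
      ((dagger N).secured.Achievable ((dagger N).securedRate (daggerRate h))
          ((dagger N).securedCap (daggerRate h) (daggerCap h)) ↔
        AlmostEntropic h)) :=
  ⟨fun P rate cap c hc => admissible_iff_secured_admissible P rate cap c hc,
    fun _ _ h0 => ⟨almostEntropic_of_achievable h0, achievable_of_almostEntropic⟩⟩
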